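/- **Setting.** A process is a probability measure on $\mathbb R^{\mathbb N}$. For a sequence $x$, $n\in\mathbb N$ and Borel $B\subseteq\mathbb R^u$ let $\mu_n(x,B)$ be the proportion of the $n-u+1$ windows of $u$ consecutive terms of $x_1,\dots,x_n$ that lie in $B$ (and $0$ if $n<u$). A process $\mu$ is stationary if $\mu(X_{1..u}\in B)=\mu(X_{1+j..u+j}\in B)$ for all $u$, $j$ and Borel $B\subseteq\mathbb R^u$; it is stationary ergodic if moreover $\mu_n(x,B)\to\mu(X_{1..u}\in B)$ $\mu$-a.s. for all $u$ and $B$. Let $N\ge1$, $\kappa_1,\dots,\kappa_N\ge 0$, and let $P$ be a probability measure on $\prod_{i=1}^N(\mathbb R^{\mathbb N})^{\kappa_i+1}$. Let $\mu_{i,j}$ be the $P$-marginal of row $j$ of the $i$-th matrix. Assume that every $\mu_{i,j}$ is stationary ergodic and that $\mu_{i,j}\ne\mu_{i,j+1}$; no assumption is made on the dependence between rows or samples. Let $0=\theta^{(i)}_0<\theta^{(i)}_1<\dots<\theta^{(i)}_{\kappa_i+1}<1$ and $\alpha=\min_{i,j}(\theta^{(i)}_j-\theta^{(i)}_{j-1})$.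 For $n\in\mathbb N$ the sample $\mathbf y_i(n)$ has length $\lfloor n\theta^{(i)}_{\kappa_i+1}\rfloor$; its $j$-th segment occupies the positions $\lfloor n\theta^{(i)}_{j-1}\rfloor+1,\dots,\lfloor n\theta^{(i)}_j\rfloor$ and consists of the first terms of row $j$ of the $i$-th matrix. Let $M_i=\{\mu_{i,j}:1\le j\le\kappa_i+1\}$, let $m$ be the number of distinct sets among $M_1,\dots,M_N$, and let the ground-truth clustering $\mathcal G$ be the partition of $\{1,\dots,N\}$ in which $i,i'$ are together iff $M_i=M_{i'}$. **Distance.** Let $w_1,w_2,\dots>0$ be summable (for instance $w_j=1/(j(j+1))$), and let $D:\mathbb N\to\mathbb N\cup\{\infty\}$ with $D(n)\to\infty$. For finite sequences $y,y'$ of lengths $n,n'$ put $$\widehat d(y,y')=\sum_{1\le u,v\le D(\min(n,n'))}w_uw_v\sum_{B\in\Delta_{u,v}}|\mu_n(y,B)-\mu_{n'}(y',B)|,$$ where $\Delta_{u,v}$ is the set of all dyadic cubes $\prod_{j\le u}[k_j2^{-v},(k_j+1)2^{-v})$, $k_j\in\mathbb Z$. **List-estimator.** For $\lambda\in(0,1)$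 and a sample $y$ of length $n$, let $b^t_i=\lfloor n\frac\lambda3(i+\frac1{t+1})\rfloor$ for $t=1,2$, and consider the blocks $[b^t_i,b^t_{i+1}]$ with $1\le i\le\lfloor3/\lambda\rfloor$ and $b^t_{i+2}\le n$. The score of a block is the $\widehat d$-distance of its two halves; its candidate is the first $s\in[b^t_i,b^t_{i+1}]$ that maximises $\widehat d(y_{b^t_{i-1}+1..s},\,y_{s+1..b^t_{i+2}})$. Among the candidates in $[\lambda n,n-\lambda n]$, repeatedly select one of highest score and discard all those at distance less than $\lambda n$ from it. The output is the sorted list of the selected candidates. **Algorithm 1.** Given $y,y'$ of lengths $n_1,n_2$ and $\lambda$: cut $y$ and $y'$ at the points returned by the list-estimator into lists of consecutive segments $S,S'$, let $n=\lfloor\min(\lambda n_1,\lambda n_2)\rfloor$, and return $$\widehat\delta(y,y')=\max_{s\in S}\min_{s'\in S'}\widehat d(s_{1..n},s'_{1..n})+\max_{s'\in S'}\min_{s\in S}\widehat d(s'_{1..n},s_{1..n}).$$ **Algorithm 2.** Given $y_1,\dots,y_N$, $m$ and $\lambda$: put $c_1=1$ and, for $\ell=2,\dots,m$, let $c_\ell$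 be the smallest $i$ that maximises $\min_{j<\ell}\widehat\delta(y_i,y_{c_j})$. Then let $C_\ell$ consist of $c_\ell$ and of all $i$ for which $\ell$ is the smallest index minimising $\widehat\delta(y_i,y_{c_\ell})$. The output is $\{C_1,\dots,C_m\}$. (Other ties are broken by taking the first maximiser in a fixed order.) **Theorem.** (a) For every $\lambda\in(0,\alpha]$, with the correct $m$ as defined above, $P$-almost surely the output of Algorithm 2 on $\mathbf y_1(n),\dots,\mathbf y_N(n)$ equals $\mathcal G$ for all sufficiently large $n$. This holds for every choice of $w$ and $D$ as above, in particular for $D\equiv\infty$ (the full series) and for $D(n)=\lfloor\log_2 n\rfloor$. (b) Let $D(n)=\lfloor\log_2n\rfloor$. There are one program for a real random access machine and constants $c,d$ such that, for all $w$ as above (given as a read-access table), $\lambda\in(0,1)$, $N,m\ge1$, $n\ge2$ and all samples $y_1,\dots,y_N\in\bigcup_{k\le n}\mathbb R^k$, the program computes the clusters $C_1,\dots,C_m$ of Algorithm 2 in at most $$c\,mN\bigl(n^2(\log n)^d+\lambda^{-2}\,n(\log n)^d\bigr)$$ steps. The machine has registers and arrays for natural numbers and for reals; a step is a comparison, an array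 access by a natural-number index, a constant, an addition or truncated subtraction of natural numbers, the conversion of a natural number to a real, or an operation $+,-,\cdot,/,\lfloor\cdot\rfloor$ on reals. -/

import Mathlib

open Filter Topology MeasureTheory

noncomputable section

namespace PSClust

/-! ### Stationary ergodic processes

A stochastic process is a probability measure on `ℕ → ℝ`. Time is indexed from `0`. -/

/-- The window `x_i, …, x_{i+u-1}` of length `u`. -/
def window (x : ℕ → ℝ) (i u : ℕ) : Fin u → ℝ := fun j => x (i + j)

/-- The empirical measure of `B` on the first `n` terms of `x`: the proportion of the
`n - u + 1` windows of length `u` that lie in `B`, and `0` if `n < u`. -/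
def empFreq (n : ℕ) (x : ℕ → ℝ) {u : ℕ} (B : Set (Fin u → ℝ)) : ℝ :=
  if u ≤ n then
    (∑ i ∈ Finset.range (n - u + 1), B.indicator (fun _ => (1 : ℝ)) (window x i u)) /
      ((n - u + 1 : ℕ) : ℝ)
  else 0

/-- Stationarity: all windows of the same length have the same law. -/
def IsStationary (μ : Measure (ℕ → ℝ)) : Prop :=
  ∀ (u : ℕ) (B : Set (Fin u → ℝ)), MeasurableSet B → ∀ j : ℕ,
    μ {x | window x 0 u ∈ B} = μ {x | window x j u ∈ B}

/-- A stationary process is ergodic if all empirical frequencies converge almost surely to the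
probabilities. -/
def IsStationaryErgodic (μ : Measure (ℕ → ℝ)) : Prop :=
  IsStationary μ ∧
    ∀ (u : ℕ) (B : Set (Fin u → ℝ)), MeasurableSet B →
      ∀ᵐ x ∂μ, Tendsto (fun n => empFreq n x B) atTop (𝓝 (μ.real {x | window x 0 u ∈ B}))

/-! ### Piecewise stationary ergodic processes and samples -/

/-- The law of row `j` of a random matrix with `κ + 1` rows and law `ρ`. -/
def rowLaw {κ : ℕ} (ρ : Measure (Fin (κ + 1) → ℕ → ℝ)) (j : Fin (κ + 1)) : Measure (ℕ → ℝ) :=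
  ρ.map (fun x => x j)

/-- The set of stationary-segment distributions of `ρ`. -/
def segmentLaws {κ : ℕ} (ρ : Measure (Fin (κ + 1) → ℕ → ℝ)) : Set (Measure (ℕ → ℝ)) :=
  Set.range (rowLaw ρ)

/-- All rows are stationary ergodic, and consecutive rows have different laws
(the rows may be dependent). -/
def IsPiecewiseStationaryErgodic {κ : ℕ} (ρ : Measure (Fin (κ + 1) → ℕ → ℝ)) : Prop :=
  (∀ j, IsStationaryErgodic (rowLaw ρ j)) ∧
    ∀ j : Fin κ, rowLaw ρ j.castSucc ≠ rowLaw ρ j.succ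

/-- The sample with normalized change points `θ` (where `θ 0 = 0`): segment `j` occupies the
positions from `⌊n θ_j⌋` (included) to `⌊n θ_{j+1}⌋` (excluded) and consists of the first terms of
row `j`. Its total length is `⌊n θ_{κ+1}⌋`. -/
def pwSample {κ : ℕ} (θ : Fin (κ + 2) → ℝ) (x : Fin (κ + 1) → ℕ → ℝ) (n : ℕ) : List ℝ :=
  (List.finRange (κ + 1)).flatMap fun j =>
    List.ofFn fun t : Fin (⌊n * θ j.succ⌋₊ - ⌊n * θ j.castSucc⌋₊) => x j t

/-- The minimum normalized separation between the change points, over all samples. -/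
def minSeparation {N : ℕ} {κ : Fin N → ℕ} (θ : (i : Fin N) → Fin (κ i + 2) → ℝ) : ℝ :=
  ⨅ i : Fin N, ⨅ k : Fin (κ i + 1), (θ i k.succ - θ i k.castSucc)

/-- The law of the random matrix that generates sample `i`. -/
def sampleLaw {N : ℕ} {κ : Fin N → ℕ} (P : Measure ((i : Fin N) → Fin (κ i + 1) → ℕ → ℝ))
    (i : Fin N) : Measure (Fin (κ i + 1) → ℕ → ℝ) :=
  P.map (fun ω => ω i)

/-- The number of distinct classes among the processes that generate the samples. -/
def numClasses {N : ℕ} {κ : Fin N → ℕ} (P : Measure ((i : Fin N) → Fin (κ i + 1) → ℕ → ℝ)) : ℕ :=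
  (Set.range fun i => segmentLaws (sampleLaw P i)).ncard

open Classical in
/-- The ground-truth clustering: two samples are together if and only if their generating processes
have the same set of stationary-segment distributions. -/
def groundTruth {N : ℕ} {κ : Fin N → ℕ} (P : Measure ((i : Fin N) → Fin (κ i + 1) → ℕ → ℝ)) :
    Finset (Finset (Fin N)) :=
  Finset.univ.image fun i =>
    Finset.univ.filter fun j => segmentLaws (sampleLaw P j) = segmentLaws (sampleLaw P i)

/-! ### Empirical distributional distance -/

/-- The dyadic cube of side `2^{-v}` in `ℝ^u` with index `k`. -/
def dyadicCube {u : ℕ} (v : ℕ) (k : Fin u → ℤ) : Set (Fin u → ℝ) :=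
  {x | ∀ j, (k j : ℝ) / 2 ^ v ≤ x j ∧ x j < ((k j : ℝ) + 1) / 2 ^ v}

/-- The empirical distributional distance of two finite sequences,
`∑_{u,v} w_u w_v ∑_B |μ_n(y,B) - μ_{n'}(y',B)|` with `u, v ≥ 1` and `B` ranging over the dyadic
cubes of side `2^{-v}` in `ℝ^u`. The sum is restricted to `u, v ≤ D (min n n')`; the choice
`D = ⊤` gives the full series. -/
def empDist (w : ℕ → ℝ) (D : ℕ → ℕ∞) (y y' : List ℝ) : ℝ :=
  ∑' u : ℕ, ∑' v : ℕ,
    if ((u + 1 : ℕ) : ℕ∞) ≤ D (min y.length y'.length) ∧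
        ((v + 1 : ℕ) : ℕ∞) ≤ D (min y.length y'.length) then
      w (u + 1) * w (v + 1) * ∑' k : Fin (u + 1) → ℤ,
        |empFreq y.length (fun t => y.getD t 0) (dyadicCube (v + 1) k) -
          empFreq y'.length (fun t => y'.getD t 0) (dyadicCube (v + 1) k)|
    else 0

/-! ### The list-estimator of change points -/

/-- The terms of `y` in the positions from `a` (included) to `b` (excluded). -/
def seg (y : List ℝ) (a b : ℕ) : List ℝ := (y.drop a).take (b - a)

/-- The grid points `b_i^t = ⌊n (lam/3) (i + 1/(t+1))⌋`, `t = 1, 2`. -/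
def gridPt (lam : ℝ) (n t i : ℕ) : ℕ := ⌊(n : ℝ) * (lam / 3) * ((i : ℝ) + 1 / ((t : ℝ) + 1))⌋₊

/-- Indices `(t, i)` of the blocks `[b_i^t, b_{i+1}^t]` whose enlargement by a block on each
side, `[b_{i-1}^t, b_{i+2}^t]`, fits in the sample. -/
def blocks (lam : ℝ) (n : ℕ) : List (ℕ × ℕ) :=
  ([1, 2].flatMap fun t => (List.range' 1 ⌊3 / lam⌋₊).map fun i => (t, i)).filter
    fun c => gridPt lam n c.1 (c.2 + 2) ≤ n

/-- The score of a block: the empirical distance of its two halves. -/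
def blockScore (w : ℕ → ℝ) (D : ℕ → ℕ∞) (lam : ℝ) (y : List ℝ) (c : ℕ × ℕ) : ℝ :=
  let a := gridPt lam y.length c.1 c.2
  let b := gridPt lam y.length c.1 (c.2 + 1)
  empDist w D (seg y a ((a + b) / 2)) (seg y ((a + b) / 2) b)

/-- The single-change-point estimate of a block: the first position `s` of the block that maximizes
the empirical distance between what precedes and what follows `s` in the enlarged block. -/
def blockEstimate (w : ℕ → ℝ) (D : ℕ → ℕ∞) (lam : ℝ) (y : List ℝ) (c : ℕ × ℕ) : ℕ :=
  let g := gridPt lam y.length c.1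
  ((List.range' (g c.2) (g (c.2 + 1) - g c.2 + 1)).argmax fun s =>
    empDist w D (seg y (g (c.2 - 1)) s) (seg y s (g (c.2 + 2)))).getD 0

open Classical in
/-- Greedy selection from a list of scored candidates: repeatedly take a candidate of
highest score and discard all candidates at distance less than `r` from it. The first argument bounds
the number of rounds. -/
def greedySelect (r : ℝ) : ℕ → List (ℕ × ℝ) → List ℕ
  | 0, _ => []
  | k + 1, U =>
    match U.argmax Prod.snd with
    | none => []
    | some c => c.1 :: greedySelect r k (U.filter fun d => r ≤ |(d.1 : ℝ) - (c.1 : ℝ)|)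

open Classical in
/-- The scored candidates: the single-change-point estimates of all blocks, as far as they are at
distance at least `lam * n` from both ends of the sample. -/
def scoredCandidates (w : ℕ → ℝ) (D : ℕ → ℕ∞) (lam : ℝ) (y : List ℝ) : List (ℕ × ℝ) :=
  ((blocks lam y.length).map fun c => (blockEstimate w D lam y c, blockScore w D lam y c)).filter
    fun d => 0 < d.1 ∧ lam * y.length ≤ d.1 ∧ (d.1 : ℝ) + lam * y.length ≤ y.length

/-- The list-estimator: a list of candidate change points, at least `lam * n` apart, in increasing
order. -/
def listEstimator (w : ℕ → ℝ) (D : ℕ → ℕ∞) (lam : ℝ) (y : List ℝ) : List ℕ :=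
  (greedySelect (lam * y.length) (scoredCandidates w D lam y).length
    (scoredCandidates w D lam y)).mergeSort

/-! ### The estimate of the distance between samples (first algorithm) -/

/-- The consecutive segments of `y` between the candidate change points. -/
def segments (w : ℕ → ℝ) (D : ℕ → ℕ∞) (lam : ℝ) (y : List ℝ) : List (List ℝ) :=
  List.zipWith (seg y) (0 :: listEstimator w D lam y) (listEstimator w D lam y ++ [y.length])

/-- `max_{s ∈ S} min_{s' ∈ S'}` of the empirical distance of the first `n` terms of `s` and `s'`. -/
def maxMinDist (w : ℕ → ℝ) (D : ℕ → ℕ∞) (n : ℕ) (S S' : List (List ℝ)) : ℝ :=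
  ⨆ a : Fin S.length, ⨅ b : Fin S'.length, empDist w D ((S.get a).take n) ((S'.get b).take n)

/-- The output of the first algorithm. -/
def empDelta (w : ℕ → ℝ) (D : ℕ → ℕ∞) (lam : ℝ) (y y' : List ℝ) : ℝ :=
  let n : ℕ := ⌊min (lam * y.length) (lam * y'.length)⌋₊
  maxMinDist w D n (segments w D lam y) (segments w D lam y') +
    maxMinDist w D n (segments w D lam y') (segments w D lam y)

/-! ### The clustering algorithm (second algorithm) -/

/-- Farthest-point initialisation: the first `ℓ` cluster centres. The first one is sample `0`; each
further one is the first sample that maximizes the minimal distance to the previous centres. -/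
def centres {N : ℕ} [NeZero N] (δ : Fin N → Fin N → ℝ) : ℕ → List (Fin N)
  | 0 => []
  | 1 => [0]
  | ℓ + 2 =>
    let cs := centres δ (ℓ + 1)
    cs ++ [((List.finRange N).argmax fun i => ⨅ j : Fin cs.length, δ i (cs.get j)).getD 0]

/-- Nearest-centre assignment: the first `ℓ < m` for which centre `ℓ` is closest to sample `i`. -/
def label {N : ℕ} [NeZero N] (δ : Fin N → Fin N → ℝ) (m : ℕ) (i : Fin N) : ℕ :=
  ((List.range m).argmin fun ℓ => δ i ((centres δ m).getD ℓ 0)).getD 0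

/-- Cluster `ℓ < m`: its centre and all samples assigned to it. -/
def cluster {N : ℕ} [NeZero N] (δ : Fin N → Fin N → ℝ) (m ℓ : ℕ) : Finset (Fin N) :=
  insert ((centres δ m).getD ℓ 0) (Finset.univ.filter fun i => label δ m i = ℓ)

/-- The `ℓ`-th cluster that the clustering algorithm computes from the samples `S`. -/
def algCluster {N : ℕ} [NeZero N] (w : ℕ → ℝ) (D : ℕ → ℕ∞) (lam : ℝ) (S : Fin N → List ℝ)
    (m ℓ : ℕ) : Finset (Fin N) :=
  cluster (fun i j => empDelta w D lam (S i) (S j)) m ℓ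

/-- The output of the clustering algorithm, as an (unordered) set of clusters. -/
def algOutput {N : ℕ} [NeZero N] (w : ℕ → ℝ) (D : ℕ → ℕ∞) (lam : ℝ) (S : Fin N → List ℝ)
    (m : ℕ) : Finset (Finset (Fin N)) :=
  (Finset.range m).image (algCluster w D lam S m)

/-! ### A real random access machine with step count

A memory state has natural-number and real registers, and natural-number and real arrays. The
arrays have fixed names and are addressed by the content of a natural-number register. -/

structure State where
  nvar : ℕ → ℕ
  rvar : ℕ → ℝ
  narr : ℕ → ℕ → ℕ
  rarr : ℕ → ℕ → ℝ

/-- Elementary instructions. The first argument is the target (register, or array for a store). -/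
inductive Instr where
  | natConst (x k : ℕ)
  | natAdd (x y z : ℕ)
  | natSub (x y z : ℕ)
  | natLoad (x a y : ℕ)
  | natStore (a y x : ℕ)
  | realOfNat (r x : ℕ)
  | realAdd (r s t : ℕ)
  | realSub (r s t : ℕ)
  | realMul (r s t : ℕ)
  | realDiv (r s t : ℕ)
  | realFloor (r s : ℕ)
  | realLoad (r a y : ℕ)
  | realStore (a y r : ℕ)

def State.setN (σ : State) (x k : ℕ) : State := { σ with nvar := Function.update σ.nvar x k }

def State.setR (σ : State) (r : ℕ) (v : ℝ) : State := { σ with rvar := Function.update σ.rvar r v }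

def Instr.apply : Instr → State → State
  | natConst x k, σ => σ.setN x k
  | natAdd x y z, σ => σ.setN x (σ.nvar y + σ.nvar z)
  | natSub x y z, σ => σ.setN x (σ.nvar y - σ.nvar z)
  | natLoad x a y, σ => σ.setN x (σ.narr a (σ.nvar y))
  | natStore a y x, σ =>
    { σ with narr := Function.update σ.narr a (Function.update (σ.narr a) (σ.nvar y) (σ.nvar x)) }
  | realOfNat r x, σ => σ.setR r (σ.nvar x)
  | realAdd r s t, σ => σ.setR r (σ.rvar s + σ.rvar t)
  | realSub r s t, σ => σ.setR r (σ.rvar s - σ.rvar t)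
  | realMul r s t, σ => σ.setR r (σ.rvar s * σ.rvar t)
  | realDiv r s t, σ => σ.setR r (σ.rvar s / σ.rvar t)
  | realFloor r s, σ => σ.setR r (⌊σ.rvar s⌋ : ℤ)
  | realLoad r a y, σ => σ.setR r (σ.rarr a (σ.nvar y))
  | realStore a y r, σ =>
    { σ with rarr := Function.update σ.rarr a (Function.update (σ.rarr a) (σ.nvar y) (σ.rvar r)) }

/-- Structured programs. The tests compare two registers by `<`. -/
inductive Prog where
  | skip
  | instr (c : Instr)
  | seq (p q : Prog)
  | ifNat (x y : ℕ) (p q : Prog)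
  | ifReal (r s : ℕ) (p q : Prog)
  | whileNat (x y : ℕ) (p : Prog)

/-- `Runs p σ σ' t`: started in `σ`, the program `p` halts in `σ'` after `t` steps. Every executed
instruction and every test counts as one step. -/
inductive Runs : Prog → State → State → ℕ → Prop where
  | skip (σ : State) : Runs .skip σ σ 0
  | instr (c : Instr) (σ : State) : Runs (.instr c) σ (c.apply σ) 1
  | seq {p q : Prog} {σ σ₁ σ₂ : State} {s t : ℕ} :
      Runs p σ σ₁ s → Runs q σ₁ σ₂ t → Runs (.seq p q) σ σ₂ (s + t)
  | ifNatTrue {x y : ℕ} {p q : Prog} {σ σ' : State} {t : ℕ} :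
      σ.nvar x < σ.nvar y → Runs p σ σ' t → Runs (.ifNat x y p q) σ σ' (t + 1)
  | ifNatFalse {x y : ℕ} {p q : Prog} {σ σ' : State} {t : ℕ} :
      ¬ σ.nvar x < σ.nvar y → Runs q σ σ' t → Runs (.ifNat x y p q) σ σ' (t + 1)
  | ifRealTrue {r s : ℕ} {p q : Prog} {σ σ' : State} {t : ℕ} :
      σ.rvar r < σ.rvar s → Runs p σ σ' t → Runs (.ifReal r s p q) σ σ' (t + 1)
  | ifRealFalse {r s : ℕ} {p q : Prog} {σ σ' : State} {t : ℕ} :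
      ¬ σ.rvar r < σ.rvar s → Runs q σ σ' t → Runs (.ifReal r s p q) σ σ' (t + 1)
  | whileStop {x y : ℕ} {p : Prog} {σ : State} :
      ¬ σ.nvar x < σ.nvar y → Runs (.whileNat x y p) σ σ 1
  | whileStep {x y : ℕ} {p : Prog} {σ σ₁ σ₂ : State} {s t : ℕ} :
      σ.nvar x < σ.nvar y → Runs p σ σ₁ s → Runs (.whileNat x y p) σ₁ σ₂ t →
        Runs (.whileNat x y p) σ σ₂ (s + t + 1)

/-- The input: `N` and `m` in the natural-number registers `0` and `1`, `lam` in the real register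
`0`, the lengths of the samples in the natural-number array `0`, the concatenated samples in the
real array `0`, and the weights in the real array `1`. All other memory is zero. -/
def inputState {N : ℕ} (w : ℕ → ℝ) (lam : ℝ) (S : Fin N → List ℝ) (m : ℕ) : State where
  nvar x := if x = 0 then N else if x = 1 then m else 0
  rvar r := if r = 0 then lam else 0
  narr a i := if a = 0 then (if h : i < N then (S ⟨i, h⟩).length else 0) else 0
  rarr a i := if a = 0 then (List.ofFn S).flatten.getD i 0 else if a = 1 then w i else 0

/-- The final state holds the clusters `C 0, …, C (m-1)` as an `m × N` table of memberships in the
natural-number array `1`. -/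
def OutputsClusters {N : ℕ} (σ : State) (m : ℕ) (C : ℕ → Finset (Fin N)) : Prop :=
  ∀ ℓ < m, ∀ i : Fin N, σ.narr 1 (ℓ * N + i) = if i ∈ C ℓ then 1 else 0

end PSClust

end

open PSClust

/-!
# Clustering piecewise stationary ergodic samples

**Consistency.** Fix a realization for which the frequencies of all dyadic cubes converge in every
row to the probabilities under the law of the row; almost every realization has this property
(`ae_tendsto_empFamily`), and a law is determined by these probabilities (`lawFamily_injective`).
What remains is deterministic. It suffices to work along an arbitrary ultrafilter `𝒰 ≤ atTop`, where
every sequence of positions `s n ≤ n` has a rate `lim s n / n` (`exists_hasRate`) and every sequence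
of choices from a fixed finite set is eventually constant. A stretch of the sample whose end points have rates
has limiting frequencies: those of one row if it contains no change point in the limit, and a
mixture of those of two consecutive rows if it contains one (`IsGeneric.empTendsto_single`,
`IsGeneric.empTendsto_mix`). By Scheffé's lemma, which controls the infinite sum over the cubes,
the empirical distance of two such stretches tends to the distance of their limits
(`tendsto_empDist`).

Let `L` be the length of the sample. As `L` grows like `Θ n` with `Θ < 1`, an enlarged block of the
list-estimator is asymptotically shorter than `lam * n` and so contains at most one change point. If the point `τ` splits the enlarged
block `[A, B]` of laws `p`, `q`, the distance of the two parts at a splitting point `σ` tends to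
`splitFactor A B τ σ` times the distance of `p` and `q`, and this is maximal at `σ = τ` only. Hence
the estimate of a block around a change point is consistent, its score has a positive limit, and
the score of a block without inner change point tends to zero. The greedy selection drops a
candidate only in favour of one of at least the same score at distance less than `lam * L`, which
must belong to the same change point. So each change point is a limit of selected candidates
(`IsGeneric.exists_mem_listEstimator`). The list may hold further candidates, but these do no harm:
all candidates are at least `lam * L` apart, so the first `lam * L` terms of each estimated segment
lie in one true segment, and all true segments are represented. Therefore the estimated distance of
two samples tends to zero if their sets of laws agree (`IsGeneric.tendsto_empDelta_zero`) and stays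
away from zero otherwise (`IsGeneric.exists_eventually_le_empDelta`). For such a distance the
farthest-point initialisation picks one centre per class (`image_cluster_eq`).

**Running time.** With the cut-off at the logarithm, only the cubes that contain a window of one of the
two sequences contribute to the empirical distance, so that it is a finite sum over window
lengths, levels and positions, in which a cube is accounted for at its first window
(`empDist_eq_stretchDist`). For a pair of samples of total length `Z`, the program first tabulates,
for each window length and level, the number of windows before `k` that share the cube of the window
at `i`, in time `Z ^ 2` up to logarithms (`spec_tableProg`). From this table the distance of any two
stretches is computed in time `Z` up to logarithms (`spec_distProg`). The list-estimator needs
this distance at each position of each of the `2 ⌊3 / lam⌋` blocks, which are `O (n)` positions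
altogether, apart from a constant number for each block, and the
distance between the samples needs it for at most `O (lam ^ (-2))` pairs of segments. The clustering
algorithm computes the distance of each sample to each centre once.

Correctness and step counts of programs are expressed together by `Spec`. The frame rule `Spec.frame`
recovers what a program leaves unchanged from the syntactic condition `Prog.WritesFrom`; a subprogram
writes only registers with larger numbers than those of the loops around it.
-/

noncomputable section

namespace PSClust

/-! ### Reasoning about programs of the real random access machine -/

namespace State

/-- Store in a natural-number array. -/
def storeN (σ : State) (a i k : ℕ) : State :=
  { σ with narr := Function.update σ.narr a (Function.update (σ.narr a) i k) }

/-- Store in a real array. -/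
def storeR (σ : State) (a i : ℕ) (v : ℝ) : State :=
  { σ with rarr := Function.update σ.rarr a (Function.update (σ.rarr a) i v) }

variable (σ : State) (x k y a i j : ℕ) (v : ℝ)

@[simp] theorem nvar_setN : (σ.setN x k).nvar y = if y = x then k else σ.nvar y :=
  Function.update_apply ..
@[simp] theorem rvar_setN : (σ.setN x k).rvar = σ.rvar := rfl
@[simp] theorem narr_setN : (σ.setN x k).narr = σ.narr := rfl
@[simp] theorem rarr_setN : (σ.setN x k).rarr = σ.rarr := rfl
@[simp] theorem nvar_setR : (σ.setR x v).nvar = σ.nvar := rfl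
@[simp] theorem rvar_setR : (σ.setR x v).rvar y = if y = x then v else σ.rvar y :=
  Function.update_apply ..
@[simp] theorem narr_setR : (σ.setR x v).narr = σ.narr := rfl
@[simp] theorem rarr_setR : (σ.setR x v).rarr = σ.rarr := rfl
@[simp] theorem nvar_storeN : (σ.storeN a i k).nvar = σ.nvar := rfl
@[simp] theorem rvar_storeN : (σ.storeN a i k).rvar = σ.rvar := rfl
@[simp] theorem rarr_storeN : (σ.storeN a i k).rarr = σ.rarr := rfl
@[simp] theorem narr_storeN :
    (σ.storeN a i k).narr y j = if y = a ∧ j = i then k else σ.narr y j := by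
  unfold storeN
  by_cases h : y = a
  · subst h; simp [Function.update_apply]
  · simp [h]
@[simp] theorem nvar_storeR : (σ.storeR a i v).nvar = σ.nvar := rfl
@[simp] theorem rvar_storeR : (σ.storeR a i v).rvar = σ.rvar := rfl
@[simp] theorem narr_storeR : (σ.storeR a i v).narr = σ.narr := rfl
@[simp] theorem rarr_storeR :
    (σ.storeR a i v).rarr y j = if y = a ∧ j = i then v else σ.rarr y j := by
  unfold storeR
  by_cases h : y = a
  · subst h; simp [Function.update_apply]
  · simp [h]

end State

/-- Successive execution of a list of instructions. -/
def exec : List Instr → State → State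
  | [], σ => σ
  | c :: cs, σ => exec cs (c.apply σ)

/-- The straight-line program with the given instructions. -/
def line : List Instr → Prog
  | [] => .skip
  | c :: cs => .seq (.instr c) (line cs)

section exec
variable (σ : State) (x y z k r s t a : ℕ) (cs : List Instr)
open Instr
@[simp] theorem exec_nil : exec [] σ = σ := rfl
@[simp] theorem exec_natConst : exec (natConst x k :: cs) σ = exec cs (σ.setN x k) := rfl
@[simp] theorem exec_natAdd : exec (natAdd x y z :: cs) σ = exec cs (σ.setN x (σ.nvar y + σ.nvar z)) := rfl
@[simp] theorem exec_natSub : exec (natSub x y z :: cs) σ = exec cs (σ.setN x (σ.nvar y - σ.nvar z)) := rfl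
@[simp] theorem exec_natLoad : exec (natLoad x a y :: cs) σ = exec cs (σ.setN x (σ.narr a (σ.nvar y))) := rfl
@[simp] theorem exec_natStore : exec (natStore a y x :: cs) σ =
  exec cs (σ.storeN a (σ.nvar y) (σ.nvar x)) := rfl
@[simp] theorem exec_realOfNat : exec (realOfNat r x :: cs) σ = exec cs (σ.setR r (σ.nvar x)) := rfl
@[simp] theorem exec_realAdd : exec (realAdd r s t :: cs) σ =
  exec cs (σ.setR r (σ.rvar s + σ.rvar t)) := rfl
@[simp] theorem exec_realSub : exec (realSub r s t :: cs) σ =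
  exec cs (σ.setR r (σ.rvar s - σ.rvar t)) := rfl
@[simp] theorem exec_realMul : exec (realMul r s t :: cs) σ =
  exec cs (σ.setR r (σ.rvar s * σ.rvar t)) := rfl
@[simp] theorem exec_realDiv : exec (realDiv r s t :: cs) σ =
  exec cs (σ.setR r (σ.rvar s / σ.rvar t)) := rfl
@[simp] theorem exec_realFloor : exec (realFloor r s :: cs) σ =
  exec cs (σ.setR r (⌊σ.rvar s⌋ : ℤ)) := rfl
@[simp] theorem exec_realLoad : exec (realLoad r a y :: cs) σ =
  exec cs (σ.setR r (σ.rarr a (σ.nvar y))) := rfl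
@[simp] theorem exec_realStore : exec (realStore a y r :: cs) σ =
  exec cs (σ.storeR a (σ.nvar y) (σ.rvar r)) := rfl
end exec

/-- `Spec p σ T Q`: started in `σ`, the program `p` halts after at most `T` steps in a state that
satisfies `Q`. -/
def Spec (p : Prog) (σ : State) (T : ℕ) (Q : State → Prop) : Prop :=
  ∃ σ' t, Runs p σ σ' t ∧ t ≤ T ∧ Q σ'

theorem Spec.mono {p σ T T'} {Q Q' : State → Prop} (h : Spec p σ T Q) (hT : T ≤ T')
    (hQ : ∀ τ, Q τ → Q' τ) : Spec p σ T' Q' := by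
  obtain ⟨σ', t, h1, h2, h3⟩ := h
  exact ⟨σ', t, h1, h2.trans hT, hQ _ h3⟩

theorem Spec.skip {σ T} {Q : State → Prop} (h : Q σ) : Spec .skip σ T Q :=
  ⟨σ, 0, .skip σ, Nat.zero_le _, h⟩

theorem Spec.seq {p q σ T T'} {R Q : State → Prop} (h : Spec p σ T R)
    (h' : ∀ τ, R τ → Spec q τ T' Q) : Spec (.seq p q) σ (T + T') Q := by
  obtain ⟨σ₁, s, h1, h2, h3⟩ := h
  obtain ⟨σ₂, t, k1, k2, k3⟩ := h' _ h3
  exact ⟨σ₂, s + t, .seq h1 k1, Nat.add_le_add h2 k2, k3⟩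

theorem Spec.instr {c σ} {T : ℕ} {Q : State → Prop} (hT : 1 ≤ T) (h : Q (c.apply σ)) :
    Spec (.instr c) σ T Q :=
  ⟨_, 1, .instr c σ, hT, h⟩

theorem runs_line (cs : List Instr) (σ : State) : Runs (line cs) σ (exec cs σ) cs.length := by
  induction cs generalizing σ with
  | nil => exact .skip σ
  | cons c cs ih =>
    rw [List.length_cons, Nat.add_comm]
    exact .seq (.instr c σ) (ih _)

theorem Spec.ofLine {cs σ} {T : ℕ} {Q : State → Prop} (hT : cs.length ≤ T) (h : Q (exec cs σ)) :
    Spec (line cs) σ T Q :=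
  ⟨_, _, runs_line cs σ, hT, h⟩

theorem Spec.ifNat {x y p q σ T} {Q : State → Prop}
    (h1 : σ.nvar x < σ.nvar y → Spec p σ T Q) (h2 : ¬ σ.nvar x < σ.nvar y → Spec q σ T Q) :
    Spec (.ifNat x y p q) σ (T + 1) Q := by
  by_cases h : σ.nvar x < σ.nvar y
  · obtain ⟨τ, t, k1, k2, k3⟩ := h1 h
    exact ⟨τ, t + 1, .ifNatTrue h k1, by omega, k3⟩
  · obtain ⟨τ, t, k1, k2, k3⟩ := h2 h
    exact ⟨τ, t + 1, .ifNatFalse h k1, by omega, k3⟩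

theorem Spec.ifReal {r s p q σ T} {Q : State → Prop}
    (h1 : σ.rvar r < σ.rvar s → Spec p σ T Q) (h2 : ¬ σ.rvar r < σ.rvar s → Spec q σ T Q) :
    Spec (.ifReal r s p q) σ (T + 1) Q := by
  by_cases h : σ.rvar r < σ.rvar s
  · obtain ⟨τ, t, k1, k2, k3⟩ := h1 h
    exact ⟨τ, t + 1, .ifRealTrue h k1, by omega, k3⟩
  · obtain ⟨τ, t, k1, k2, k3⟩ := h2 h
    exact ⟨τ, t + 1, .ifRealFalse h k1, by omega, k3⟩

/-- The states agree on all registers below `B` and all arrays below `A`. -/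
structure Agree (B A : ℕ) (σ τ : State) : Prop where
  nvar : ∀ x < B, τ.nvar x = σ.nvar x
  rvar : ∀ x < B, τ.rvar x = σ.rvar x
  narr : ∀ a < A, τ.narr a = σ.narr a
  rarr : ∀ a < A, τ.rarr a = σ.rarr a

theorem Agree.refl (B A : ℕ) (σ : State) : Agree B A σ σ :=
  ⟨fun _ _ => rfl, fun _ _ => rfl, fun _ _ => rfl, fun _ _ => rfl⟩

theorem Agree.trans {B A σ τ υ} (h : Agree B A σ τ) (h' : Agree B A τ υ) : Agree B A σ υ :=
  ⟨fun x hx => (h'.nvar x hx).trans (h.nvar x hx), fun x hx => (h'.rvar x hx).trans (h.rvar x hx),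
    fun x hx => (h'.narr x hx).trans (h.narr x hx), fun x hx => (h'.rarr x hx).trans (h.rarr x hx)⟩

theorem Agree.mono {B A B' A' σ τ} (h : Agree B A σ τ) (hB : B' ≤ B) (hA : A' ≤ A) :
    Agree B' A' σ τ :=
  ⟨fun x hx => h.nvar x (hx.trans_le hB), fun x hx => h.rvar x (hx.trans_le hB),
    fun x hx => h.narr x (hx.trans_le hA), fun x hx => h.rarr x (hx.trans_le hA)⟩

/-- The instruction writes only registers from `B` on and arrays from `A` on. -/
def Instr.WritesFrom (B A : ℕ) : Instr → Bool
  | natConst x _ => B ≤ x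
  | natAdd x _ _ => B ≤ x
  | natSub x _ _ => B ≤ x
  | natLoad x _ _ => B ≤ x
  | natStore a _ _ => A ≤ a
  | realOfNat r _ => B ≤ r
  | realAdd r _ _ => B ≤ r
  | realSub r _ _ => B ≤ r
  | realMul r _ _ => B ≤ r
  | realDiv r _ _ => B ≤ r
  | realFloor r _ => B ≤ r
  | realLoad r _ _ => B ≤ r
  | realStore a _ _ => A ≤ a

/-- The program writes only registers from `B` on and arrays from `A` on. -/
def Prog.WritesFrom (B A : ℕ) : Prog → Bool
  | skip => true
  | instr c => c.WritesFrom B A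
  | seq p q => p.WritesFrom B A && q.WritesFrom B A
  | ifNat _ _ p q => p.WritesFrom B A && q.WritesFrom B A
  | ifReal _ _ p q => p.WritesFrom B A && q.WritesFrom B A
  | whileNat _ _ p => p.WritesFrom B A

theorem Instr.WritesFrom.mono {B A B' A' : ℕ} (hB : B' ≤ B) (hA : A' ≤ A) {c : Instr}
    (h : c.WritesFrom B A) : c.WritesFrom B' A' := by
  cases c <;> simp only [Instr.WritesFrom, decide_eq_true_eq] at h ⊢ <;> omega

theorem Prog.WritesFrom.mono {B A B' A' : ℕ} (hB : B' ≤ B) (hA : A' ≤ A) {p : Prog}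
    (h : p.WritesFrom B A) : p.WritesFrom B' A' := by
  induction p with
  | skip => rfl
  | instr c => exact Instr.WritesFrom.mono hB hA h
  | seq p q ihp ihq | ifNat _ _ p q ihp ihq | ifReal _ _ p q ihp ihq =>
    simp only [WritesFrom, Bool.and_eq_true] at h ⊢
    exact ⟨ihp h.1, ihq h.2⟩
  | whileNat _ _ p ih => exact ih h

theorem Instr.agree {B A : ℕ} {c : Instr} (h : c.WritesFrom B A) (σ : State) :
    Agree B A σ (c.apply σ) := by
  cases c <;> simp only [Instr.WritesFrom, decide_eq_true_eq] at h <;> constructor <;>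
    intro y hy <;> first
    | rfl
    | exact Function.update_of_ne (by omega) _ _

/-- A program changes nothing but the registers and arrays that it may write. -/
theorem Runs.agree {B A : ℕ} {p : Prog} {σ τ t} (hr : Runs p σ τ t) (h : p.WritesFrom B A) :
    Agree B A σ τ := by
  induction hr with
  | skip σ => exact .refl _ _ _
  | instr c σ => exact Instr.agree h σ
  | seq _ _ ih1 ih2 =>
    simp only [Prog.WritesFrom, Bool.and_eq_true] at h
    exact (ih1 h.1).trans (ih2 h.2)
  | ifNatTrue _ _ ih | ifRealTrue _ _ ih =>
    simp only [Prog.WritesFrom, Bool.and_eq_true] at h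
    exact ih h.1
  | ifNatFalse _ _ ih | ifRealFalse _ _ ih =>
    simp only [Prog.WritesFrom, Bool.and_eq_true] at h
    exact ih h.2
  | whileStop _ => exact .refl _ _ _
  | whileStep _ _ _ ih1 ih2 => exact (ih1 h).trans (ih2 h)

/-- The frame rule. -/
theorem Spec.frame {p σ T} {Q : State → Prop} (h : Spec p σ T Q) {B A : ℕ}
    (hw : p.WritesFrom B A) : Spec p σ T (fun τ => Q τ ∧ Agree B A σ τ) := by
  obtain ⟨τ, t, h1, h2, h3⟩ := h
  exact ⟨τ, t, h1, h2, h3, h1.agree hw⟩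

/-- Sequential composition, with the frame of the first part made available to the second. -/
theorem Spec.seqF {p q σ T T'} {R Q : State → Prop} (h : Spec p σ T R) (B A : ℕ)
    (hw : p.WritesFrom B A) (h' : ∀ τ, R τ → Agree B A σ τ → Spec q τ T' Q) :
    Spec (.seq p q) σ (T + T') Q :=
  (h.frame hw).seq fun τ hτ => h' τ hτ.1 hτ.2

/-- The loop that runs `p` for the values `0, …, n - 1` of the register `i`, where `n` is the
content of the register `x`; the register `i + 1` is scratch. -/
def forLoop (i x : ℕ) (p : Prog) : Prog :=
  .seq (.instr (.natConst i 0)) (.whileNat i x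
    (.seq p (.seq (.instr (.natConst (i + 1) 1)) (.instr (.natAdd i i (i + 1))))))

theorem writesFrom_forLoop {i x B A : ℕ} {p : Prog} (hB : B ≤ i) (h : p.WritesFrom B A) :
    (forLoop i x p).WritesFrom B A := by
  simp [forLoop, Prog.WritesFrom, Instr.WritesFrom, h]; omega

/-- The rule for counting loops. The invariant must not depend on the registers `i` and `i + 1`. -/
theorem spec_forLoop {i x A n T : ℕ} {p : Prog} {σ : State} (Inv : ℕ → State → Prop)
    (hp : p.WritesFrom (i + 2) A) (hx : x < i) (hn : σ.nvar x = n)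
    (hI : ∀ k τ a b, Inv k τ → Inv k ((τ.setN (i + 1) a).setN i b))
    (h0 : Inv 0 (σ.setN i 0))
    (hs : ∀ k < n, ∀ τ, Agree i A σ τ → τ.nvar i = k → Inv k τ → Spec p τ T (Inv (k + 1))) :
    Spec (forLoop i x p) σ (n * (T + 3) + 2) (fun τ => Inv n τ ∧ Agree i A σ τ) := by
  have key : ∀ r k τ, k + r = n → Agree i A σ τ → τ.nvar i = k → Inv k τ →
      Spec (.whileNat i x
        (.seq p (.seq (.instr (.natConst (i + 1) 1)) (.instr (.natAdd i i (i + 1)))))) τ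
        (r * (T + 3) + 1) (Inv n) := by
    intro r
    induction r with
    | zero =>
      intro k τ hk hag hi hinv
      have hx' := hag.nvar x hx
      exact ⟨τ, 1, .whileStop (by omega), by omega, by rwa [← hk]⟩
    | succ r ih =>
      intro k τ hk hag hi hinv
      have hx' := hag.nvar x hx
      obtain ⟨τ', t, h1, h2, h3⟩ := hs k (by omega) τ hag hi hinv
      have hag' := h1.agree hp
      have hi' : τ'.nvar i = k := (hag'.nvar i (by omega)).trans hi
      obtain ⟨τ'', t', k1, k2, k3⟩ := ih (k + 1) ((τ'.setN (i + 1) 1).setN i (k + 1)) (by omega)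
        ⟨fun y hy => by
            simp only [State.nvar_setN]
            rw [if_neg (by omega), if_neg (by omega), hag'.nvar y (by omega), hag.nvar y hy],
          fun y hy => by
            simp only [State.rvar_setN]
            rw [hag'.rvar y (by omega), hag.rvar y hy],
          fun y hy => by
            simp only [State.narr_setN]
            rw [hag'.narr y (by omega), hag.narr y hy],
          fun y hy => by
            simp only [State.rarr_setN]
            rw [hag'.rarr y (by omega), hag.rarr y hy]⟩
        (by simp [State.nvar_setN]) (hI _ _ _ _ h3)
      have hstep : Runs (.seq (.instr (.natConst (i + 1) 1)) (.instr (.natAdd i i (i + 1)))) τ'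
          ((τ'.setN (i + 1) 1).setN i (k + 1)) (1 + 1) := by
        have := Runs.seq (Runs.instr (.natConst (i + 1) 1) τ')
          (Runs.instr (.natAdd i i (i + 1)) _)
        convert this using 1
        simp [Instr.apply, State.nvar_setN, hi']
      refine ⟨τ'', _, .whileStep (by omega) (.seq h1 hstep) k1, ?_, k3⟩
      rw [Nat.succ_mul]; omega
  have hw := writesFrom_forLoop (B := i) (x := x) le_rfl (Prog.WritesFrom.mono (by omega) le_rfl hp)
  refine Spec.frame ?_ hw
  have hag0 : Agree i A σ (σ.setN i 0) :=
    Instr.agree (c := .natConst i 0) (by simp [Instr.WritesFrom]) σ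
  refine (Spec.seq (T := 1) (T' := n * (T + 3) + 1) (R := fun τ => τ = σ.setN i 0)
    (Spec.instr le_rfl rfl) ?_).mono (by omega) (fun _ h => h)
  rintro _ rfl
  exact key n 0 _ (by omega) hag0 (by simp [State.nvar_setN]) h0

section
open Instr Prog

/-! ### Standard loops -/

/-- Sum over the values of the counter `i` of the real number that `p` leaves in the real register
`r`; the sum is left in the real register `i + 2`. -/
def sumLoop (i x r : ℕ) (p : Prog) : Prog :=
  .seq (line [natConst i 0, realOfNat (i + 2) i])
    (forLoop i x (.seq p (line [realAdd (i + 2) (i + 2) r])))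

theorem spec_sumLoop {i x r A n T : ℕ} {p : Prog} {σ : State} (f : ℕ → ℝ)
    (hp : p.WritesFrom (i + 3) A) (hx : x < i) (hn : σ.nvar x = n)
    (hs : ∀ k < n, ∀ τ, Agree i A σ τ → τ.nvar i = k → Spec p τ T fun τ' => τ'.rvar r = f k) :
    Spec (sumLoop i x r p) σ (n * (T + 4) + 4)
      (fun τ => τ.rvar (i + 2) = ∑ k ∈ Finset.range n, f k) := by
  refine (Spec.seqF (T := 2) (T' := n * (T + 1 + 3) + 2)
    (R := fun τ => τ.rvar (i + 2) = 0) ?_ i A ?_ ?_).mono (by ring_nf; omega) fun _ h => h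
  · exact Spec.ofLine (by simp) (by simp)
  · simp [line, Prog.WritesFrom, Instr.WritesFrom]
  · intro τ hτ hag
    refine (spec_forLoop (A := A) (n := n) (T := T + 1)
      (fun k υ => υ.rvar (i + 2) = ∑ j ∈ Finset.range k, f j) ?_ hx
      ((hag.nvar x hx).trans hn) (fun _ _ _ _ h => by simpa using h) (by simpa using hτ)
      ?_).mono le_rfl fun _ h => h.1
    · simp [line, Prog.WritesFrom, Instr.WritesFrom]
      exact Prog.WritesFrom.mono (by omega) le_rfl hp
    · intro k hk υ hυ hi hinv
      refine Spec.seqF (hs k hk υ (hag.trans hυ) hi) _ _ hp fun υ' h1 h2 => Spec.ofLine (by simp) ?_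
      have := h2.rvar (i + 2) (by omega)
      simp [h1, this, hinv, Finset.sum_range_succ]

/-- The first value of the counter `i` for which the real number that `p` leaves in the real
register `r` is largest. It is left in the register `i + 2`, and the maximum in the real register
`i + 2`. -/
def argmaxLoop (i x r : ℕ) (p : Prog) : Prog :=
  forLoop i x (.seq p (.seq (line [natConst (i + 3) 1, natConst (i + 4) 0])
    (.seq (.ifNat i (i + 3) (line [natConst (i + 4) 1])
        (.ifReal (i + 2) r (line [natConst (i + 4) 1]) .skip))
      (.ifNat (i + 4) (i + 3) .skip
        (line [natSub (i + 4) (i + 4) (i + 4), natAdd (i + 2) i (i + 4),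
          realSub (i + 2) (i + 2) (i + 2), realAdd (i + 2) (i + 2) r])))))

theorem spec_argmaxLoop {i x r A n T : ℕ} {p : Prog} {σ : State} (f : ℕ → ℝ)
    (hp : p.WritesFrom (i + 3) A) (hx : x < i) (hn : σ.nvar x = n) (hr : i + 2 < r)
    (hs : ∀ k < n, ∀ τ, Agree i A σ τ → τ.nvar i = k → Spec p τ T fun τ' => τ'.rvar r = f k) :
    Spec (argmaxLoop i x r p) σ (n * (T + 15) + 2)
      (fun τ => n ≠ 0 → (List.range n).argmax f = some (τ.nvar (i + 2)) ∧
        τ.rvar (i + 2) = f (τ.nvar (i + 2))) := by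
  refine (spec_forLoop (A := A) (n := n) (T := T + 12)
    (fun k υ => k ≠ 0 → (List.range k).argmax f = some (υ.nvar (i + 2)) ∧
      υ.rvar (i + 2) = f (υ.nvar (i + 2))) ?_ hx hn (fun _ _ _ _ h => by simpa using h)
    (by simp) ?_).mono le_rfl fun _ h => h.1
  · simp [line, Prog.WritesFrom, Instr.WritesFrom]
    exact Prog.WritesFrom.mono (by omega) le_rfl hp
  · intro k hk υ hυ hi hinv
    refine (Spec.seqF (T' := 2 + (3 + 5)) (hs k hk υ hυ hi) _ _ hp fun υ' h1 h2 => ?_).mono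
      (by omega) fun _ h => h
    refine Spec.seq (Spec.ofLine (by simp) rfl) ?_
    rintro _ rfl
    have hi' := (h2.nvar i (by omega)).trans hi
    have e1 := h2.nvar (i + 2) (by omega)
    have e2 := h2.rvar (i + 2) (by omega)
    have hr' : r ≠ i + 2 := by omega
    set b : Prop := k = 0 ∨ f (υ.nvar (i + 2)) < f k with hb
    classical
    -- the register `i + 4` is the flag that the current value is taken
    refine Spec.seq (R := fun τ => Agree (i + 4) A υ' (τ.setN (i + 3) (υ'.nvar (i + 3))) ∧
      τ.rvar = υ'.rvar ∧ τ.nvar (i + 3) = 1 ∧ τ.nvar (i + 4) = if b then 1 else 0) ?_ ?_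
    · refine (Spec.ifNat (T := 2) (fun h => Spec.ofLine (by simp) ?_) (fun h => ?_)).mono
        le_rfl fun _ h => h
      · simp [hi'] at h
        refine ⟨⟨fun y hy => ?_, fun _ _ => rfl, fun _ _ => rfl, fun _ _ => rfl⟩, ?_⟩
        · simp; grind
        · simp [hb, h]
      · simp [hi'] at h
        refine (Spec.ifReal (T := 1) (fun h' => Spec.ofLine (by simp) ?_)
          (fun h' => Spec.skip ?_)).mono le_rfl fun _ h => h
        all_goals
          obtain ⟨-, hbest⟩ := hinv h
          simp [e2, h1, hbest] at h'
          refine ⟨⟨fun y hy => ?_, fun _ _ => rfl, fun _ _ => rfl, fun _ _ => rfl⟩, ?_⟩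
          · simp; grind
          · simp [hb, h, h']
    · rintro τ ⟨hag, hrv, h3, h4⟩
      have hni : τ.nvar i = k := by
        have := hag.nvar i (by omega); simpa [hi'] using this
      have hn2 : τ.nvar (i + 2) = υ.nvar (i + 2) := by
        have := hag.nvar (i + 2) (by omega); simpa [e1] using this
      refine (Spec.ifNat (T := 4) (fun h => Spec.skip ?_)
        (fun h => Spec.ofLine (by simp) ?_)).mono le_rfl fun _ h => h
      · intro _
        have hnb : ¬ b := by
          intro hb'; simp [h3, h4, hb'] at h
        have hk0 : k ≠ 0 := fun h => hnb (Or.inl h)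
        have hlt : ¬ f (υ.nvar (i + 2)) < f k := fun h => hnb (Or.inr h)
        obtain ⟨ha, hbest⟩ := hinv hk0
        rw [hn2, hrv, e2, List.range_succ, List.argmax_concat, ha]
        simp [hlt, hbest]
      · intro _
        have hb' : b := by
          by_contra hb'; simp [h3, h4, hb'] at h
        simp only [exec_natSub, exec_natAdd, exec_realSub, exec_realAdd, exec_nil]
        simp [hni, hrv, h1, hr']
        rw [List.range_succ, List.argmax_concat]
        by_cases hk0 : k = 0
        · simp [hk0]
        · obtain ⟨ha, hbest⟩ := hinv hk0
          rw [ha]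
          have : f (υ.nvar (i + 2)) < f k := hb'.resolve_left hk0
          simp [this]

/-- The binary logarithm of the register `x`, left in the register `i + 2`. -/
def logLoop (i x : ℕ) : Prog :=
  .seq (line [natConst (i + 2) 0, natConst (i + 3) 1, natConst (i + 4) 1])
    (forLoop i x (.seq (line [natAdd (i + 5) (i + 3) (i + 3)])
      (.ifNat x (i + 5) .skip
        (line [natSub (i + 3) (i + 5) i, natAdd (i + 3) (i + 3) i,
          natAdd (i + 2) (i + 2) (i + 4)]))))

theorem spec_logLoop {i x n : ℕ} {σ : State} (hx : x < i) (hn : σ.nvar x = n) :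
    Spec (logLoop i x) σ (n * 8 + 5) (fun τ => τ.nvar (i + 2) = Nat.log 2 n) := by
  refine (Spec.seqF (T := 3) (T' := n * (5 + 3) + 2) (Spec.ofLine (by simp) rfl) i 0 ?_ ?_).mono
    (by omega) fun _ h => h
  · simp [line, Prog.WritesFrom, Instr.WritesFrom]
  rintro _ rfl hag
  refine (spec_forLoop (A := 0) (n := n) (T := 5)
    (fun k υ => υ.nvar (i + 2) = min k (Nat.log 2 n) ∧
      υ.nvar (i + 3) = 2 ^ (min k (Nat.log 2 n)) ∧ υ.nvar (i + 4) = 1) ?_ hx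
      ((hag.nvar x hx).trans hn) (fun _ _ _ _ h => by simpa using h) (by simp)
      ?_).mono le_rfl fun τ h => ?_
  · simp [line, Prog.WritesFrom, Instr.WritesFrom]
  · rintro k hk υ hυ hi ⟨h1, h2, h3⟩
    have hx' := (hag.trans hυ).nvar x hx
    rw [hn] at hx'
    have hxi : x ≠ i + 5 := by omega
    refine (Spec.seq (T := 1) (T' := 4) (Spec.ofLine (by simp) rfl) ?_).mono le_rfl fun _ h => h
    rintro _ rfl
    have hlog : ∀ j, 2 ^ j ≤ n → j ≤ Nat.log 2 n := fun j hj =>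
      (Nat.le_log_iff_pow_le (by norm_num) (by omega)).2 hj
    have hlog' : ∀ j ≤ Nat.log 2 n, 2 ^ j ≤ n := fun j hj =>
      (Nat.le_log_iff_pow_le (by norm_num) (by omega)).1 hj
    refine (Spec.ifNat (T := 3) (fun h => Spec.skip ?_)
        (fun h => Spec.ofLine (by simp) ?_)).mono le_rfl fun _ h => h
    · simp [hx', hxi, h2, ← mul_two, ← pow_succ] at h
      have : ¬ (min k (Nat.log 2 n) + 1 ≤ Nat.log 2 n) := fun h' => by
        have := hlog' _ h'; omega
      have e : min (k + 1) (Nat.log 2 n) = min k (Nat.log 2 n) := by omega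
      simp [h1, h2, h3, e]
    · simp [hx', hxi, h2, ← mul_two, ← pow_succ] at h
      have := hlog _ h
      have e : min (k + 1) (Nat.log 2 n) = min k (Nat.log 2 n) + 1 := by omega
      have e' : min k (Nat.log 2 n) = k := by omega
      have h5 : k ≤ 2 ^ k + 2 ^ k := by have := k.lt_two_pow_self; omega
      rw [e]
      simp only [exec_natSub, exec_natAdd, exec_nil]
      simp [h1, h2, h3, e', hi, pow_succ, mul_two, h5]
  · rw [h.1.1]
    exact min_eq_right (Nat.log_le_self _ _)

/-- The multiples `0, s, 2 s, …` of the register `s`, one for each value of the counter, are left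
in the array `a`, and the next multiple in the register `i + 2`. -/
def multLoop (i x s a : ℕ) : Prog :=
  .seq (line [natConst (i + 2) 0])
    (forLoop i x (line [natStore a i (i + 2), natAdd (i + 2) (i + 2) s]))

theorem spec_multLoop {i x s a n : ℕ} {σ : State} (hx : x < i) (hs : s < i)
    (hn : σ.nvar x = n) :
    Spec (multLoop i x s a) σ (n * 5 + 3) (fun τ => (∀ k < n, τ.narr a k = k * σ.nvar s) ∧
      τ.nvar (i + 2) = n * σ.nvar s ∧ τ.rarr = σ.rarr) := by
  refine (Spec.seqF (T := 1) (T' := n * (2 + 3) + 2) (Spec.ofLine (by simp) rfl) i 0 ?_ ?_).mono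
    (by omega) fun _ h => h
  · simp [line, Prog.WritesFrom, Instr.WritesFrom]
  rintro _ rfl hag
  refine (spec_forLoop (A := 0) (n := n) (T := 2)
    (fun k υ => (∀ j < k, υ.narr a j = j * σ.nvar s) ∧ υ.nvar (i + 2) = k * σ.nvar s ∧
      υ.rarr = σ.rarr) ?_ hx
      ((hag.nvar x hx).trans hn) (fun _ _ _ _ h => by simpa using h) (by simp)
      ?_).mono le_rfl fun τ h => h.1
  · simp [line, Prog.WritesFrom, Instr.WritesFrom]
  · rintro k hk υ hυ hi ⟨h1, h2, h3⟩
    have hs' := (hag.trans hυ).nvar s hs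
    refine Spec.ofLine (by simp) ?_
    simp [hi, h2, hs', Nat.succ_mul, h3]
    intro j hj
    by_cases h : j = k
    · simp [h]
    · simp [h]; exact h1 j (by omega)

/-- The powers `2, 4, 8, …`, one for each value of the counter, are left in the real array `a`. -/
def powLoop (i x a : ℕ) : Prog :=
  .seq (line [natConst i 1, realOfNat (i + 2) i])
    (forLoop i x (line [realAdd (i + 2) (i + 2) (i + 2), realStore a i (i + 2)]))

theorem spec_powLoop {i x a n : ℕ} {σ : State} (hx : x < i) (hn : σ.nvar x = n) :
    Spec (powLoop i x a) σ (n * 5 + 4) (fun τ => ∀ k < n, τ.rarr a k = 2 ^ (k + 1)) := by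
  refine (Spec.seqF (T := 2) (T' := n * (2 + 3) + 2) (Spec.ofLine (by simp) rfl) i 0 ?_ ?_).mono
    (by omega) fun _ h => h
  · simp [line, Prog.WritesFrom, Instr.WritesFrom]
  rintro _ rfl hag
  refine (spec_forLoop (A := 0) (n := n) (T := 2)
    (fun k υ => (∀ j < k, υ.rarr a j = 2 ^ (j + 1)) ∧ υ.rvar (i + 2) = 2 ^ k) ?_ hx
      ((hag.nvar x hx).trans hn) (fun _ _ _ _ h => by simpa using h) (by simp)
      ?_).mono le_rfl fun τ h => h.1.1
  · simp [line, Prog.WritesFrom, Instr.WritesFrom]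
  · rintro k hk υ hυ hi ⟨h1, h2⟩
    refine Spec.ofLine (by simp) ?_
    simp [hi, h2, pow_succ, mul_two]
    intro j hj
    by_cases h : j = k
    · simp [h]
    · simp [h]; rw [h1 j (by omega)]; ring

/-- The natural floor of the real register `r`, capped by the register `x`, left in the register
`i + 2`. -/
def floorLoop (i x r : ℕ) : Prog :=
  .seq (line [natConst (i + 2) 0, natConst (i + 3) 1])
    (forLoop i x (.seq (line [natAdd (i + 4) i (i + 3), realOfNat (i + 2) (i + 4)])
      (.ifReal r (i + 2) .skip (line [natAdd (i + 2) i (i + 3)]))))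

theorem spec_floorLoop {i x r n : ℕ} {σ : State} (hx : x < i) (hr : r < i) (hn : σ.nvar x = n) :
    Spec (floorLoop i x r) σ (n * 7 + 4) (fun τ => τ.nvar (i + 2) = min n ⌊σ.rvar r⌋₊) := by
  refine (Spec.seqF (T := 2) (T' := n * (4 + 3) + 2) (Spec.ofLine (by simp) rfl) i 0 ?_ ?_).mono
    (by omega) fun _ h => h
  · simp [line, Prog.WritesFrom, Instr.WritesFrom]
  rintro _ rfl hag
  refine (spec_forLoop (A := 0) (n := n) (T := 4)
    (fun k υ => υ.nvar (i + 2) = min k ⌊σ.rvar r⌋₊ ∧ υ.nvar (i + 3) = 1) ?_ hx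
      ((hag.nvar x hx).trans hn) (fun _ _ _ _ h => by simpa using h) (by simp)
      ?_).mono le_rfl fun τ h => h.1.1
  · simp [line, Prog.WritesFrom, Instr.WritesFrom]
  · rintro k hk υ hυ hi ⟨h1, h2⟩
    have hr' := (hag.trans hυ).rvar r hr
    have hri : r ≠ i + 2 := by omega
    refine (Spec.seq (T := 2) (T' := 2) (Spec.ofLine (by simp) rfl) ?_).mono le_rfl fun _ h => h
    rintro _ rfl
    have key : ((k : ℝ) + 1 ≤ σ.rvar r) ↔ k + 1 ≤ ⌊σ.rvar r⌋₊ := by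
      rw [Nat.le_floor_iff' (by omega)]; push_cast; rfl
    refine (Spec.ifReal (T := 1) (fun h => Spec.skip ?_)
        (fun h => Spec.ofLine (by simp) ?_)).mono le_rfl fun _ h => h
    · simp [hr', hri, hi, h2] at h
      rw [← not_le, key] at h
      simp [h1, h2]; omega
    · simp [hr', hri, hi, h2] at h
      rw [key] at h
      simp [hi, h2]; omega

end

section
open Instr Prog

/-! ### Computing the empirical distance -/

/-- The windows of length `u` at `i` and `j` lie in the same dyadic cube of side `2 ^ (-v)`. -/
def SameCube (f : ℕ → ℝ) (u v i j : ℕ) : Prop :=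
  ∀ t < u, ⌊f (i + t) * 2 ^ v⌋ = ⌊f (j + t) * 2 ^ v⌋

open Classical in
/-- The number of positions `j < k` whose window lies in the same cube as the window at `i`. -/
def cubeCount (f : ℕ → ℝ) (u v i k : ℕ) : ℕ :=
  ((Finset.range k).filter fun j => SameCube f u v i j).card

/-- The contribution to the empirical distance of the stretches `[a, b)` and `[a', b')` of `f` of
the cube of the window at `i`. A cube is accounted for at its first window only. -/
def cubeTerm (f : ℕ → ℝ) (a b a' b' u v i : ℕ) : ℝ :=
  if 0 < cubeCount f (u + 1) (v + 1) i i then 0 else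
    |((cubeCount f (u + 1) (v + 1) i (b - u) - cubeCount f (u + 1) (v + 1) i a : ℕ) : ℝ) /
        ((b - a - u : ℕ) : ℝ) -
      ((cubeCount f (u + 1) (v + 1) i (b' - u) - cubeCount f (u + 1) (v + 1) i a' : ℕ) : ℝ) /
        ((b' - a' - u : ℕ) : ℝ)|

/-- The empirical distance of the stretches `[a, b)` and `[a', b')` of `f`, cut off at the
logarithm, as a finite sum over window lengths, levels and positions below `Z`. -/
def stretchDist (w f : ℕ → ℝ) (Z a b a' b' : ℕ) : ℝ :=
  ∑ u ∈ Finset.range (Nat.log 2 (min (b - a) (b' - a'))),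
    ∑ v ∈ Finset.range (Nat.log 2 (min (b - a) (b' - a'))),
      w (u + 1) * w (v + 1) * ∑ i ∈ Finset.range Z, cubeTerm f a b a' b' u v i

/-- The memory holds the counts `cubeCount` for the sequence `f`, at the window lengths and levels
up to `Nat.log 2 Z`, in the array `8`; the offsets of the entries are the sums of entries of the
arrays `5`, `6`, `7`. -/
structure TableReady (w f : ℕ → ℝ) (Z : ℕ) (σ : State) : Prop where
  one : σ.nvar 3 = 1
  zero : σ.nvar 4 = 0
  zeroR : σ.rvar 1 = 0
  size : σ.nvar 54 = Z
  weights : σ.rarr 1 = w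
  mul5 : ∀ i < Z, σ.narr 5 i = i * (Z + 1)
  mul6 : ∀ v < Nat.log 2 Z, σ.narr 6 v = v * (Z * (Z + 1))
  mul7 : ∀ u < Nat.log 2 Z, σ.narr 7 u = u * (Nat.log 2 Z * (Z * (Z + 1)))
  table : ∀ u < Nat.log 2 Z, ∀ v < Nat.log 2 Z, ∀ i < Z, ∀ k ≤ Z,
    σ.narr 8 (u * (Nat.log 2 Z * (Z * (Z + 1))) + v * (Z * (Z + 1)) + i * (Z + 1) + k) =
      cubeCount f (u + 1) (v + 1) i k

theorem TableReady.agree {w f Z σ τ B A} (h : TableReady w f Z σ) (hag : Agree B A σ τ)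
    (hB : 55 ≤ B) (hA : 9 ≤ A) : TableReady w f Z τ := by
  have e5 := hag.narr 5 (by omega)
  have e6 := hag.narr 6 (by omega)
  have e7 := hag.narr 7 (by omega)
  have e8 := hag.narr 8 (by omega)
  exact ⟨(hag.nvar 3 (by omega)).trans h.one, (hag.nvar 4 (by omega)).trans h.zero,
    (hag.rvar 1 (by omega)).trans h.zeroR,
    (hag.nvar 54 (by omega)).trans h.size, (hag.rarr 1 (by omega)).trans h.weights,
    by rw [e5]; exact h.mul5, by rw [e6]; exact h.mul6, by rw [e7]; exact h.mul7,
    by rw [e8]; exact h.table⟩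

/-- Computes `cubeTerm` for the stretches in the registers `280`–`283`; window length, level and
position are in the registers `310`, `320`, `330`. The result is left in the real register `340`. -/
def termProg : Prog :=
  .seq (line [natLoad 333 7 310, natLoad 334 6 320, natAdd 333 333 334, natLoad 334 5 330,
    natAdd 333 333 334, natAdd 334 333 330, natLoad 334 8 334])
  (.ifNat 4 334 (line [realSub 340 1 1])
    (.seq (line [natSub 335 281 310, natAdd 335 333 335, natLoad 335 8 335,
      natAdd 336 333 280, natLoad 336 8 336, natSub 335 335 336, natSub 336 300 310,
      realOfNat 340 335, realOfNat 341 336, realDiv 340 340 341,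
      natSub 335 283 310, natAdd 335 333 335, natLoad 335 8 335,
      natAdd 336 333 282, natLoad 336 8 336, natSub 335 335 336, natSub 336 301 310,
      realOfNat 342 335, realOfNat 343 336, realDiv 342 342 343])
    (.ifReal 340 342 (line [realSub 340 342 340]) (line [realSub 340 340 342]))))

theorem spec_termProg {w f Z σ} (h : TableReady w f Z σ) {a b a' b' u v i : ℕ}
    (ha : σ.nvar 280 = a) (hb : σ.nvar 281 = b) (ha' : σ.nvar 282 = a') (hb' : σ.nvar 283 = b')
    (hl : σ.nvar 300 = b - a) (hl' : σ.nvar 301 = b' - a')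
    (hu : σ.nvar 310 = u) (hv : σ.nvar 320 = v) (hi : σ.nvar 330 = i)
    (haZ : a ≤ Z) (hbZ : b ≤ Z) (haZ' : a' ≤ Z) (hbZ' : b' ≤ Z)
    (huK : u < Nat.log 2 Z) (hvK : v < Nat.log 2 Z) (hiZ : i < Z) :
    Spec termProg σ 30 (fun τ => τ.rvar 340 = cubeTerm f a b a' b' u v i) := by
  have m5 := h.mul5 i hiZ
  have m6 := h.mul6 v hvK
  have m7 := h.mul7 u huK
  have tb := h.table u huK v hvK i hiZ
  refine (Spec.seq (T := 7) (T' := 22 + 1) (Spec.ofLine (by simp) rfl) ?_).mono le_rfl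
    fun _ h => h
  rintro _ rfl
  simp only [exec_natLoad, exec_natAdd, exec_nil, State.nvar_setN, State.narr_setN, hu, hv, hi, m5,
    m6, m7, tb i hiZ.le, Nat.reduceEqDiff, if_true, if_false]
  refine Spec.ifNat (fun h0 => ?_) (fun h0 => ?_)
  · refine Spec.ofLine (by simp) ?_
    simp [h.zero] at h0
    simp [cubeTerm, h0]
  · simp [h.zero] at h0
    refine (Spec.seq (T := 20) (T' := 1 + 1) (Spec.ofLine (by simp) rfl) ?_)
    rintro _ rfl
    have t1 := tb (b - u) (by omega)
    have t2 := tb a haZ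
    have t3 := tb (b' - u) (by omega)
    have t4 := tb a' haZ'
    have hn : ¬ 0 < cubeCount f (u + 1) (v + 1) i i := by omega
    refine Spec.ifReal (fun h1 => Spec.ofLine (by simp) ?_) (fun h1 => Spec.ofLine (by simp) ?_)
    · simp [ha, hb, ha', hb', hl, hl', hu, t1, t2, t3, t4] at h1 ⊢
      rw [cubeTerm, if_neg hn, abs_of_neg (sub_neg.2 h1), neg_sub]
    · simp [ha, hb, ha', hb', hl, hl', hu, t1, t2, t3, t4] at h1 ⊢
      rw [cubeTerm, if_neg hn, abs_of_nonneg (sub_nonneg.2 h1)]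

/-- Computes the empirical distance of the stretches `[a, b)` and `[a', b')`; the numbers `a`, `b`,
`a'`, `b'` are in the registers `280`–`283`. The result is left in the real register `312`. -/
def distProg : Prog :=
  .seq (line [natSub 300 281 280, natSub 301 283 282])
  (.seq (.ifNat 300 301 (line [natAdd 302 300 4]) (line [natAdd 302 301 4]))
  (.seq (logLoop 304 302)
    (sumLoop 310 306 322 (sumLoop 320 306 341
      (.seq (sumLoop 330 54 340 termProg)
        (line [natAdd 323 310 3, natAdd 324 320 3, realLoad 341 1 323, realLoad 342 1 324,
          realMul 341 341 342, realMul 341 341 332]))))))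

/-- With the table at hand, each cube of each window length and level takes constant time. -/
theorem spec_distProg {w f Z σ} (h : TableReady w f Z σ) {a b a' b' : ℕ}
    (ha : σ.nvar 280 = a) (hb : σ.nvar 281 = b) (ha' : σ.nvar 282 = a') (hb' : σ.nvar 283 = b')
    (haZ : a ≤ Z) (hbZ : b ≤ Z) (haZ' : a' ≤ Z) (hbZ' : b' ≤ Z) :
    Spec distProg σ (100 * ((Z + 1) * (Nat.log 2 Z + 1) ^ 2))
      (fun τ => τ.rvar 312 = stretchDist w f Z a b a' b') := by
  set M := min (b - a) (b' - a') with hM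
  set D := Nat.log 2 M with hD
  have hDK : D ≤ Nat.log 2 Z := Nat.log_mono_right (by omega)
  have hMZ : M ≤ Z := by omega
  have hT : 2 + (2 + ((M * 8 + 5) + (D * ((D * ((Z * (30 + 4) + 4 + 6) + 4) + 4) + 4) + 4))) ≤
      100 * ((Z + 1) * (Nat.log 2 Z + 1) ^ 2) := by
    calc _ ≤ 2 + (2 + ((Z * 8 + 5) + (Nat.log 2 Z * ((Nat.log 2 Z * ((Z * (30 + 4) + 4 + 6) + 4) + 4)
        + 4) + 4))) := by gcongr
      _ ≤ _ := by
        generalize Nat.log 2 Z = K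
        nlinarith [Nat.zero_le (Z * K), Nat.zero_le (Z * K * K), Nat.zero_le (K * K)]
  refine Spec.mono ?_ hT fun _ h => h
  refine Spec.seqF (Spec.ofLine (by simp) rfl) 300 100 (by decide) ?_
  rintro _ rfl g1
  refine Spec.seqF (R := fun τ => τ.nvar 302 = M)
    ((Spec.ifNat (T := 1) (fun h' => Spec.ofLine (by simp) ?_)
      (fun h' => Spec.ofLine (by simp) ?_)).mono le_rfl fun _ h => h) 302 100 (by decide) ?_
  · simp [ha, hb, ha', hb', h.zero] at h' ⊢; omega
  · simp [ha, hb, ha', hb', h.zero] at h' ⊢; omega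
  rintro τ₂ h2 g2
  refine Spec.seqF (spec_logLoop (by norm_num) h2) 304 100 (by decide) ?_
  rintro τ₃ h3 g3
  have l0 : τ₃.nvar 300 = b - a := by
    rw [g3.nvar _ (by norm_num), g2.nvar _ (by norm_num)]; simp [ha, hb]
  have l1 : τ₃.nvar 301 = b' - a' := by
    rw [g3.nvar _ (by norm_num), g2.nvar _ (by norm_num)]; simp [ha', hb']
  have g : Agree 300 100 σ τ₃ := (g1.trans (g2.mono (by norm_num) le_rfl)).trans
    (g3.mono (by norm_num) le_rfl)
  refine spec_sumLoop (A := 100) _ (by decide) (by norm_num) h3 fun u hu τ₄ g4 i4 => ?_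
  refine spec_sumLoop (A := 100) _ (by decide) (by norm_num) ((g4.nvar _ (by norm_num)).trans h3)
    fun v hv τ₅ g5 i5 => ?_
  have e5 : ∀ x < 310, τ₅.nvar x = τ₃.nvar x := fun x hx =>
    (g5.nvar x (by omega)).trans (g4.nvar x hx)
  have hag5 : Agree 300 100 σ τ₅ := (g.trans (g4.mono (by norm_num) le_rfl)).trans
    (g5.mono (by norm_num) le_rfl)
  have i5' : τ₅.nvar 310 = u := (g5.nvar _ (by norm_num)).trans i4
  have R5 := h.agree hag5 (by norm_num) (by norm_num)
  refine Spec.seqF (T := Z * (30 + 4) + 4) (T' := 6) (spec_sumLoop (A := 100) (i := 330) (x := 54) (r := 340) (p := termProg)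
    (f := fun i => cubeTerm f a b a' b' u v i)
    (by decide) (by norm_num) R5.size fun i hi τ₆ g6 i6 => ?_) 330 100 (by decide) ?_
  · have hag6 := hag5.trans (g6.mono (by norm_num) le_rfl)
    have e6 : ∀ x < 310, τ₆.nvar x = τ₃.nvar x := fun x hx =>
      (g6.nvar x (by omega)).trans (e5 x hx)
    exact spec_termProg (R5.agree g6 (by norm_num) (by norm_num))
      (by rw [hag6.nvar _ (by norm_num), ha]) (by rw [hag6.nvar _ (by norm_num), hb])
      (by rw [hag6.nvar _ (by norm_num), ha']) (by rw [hag6.nvar _ (by norm_num), hb'])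
      (by rw [e6 _ (by norm_num), l0]) (by rw [e6 _ (by norm_num), l1])
      ((g6.nvar _ (by norm_num)).trans i5')
      ((g6.nvar _ (by norm_num)).trans i5) i6 haZ hbZ haZ' hbZ' (by omega) (by omega) hi
  · intro τ₇ h7 g7
    refine Spec.ofLine (by simp) ?_
    have R7 := R5.agree g7 (by norm_num) (by norm_num)
    simp [h7, R7.weights, R7.one, (g7.nvar 310 (by norm_num)).trans i5',
      (g7.nvar 320 (by norm_num)).trans i5]

end

section
open Instr Prog

/-! ### Tabulating the counts of the dyadic cubes -/

theorem cubeCount_zero (f : ℕ → ℝ) (u v i : ℕ) : cubeCount f u v i 0 = 0 := by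
  simp [cubeCount]

open Classical in
theorem cubeCount_succ (f : ℕ → ℝ) (u v i k : ℕ) :
    cubeCount f u v i (k + 1) = cubeCount f u v i k + if SameCube f u v i k then 1 else 0 := by
  unfold cubeCount
  rw [Finset.range_add_one, Finset.filter_insert]
  split_ifs <;> simp

/-- Compares the windows at the positions in the registers `130` and `140`, of length in the
register `123`; the register `154` is left at `0` if they lie in the same cube, and at `1`
otherwise. -/
def matchProg : Prog :=
  .seq (line [natConst 154 0])
    (forLoop 150 123
      (.seq (line [natAdd 152 130 150, realLoad 152 5 152, realMul 152 152 122, realFloor 152 152,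
          natAdd 153 140 150, realLoad 153 5 153, realMul 153 153 122, realFloor 153 153])
        (.seq (.ifReal 152 153 (line [natConst 154 1]) .skip)
          (.ifReal 153 152 (line [natConst 154 1]) .skip))))

theorem spec_matchProg {f : ℕ → ℝ} {u v i j : ℕ} {σ : State} (hf : σ.rarr 5 = f)
    (hu : σ.nvar 123 = u) (hv : σ.rvar 122 = 2 ^ v) (hi : σ.nvar 130 = i) (hj : σ.nvar 140 = j) :
    Spec matchProg σ (u * 15 + 3) (fun τ => (τ.nvar 154 = 0 ∧ SameCube f u v i j) ∨
      (τ.nvar 154 = 1 ∧ ¬ SameCube f u v i j)) := by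
  refine (Spec.seqF (T := 1) (T' := u * (12 + 3) + 2) (Spec.ofLine (by simp) rfl) 150 8
    (by decide) ?_).mono (by omega) fun _ h => h
  rintro _ rfl g
  refine (spec_forLoop (A := 8) (n := u) (T := 12)
    (fun k τ => (τ.nvar 154 = 0 ∧ SameCube f k v i j) ∨ (τ.nvar 154 = 1 ∧ ¬ SameCube f k v i j))
    (by decide) (by norm_num) (by simpa using hu) (fun _ _ _ _ h => by simpa using h)
    (by simp [SameCube]) ?_).mono le_rfl fun _ h => h.1
  intro k hk τ hτ ik hinv
  have hs : SameCube f (k + 1) v i j ↔ SameCube f k v i j ∧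
      ⌊f (i + k) * 2 ^ v⌋ = ⌊f (j + k) * 2 ^ v⌋ := by
    simp only [SameCube, Nat.lt_succ_iff_lt_or_eq, or_imp, forall_and, forall_eq]
  have g' := g.trans hτ
  have hf' : τ.rarr 5 = f := (g'.rarr 5 (by norm_num)).trans hf
  have hv' : τ.rvar 122 = 2 ^ v := (g'.rvar 122 (by norm_num)).trans hv
  have hi' : τ.nvar 130 = i := (g'.nvar 130 (by norm_num)).trans hi
  have hj' : τ.nvar 140 = j := (g'.nvar 140 (by norm_num)).trans hj
  refine (Spec.seq (T := 8) (T' := 2 + 2) (Spec.ofLine (by simp) rfl) ?_).mono le_rfl fun _ h => h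
  rintro _ rfl
  refine Spec.seq (R := fun τ' => τ'.rvar 152 = (⌊f (i + k) * 2 ^ v⌋ : ℤ) ∧
    τ'.rvar 153 = (⌊f (j + k) * 2 ^ v⌋ : ℤ) ∧
    ((τ'.nvar 154 = 0 ∧ SameCube f k v i j ∧ ¬ ⌊f (i + k) * 2 ^ v⌋ < ⌊f (j + k) * 2 ^ v⌋) ∨
      (τ'.nvar 154 = 1 ∧ (¬ SameCube f k v i j ∨ ⌊f (i + k) * 2 ^ v⌋ < ⌊f (j + k) * 2 ^ v⌋))))
    (Spec.ifReal (T := 1) (fun h' => Spec.ofLine (by simp) ?_) (fun h' => Spec.skip ?_)) ?_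
  · simp [hi', hj', hf', hv', ik] at h' ⊢
    exact Or.inr h'
  · simp [hi', hj', hf', hv', ik] at h' ⊢
    rcases hinv with h | h
    · exact Or.inl ⟨h.1, h.2, h'⟩
    · exact Or.inr ⟨h.1, Or.inl h.2⟩
  · rintro υ ⟨h1, h2, h3⟩
    refine Spec.ifReal (T := 1) (fun h' => Spec.ofLine (by simp) ?_) (fun h' => Spec.skip ?_)
    · rw [h1, h2, Int.cast_lt] at h'
      refine Or.inr ⟨by simp, ?_⟩
      rw [hs]
      rintro ⟨-, h⟩
      omega
    · rw [h1, h2, Int.cast_lt] at h'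
      rw [hs]
      rcases h3 with h | h
      · exact Or.inl ⟨h.1, h.2.1, by omega⟩
      · refine Or.inr ⟨h.1, ?_⟩
        rcases h.2 with h | h
        · exact fun h' => h h'.1
        · rintro ⟨-, h⟩
          omega

/-- The entry of the table of counts at the address `p`. -/
def tableEntry (f : ℕ → ℝ) (Z p : ℕ) : ℕ :=
  cubeCount f (p / (Nat.log 2 Z * (Z * (Z + 1))) + 1) (p / (Z * (Z + 1)) % Nat.log 2 Z + 1)
    (p / (Z + 1) % Z) (p % (Z + 1))

theorem tableEntry_eq (f : ℕ → ℝ) {Z u v i k : ℕ} (hv : v < Nat.log 2 Z) (hi : i < Z)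
    (hk : k ≤ Z) :
    tableEntry f Z (u * (Nat.log 2 Z * (Z * (Z + 1))) + v * (Z * (Z + 1)) + i * (Z + 1) + k) =
      cubeCount f (u + 1) (v + 1) i k := by
  unfold tableEntry
  generalize Nat.log 2 Z = K at *
  set p := u * (K * (Z * (Z + 1))) + v * (Z * (Z + 1)) + i * (Z + 1) + k with hp
  have h1 : p = (Z + 1) * ((u * K + v) * Z + i) + k := by rw [hp]; ring
  have h2 : p % (Z + 1) = k := by
    rw [h1, Nat.mul_add_mod, Nat.mod_eq_of_lt (by omega)]
  have h3 : p / (Z + 1) = (u * K + v) * Z + i := by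
    rw [h1, Nat.mul_add_div (by omega), Nat.div_eq_of_lt (by omega), add_zero]
  have h4 : p / (Z + 1) % Z = i := by
    rw [h3, mul_comm, Nat.mul_add_mod, Nat.mod_eq_of_lt hi]
  have h5 : p / (Z * (Z + 1)) = u * K + v := by
    rw [mul_comm, ← Nat.div_div_eq_div_mul, h3, mul_comm, Nat.mul_add_div (by omega),
      Nat.div_eq_of_lt hi, add_zero]
  have h6 : p / (Z * (Z + 1)) % K = v := by
    rw [h5, mul_comm, Nat.mul_add_mod, Nat.mod_eq_of_lt hv]
  have h7 : p / (K * (Z * (Z + 1))) = u := by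
    rw [mul_comm, ← Nat.div_div_eq_div_mul, h5, mul_comm, Nat.mul_add_div (by omega),
      Nat.div_eq_of_lt hv, add_zero]
  rw [h2, h4, h6, h7]

/-- Fills one row of the table: the counts for one position. -/
def rowProg : Prog :=
  .seq (line [natLoad 132 5 130, natAdd 132 122 132, natConst 144 0])
    (forLoop 140 55 (.seq (line [natAdd 142 132 140, natStore 8 142 144])
      (.seq matchProg (.ifNat 154 3 (line [natAdd 144 144 3]) .skip))))

theorem spec_rowProg {f : ℕ → ℝ} {Z u v i : ℕ} {σ : State} (h1 : σ.nvar 3 = 1)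
    (hZ : σ.nvar 55 = Z + 1) (hf : σ.rarr 5 = f)
    (hu : σ.nvar 123 = u + 1) (hv : σ.rvar 122 = 2 ^ (v + 1)) (hi : σ.nvar 130 = i)
    (hm : σ.narr 5 i = i * (Z + 1))
    (hb : σ.nvar 122 = u * (Nat.log 2 Z * (Z * (Z + 1))) + v * (Z * (Z + 1)))
    (hvK : v < Nat.log 2 Z) (hiZ : i < Z)
    (hF : ∀ p < u * (Nat.log 2 Z * (Z * (Z + 1))) + v * (Z * (Z + 1)) + i * (Z + 1),
      σ.narr 8 p = tableEntry f Z p) :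
    Spec rowProg σ ((Z + 1) * (((u + 1) * 15 + 7) + 3) + 5) (fun τ =>
      ∀ p < u * (Nat.log 2 Z * (Z * (Z + 1))) + v * (Z * (Z + 1)) + (i + 1) * (Z + 1),
      τ.narr 8 p = tableEntry f Z p) := by
  have hE := fun k (hk : k ≤ Z) => tableEntry_eq f (u := u) hvK hiZ hk
  generalize hbase : u * (Nat.log 2 Z * (Z * (Z + 1))) + v * (Z * (Z + 1)) = base at *
  refine (Spec.seqF (T := 3) (T' := (Z + 1) * (((u + 1) * 15 + 7) + 3) + 2)
    (Spec.ofLine (by simp) rfl) 132 8 (by decide) ?_).mono (by omega) fun _ h => h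
  rintro _ rfl g
  refine (spec_forLoop (A := 8) (n := Z + 1)
    (fun k τ => (∀ p < base + i * (Z + 1) + k, τ.narr 8 p = tableEntry f Z p) ∧
      τ.nvar 144 = cubeCount f (u + 1) (v + 1) i k)
    (by decide) (by norm_num) (by simpa using hZ) (fun _ _ _ _ h => by simpa using h)
    (by simpa [cubeCount_zero] using hF) ?_).mono le_rfl fun _ h => ?_
  · rintro k hk τ hτ ik ⟨hinv, hcnt⟩
    have g' := g.trans (hτ.mono (by norm_num) le_rfl)
    have e132 : τ.nvar 132 = base + i * (Z + 1) := by
      rw [hτ.nvar 132 (by norm_num)]; simp [hi, hm, hb]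
    refine (Spec.seqF (T := 2) (T' := ((u + 1) * 15 + 3) + 2)
      (Spec.ofLine (by simp) rfl) 142 8 (by decide) ?_).mono (by omega) fun _ h => h
    rintro _ rfl g2
    have g3 := g'.trans (g2.mono (by norm_num) le_rfl)
    refine Spec.seqF (spec_matchProg (j := k) ((g3.rarr 5 (by norm_num)).trans hf)
      ((g3.nvar 123 (by norm_num)).trans hu) ((g3.rvar 122 (by norm_num)).trans hv)
      ((g3.nvar 130 (by norm_num)).trans hi) ((g2.nvar 140 (by norm_num)).trans ik)) 150 100
      (by decide) ?_
    intro υ hm g4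
    have q1 : υ.nvar 3 = 1 := by
      rw [g4.nvar 3 (by norm_num), g3.nvar 3 (by norm_num), h1]
    have q2 : υ.nvar 144 = cubeCount f (u + 1) (v + 1) i k := by
      rw [g4.nvar 144 (by norm_num)]; simpa using hcnt
    have q3 : ∀ p < base + i * (Z + 1) + (k + 1), υ.narr 8 p = tableEntry f Z p := by
      intro p hp
      rw [g4.narr 8 (by norm_num)]
      simp [e132, ik, hcnt]
      split_ifs with h
      · subst h
        rw [← hbase, ← hE k (by omega), ← hbase]
      · exact hinv p (by omega)
    refine Spec.ifNat (T := 1) (fun h' => Spec.ofLine (by simp) ?_) (fun h' => Spec.skip ?_)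
    · refine ⟨by simpa using q3, ?_⟩
      rcases hm with h | h
      · simp [q1, q2, cubeCount_succ, h.2]
      · omega
    · refine ⟨q3, ?_⟩
      rcases hm with h | h
      · omega
      · simp [q2, cubeCount_succ, h.2]
  · have := h.1.1
    intro p hp
    exact this p (by rw [Nat.succ_mul] at hp; omega)

/-- Prepares the table of counts for the sequence in the real array `5`, whose length is in the
register `54`. -/
def tableProg : Prog :=
  .seq (logLoop 60 54) (.seq (powLoop 64 62 6) (.seq (multLoop 70 54 55 5)
    (.seq (multLoop 80 62 72 6) (.seq (multLoop 90 62 82 7)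
      (forLoop 110 62 (forLoop 120 62
        (.seq (line [natLoad 122 7 110, natLoad 123 6 120, natAdd 122 122 123, realLoad 122 6 120,
            natAdd 123 110 3])
          (forLoop 130 54 rowProg))))))))

/-- Each of the `Z ^ 2 * (log Z) ^ 2` entries of the table needs one comparison of windows of length at
most `log Z`. -/
theorem spec_tableProg {w : ℕ → ℝ} {Z : ℕ} {σ : State} (h1 : σ.nvar 3 = 1) (h0 : σ.nvar 4 = 0)
    (h0' : σ.rvar 1 = 0) (hw : σ.rarr 1 = w) (hZ : σ.nvar 54 = Z) (hZ1 : σ.nvar 55 = Z + 1) :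
    Spec tableProg σ (150 * ((Z + 1) ^ 2 * (Nat.log 2 Z + 1) ^ 3))
      (fun τ => TableReady w (σ.rarr 5) Z τ ∧ τ.rarr 5 = σ.rarr 5) := by
  set K := Nat.log 2 Z with hK
  have hT : (Z * 8 + 5) + ((K * 5 + 4) + ((Z * 5 + 3) + ((K * 5 + 3) + ((K * 5 + 3) +
      (K * ((K * ((5 + (Z * (((Z + 1) * ((K * 15 + 7) + 3) + 5) + 3) + 2)) + 3) + 2) + 3)
        + 2))))) ≤ 150 * ((Z + 1) ^ 2 * (K + 1) ^ 3) := by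
    ring_nf
    nlinarith [Nat.zero_le (Z * K), Nat.zero_le (Z * K^2), Nat.zero_le (Z * K^3), Nat.zero_le (K^2),
      Nat.zero_le (K^3), Nat.zero_le (Z^2 * K), Nat.zero_le (Z^2 * K^2), Nat.zero_le (Z^2 * K^3),
      Nat.zero_le (Z^2)]
  refine Spec.mono ?_ hT fun _ h => h
  refine Spec.seqF (spec_logLoop (by norm_num) hZ) 60 100 (by decide) fun τ₁ a1 g1 => ?_
  refine Spec.seqF (spec_powLoop (by norm_num) a1) 64 6 (by decide) fun τ₂ a2 g2 => ?_
  have f2 := (g1.mono (B' := 60) (A' := 5) (by norm_num) (by norm_num)).trans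
    (g2.mono (by norm_num) (by norm_num))
  have b2 : τ₂.nvar 62 = K := (g2.nvar 62 (by norm_num)).trans a1
  have c2 : τ₂.rarr 5 = σ.rarr 5 := by rw [g2.rarr 5 (by norm_num), g1.rarr 5 (by norm_num)]
  refine Spec.seqF (spec_multLoop (by norm_num) (by norm_num)
    ((f2.nvar 54 (by norm_num)).trans hZ)) 70 5 (by decide) fun τ₃ a3 g3 => ?_
  have f3 := f2.trans (g3.mono (by norm_num) (by norm_num))
  rw [f2.nvar 55 (by norm_num), hZ1] at a3
  have b3 : τ₃.nvar 62 = K := (g3.nvar 62 (by norm_num)).trans b2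
  refine Spec.seqF (spec_multLoop (by norm_num) (by norm_num) b3) 80 6 (by decide)
    fun τ₄ a4 g4 => ?_
  have f4 := f3.trans (g4.mono (by norm_num) (by norm_num))
  rw [a3.2.1] at a4
  have b4 : τ₄.nvar 62 = K := (g4.nvar 62 (by norm_num)).trans b3
  refine Spec.seqF (spec_multLoop (by norm_num) (by norm_num) b4) 90 7 (by decide)
    fun τ₅ a5 g5 => ?_
  have f5 := f4.trans (g5.mono (by norm_num) (by norm_num))
  rw [a4.2.1] at a5
  have b5 : τ₅.nvar 62 = K := (g5.nvar 62 (by norm_num)).trans b4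
  have r5 : τ₅.rarr = τ₂.rarr := by rw [a5.2.2, a4.2.2, a3.2.2]
  have m5 : ∀ i < Z, τ₅.narr 5 i = i * (Z + 1) := by
    rw [g5.narr 5 (by norm_num), g4.narr 5 (by norm_num)]; exact a3.1
  have m6 : ∀ v < K, τ₅.narr 6 v = v * (Z * (Z + 1)) := by
    rw [g5.narr 6 (by norm_num)]; exact a4.1
  have m7 := a5.1
  have hz : τ₅.rarr 5 = σ.rarr 5 := by rw [r5, c2]
  generalize hf : σ.rarr 5 = f at *
  refine (spec_forLoop (A := 8) (n := K)
    (fun u τ => ∀ p < u * (K * (Z * (Z + 1))), τ.narr 8 p = tableEntry f Z p)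
    (by decide) (by norm_num) b5 (fun _ _ _ _ h => by simpa using h) (by simp) ?_).mono
    le_rfl fun τ h => ?_
  · intro u hu υ₁ k1 i1 F1
    refine (spec_forLoop (A := 8) (n := K)
      (fun v τ => ∀ p < u * (K * (Z * (Z + 1))) + v * (Z * (Z + 1)), τ.narr 8 p = tableEntry f Z p)
      (by decide) (by norm_num) ((k1.nvar 62 (by norm_num)).trans b5)
      (fun _ _ _ _ h => by simpa using h) (by simpa using F1) ?_).mono
      le_rfl fun τ h p hp => h.1 p (by rwa [Nat.succ_mul] at hp)
    intro v hv υ₂ k2 i2 F2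
    have k2' := k1.trans (k2.mono (B' := 110) (by norm_num) le_rfl)
    have i1' : υ₂.nvar 110 = u := (k2.nvar 110 (by norm_num)).trans i1
    refine Spec.seqF (T := 5) (T' := Z * (((Z + 1) * ((K * 15 + 7) + 3) + 5) + 3) + 2)
      (Spec.ofLine (by simp) rfl) 122 8 (by decide) ?_
    rintro _ rfl g6
    have k3 := k2'.trans (g6.mono (B' := 110) (by norm_num) le_rfl)
    refine (spec_forLoop (A := 8) (n := Z)
      (fun i τ => ∀ p < u * (K * (Z * (Z + 1))) + v * (Z * (Z + 1)) + i * (Z + 1),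
        τ.narr 8 p = tableEntry f Z p)
      (by decide) (by norm_num) ?_
      (fun _ _ _ _ h => by simpa using h) (by simpa using F2) ?_).mono
      le_rfl fun τ h p hp => h.1 p ?_
    · rw [k3.nvar 54 (by norm_num), f5.nvar 54 (by norm_num), hZ]
    · intro i hi υ₃ k4 i3 F3
      have k5 := k3.trans (k4.mono (by norm_num) le_rfl)
      refine (spec_rowProg (f := f) (Z := Z) (u := u) (v := v) (i := i) ?_ ?_ ?_ ?_ ?_ i3 ?_ ?_ hv hi
        F3).mono ?_ fun _ h => h
      · rw [k5.nvar 3 (by norm_num), f5.nvar 3 (by norm_num), h1]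
      · rw [k5.nvar 55 (by norm_num), f5.nvar 55 (by norm_num), hZ1]
      · rw [k5.rarr 5 (by norm_num), hz]
      · rw [k4.nvar 123 (by norm_num)]
        simp [i1', k2'.nvar 3 (by norm_num), f5.nvar 3 (by norm_num), h1]
      · rw [k4.rvar 122 (by norm_num)]
        simp [i2, k2'.rarr 6 (by norm_num), r5, a2 v hv]
      · rw [k5.narr 5 (by norm_num), m5 i hi]
      · rw [k4.nvar 122 (by norm_num)]
        simp [i1', i2, k2'.narr 6 (by norm_num), k2'.narr 7 (by norm_num), m6 v hv, m7 u hu, ← hK]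
      · have : (u + 1) * 15 ≤ K * 15 := by omega
        gcongr
    · rw [Nat.succ_mul, ← add_assoc] at hp; exact hp
  · obtain ⟨hF, g⟩ := h
    refine ⟨⟨?_, ?_, ?_, ?_, ?_, ?_, ?_, ?_, ?_⟩, ?_⟩
    · rw [g.nvar 3 (by norm_num), f5.nvar 3 (by norm_num), h1]
    · rw [g.nvar 4 (by norm_num), f5.nvar 4 (by norm_num), h0]
    · rw [g.rvar 1 (by norm_num), f5.rvar 1 (by norm_num), h0']
    · rw [g.nvar 54 (by norm_num), f5.nvar 54 (by norm_num), hZ]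
    · rw [g.rarr 1 (by norm_num), f5.rarr 1 (by norm_num), hw]
    · rw [g.narr 5 (by norm_num)]; exact m5
    · rw [g.narr 6 (by norm_num)]; exact m6
    · rw [g.narr 7 (by norm_num)]; exact m7
    · intro u hu v hv i hi k hk
      rw [← tableEntry_eq f hv hi hk]
      refine hF _ ?_
      have e1 : i * (Z + 1) + (Z + 1) ≤ Z * (Z + 1) := by
        rw [← Nat.succ_mul]; exact Nat.mul_le_mul_right _ hi
      have e2 : v * (Z * (Z + 1)) + Z * (Z + 1) ≤ K * (Z * (Z + 1)) := by
        rw [← Nat.succ_mul]; exact Nat.mul_le_mul_right _ hv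
      have e3 : u * (K * (Z * (Z + 1))) + K * (Z * (Z + 1)) ≤ K * (K * (Z * (Z + 1))) := by
        rw [← Nat.succ_mul]; exact Nat.mul_le_mul_right _ hu
      rw [← hK]
      omega
    · rw [g.rarr 5 (by norm_num), hz]

end

/-! ### The empirical distance as a finite sum -/

/-- The index of the dyadic cube of side `2 ^ (-v)` that contains the window of length `u` at
`i`. -/
def cubeIndex (f : ℕ → ℝ) (u v i : ℕ) : Fin u → ℤ := fun t => ⌊f (i + t) * 2 ^ v⌋

theorem sameCube_iff {f : ℕ → ℝ} {u v i j : ℕ} :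
    SameCube f u v i j ↔ cubeIndex f u v j = cubeIndex f u v i := by
  simp only [SameCube, cubeIndex, funext_iff, Fin.forall_iff, eq_comm]

theorem mem_dyadicCube_iff {u v : ℕ} {k : Fin u → ℤ} {x : Fin u → ℝ} :
    x ∈ dyadicCube v k ↔ ∀ j, ⌊x j * 2 ^ v⌋ = k j := by
  have h2 : (0 : ℝ) < 2 ^ v := by positivity
  simp only [dyadicCube, Set.mem_ofPred_eq, Int.floor_eq_iff, div_le_iff₀ h2, lt_div_iff₀ h2]

theorem window_mem_dyadicCube_iff {f : ℕ → ℝ} {u v i : ℕ} {k : Fin u → ℤ} :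
    window f i u ∈ dyadicCube v k ↔ cubeIndex f u v i = k := by
  rw [mem_dyadicCube_iff, funext_iff]; rfl

open Classical in
theorem cubeCount_sub {f : ℕ → ℝ} {u v i a b : ℕ} (hab : a ≤ b) :
    cubeCount f u v i b - cubeCount f u v i a =
      ((Finset.Ico a b).filter fun j => cubeIndex f u v j = cubeIndex f u v i).card := by
  unfold cubeCount
  simp only [sameCube_iff]
  have : Finset.range b = Finset.range a ∪ Finset.Ico a b := by
    ext j; simp; omega
  rw [this, Finset.filter_union, Finset.card_union_of_disjoint, Nat.add_sub_cancel_left]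
  apply Finset.disjoint_filter_filter
  rw [Finset.disjoint_left]
  intro j; simp; omega

open Classical in
theorem empFreq_stretch {f : ℕ → ℝ} {s : List ℝ} {a b u v : ℕ} (hl : s.length = b - a)
    (hs : ∀ t < b - a, s.getD t 0 = f (a + t)) (hu : u + 1 ≤ b - a) (k : Fin (u + 1) → ℤ) :
    empFreq s.length (fun t => s.getD t 0) (dyadicCube v k) =
      (((Finset.Ico a (b - u)).filter fun j => cubeIndex f (u + 1) v j = k).card : ℝ) /
        ((b - a - u : ℕ) : ℝ) := by
  have e1 : b - a - (u + 1) + 1 = b - u - a := by omega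
  rw [empFreq, hl, if_pos hu, e1, show b - a - u = b - u - a by omega, ← Finset.sum_boole,
    Finset.sum_Ico_eq_sum_range]
  congr 1
  refine Finset.sum_congr rfl fun t ht => ?_
  rw [Finset.mem_range] at ht
  rw [Set.indicator_apply]
  have : window (fun t => s.getD t 0) t (u + 1) = window f (a + t) (u + 1) := by
    funext j
    have := j.isLt
    rw [window, hs _ (by omega), window, add_assoc]
  simp only [this, window_mem_dyadicCube_iff]

/-- Summation over the values of `κ`, each accounted for at its first argument. -/
theorem sum_image_eq_sum_first {α : Type*} [DecidableEq α] (κ : ℕ → α) (g : α → ℝ) (Z : ℕ) :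
    ∑ k ∈ (Finset.range Z).image κ, g k =
      ∑ i ∈ Finset.range Z, if ∃ j < i, κ j = κ i then 0 else g (κ i) := by
  induction Z with
  | zero => simp
  | succ Z ih =>
    have e : (Finset.range (Z + 1)).image κ = insert (κ Z) ((Finset.range Z).image κ) := by
      rw [Finset.range_add_one, Finset.image_insert]
    rw [e, Finset.sum_range_succ, ← ih]
    by_cases h : ∃ j < Z, κ j = κ Z
    · rw [if_pos h, add_zero, Finset.insert_eq_of_mem]
      simpa using h
    · rw [if_neg h, Finset.sum_insert, add_comm]
      simpa using h

theorem cubeCount_pos_iff {f : ℕ → ℝ} {u v i k : ℕ} :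
    0 < cubeCount f u v i k ↔ ∃ j < k, cubeIndex f u v j = cubeIndex f u v i := by
  classical
  rw [cubeCount, Finset.card_pos]
  simp [Finset.Nonempty, sameCube_iff]

/-- The infinite series collapse: only the cubes that contain a window of one of the sequences
contribute, and each of them is accounted for at the first position below `Z` whose window lies in
it. -/
theorem empDist_eq_stretchDist {w f : ℕ → ℝ} {s s' : List ℝ} {Z a b a' b' : ℕ}
    (hl : s.length = b - a) (hs : ∀ t < b - a, s.getD t 0 = f (a + t))
    (hl' : s'.length = b' - a') (hs' : ∀ t < b' - a', s'.getD t 0 = f (a' + t))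
    (hb : b ≤ Z) (hb' : b' ≤ Z) :
    empDist w (fun k => (Nat.log 2 k : ℕ∞)) s s' = stretchDist w f Z a b a' b' := by
  classical
  unfold empDist stretchDist
  rw [hl, hl']
  beta_reduce
  set D := Nat.log 2 (min (b - a) (b' - a')) with hD
  have hDlt : ∀ u < D, u + 1 ≤ b - a ∧ u + 1 ≤ b' - a' := by
    intro u hu
    have := Nat.log_le_self 2 (min (b - a) (b' - a'))
    omega
  have key : ∀ u v : ℕ, (if ((u + 1 : ℕ) : ℕ∞) ≤ D ∧ ((v + 1 : ℕ) : ℕ∞) ≤ D then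
      w (u + 1) * w (v + 1) * ∑' k : Fin (u + 1) → ℤ,
        |empFreq (b - a) (fun t => s.getD t 0) (dyadicCube (v + 1) k) -
          empFreq (b' - a') (fun t => s'.getD t 0) (dyadicCube (v + 1) k)|
      else 0) = if u < D ∧ v < D then
        w (u + 1) * w (v + 1) * ∑ i ∈ Finset.range Z, cubeTerm f a b a' b' u v i else 0 := by
    intro u v
    have e : (((u + 1 : ℕ) : ℕ∞) ≤ D ∧ ((v + 1 : ℕ) : ℕ∞) ≤ D) ↔ u < D ∧ v < D := by
      rw [Nat.cast_le, Nat.cast_le]; rfl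
    simp only [e]
    split_ifs with h
    swap
    · rfl
    congr 1
    obtain ⟨h1, h2⟩ := hDlt u h.1
    have f1 := fun k => empFreq_stretch (v := v + 1) hl hs h1 k
    have f2 := fun k => empFreq_stretch (v := v + 1) hl' hs' h2 k
    rw [hl] at f1
    rw [hl'] at f2
    simp only [f1, f2]
    rw [tsum_eq_sum (s := (Finset.range Z).image (cubeIndex f (u + 1) (v + 1))),
      sum_image_eq_sum_first]
    · refine Finset.sum_congr rfl fun i _ => ?_
      rw [cubeTerm, cubeCount_sub (by omega), cubeCount_sub (by omega)]
      simp only [cubeCount_pos_iff]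
    · intro k hk
      have : ∀ a b : ℕ, b ≤ Z → (Finset.Ico a (b - u)).filter
          (fun j => cubeIndex f (u + 1) (v + 1) j = k) = ∅ := by
        intro a b hb
        rw [Finset.filter_eq_empty_iff]
        intro j hj hjk
        rw [Finset.mem_Ico] at hj
        exact hk (Finset.mem_image.2 ⟨j, Finset.mem_range.2 (by omega), hjk⟩)
      rw [this a b hb, this a' b' hb']
      simp
  simp only [key]
  rw [tsum_eq_sum (s := Finset.range D)]
  · refine Finset.sum_congr rfl fun u hu => ?_
    rw [tsum_eq_sum (s := Finset.range D)]
    · refine Finset.sum_congr rfl fun v hv => ?_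
      rw [if_pos ⟨Finset.mem_range.1 hu, Finset.mem_range.1 hv⟩]
    · intro v hv
      rw [Finset.mem_range] at hv
      rw [if_neg fun h => hv h.2]
  · intro u hu
    rw [Finset.mem_range] at hu
    simp [hu]

section
open Instr Prog

/-! ### The scored candidates as a single filtered list -/

/-- The cut-off at the logarithm. -/
def logCut : ℕ → ℕ∞ := fun k => (Nat.log 2 k : ℕ∞)

/-- An enumeration of the blocks by `0, …, 2 q - 1`. -/
def blockOf (q c : ℕ) : ℕ × ℕ := if c < q then (1, c + 1) else (2, c - q + 1)

theorem blocks_eq (lam : ℝ) (n : ℕ) :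
    blocks lam n = ((List.range (⌊3 / lam⌋₊ + ⌊3 / lam⌋₊)).map (blockOf ⌊3 / lam⌋₊)).filter
      fun c => gridPt lam n c.1 (c.2 + 2) ≤ n := by
  unfold blocks
  congr 1
  generalize ⌊3 / lam⌋₊ = q
  rw [List.range_add, List.map_append, List.map_map]
  simp only [List.flatMap_cons, List.flatMap_nil, List.append_nil]
  congr 1
  · rw [List.range'_eq_map_range, List.map_map]
    refine List.map_congr_left fun i hi => ?_
    simp [blockOf, List.mem_range.1 hi, add_comm]
  · rw [List.range'_eq_map_range, List.map_map]
    refine List.map_congr_left fun i hi => ?_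
    simp [blockOf, add_comm]

open Classical in
/-- The scored candidate that comes from the block number `c`, if there is one. -/
def candidate (w : ℕ → ℝ) (lam : ℝ) (y : List ℝ) (c : ℕ) : Option (ℕ × ℝ) :=
  let b := blockOf ⌊3 / lam⌋₊ c
  let e := blockEstimate w logCut lam y b
  if gridPt lam y.length b.1 (b.2 + 2) ≤ y.length ∧ 0 < e ∧ lam * y.length ≤ e ∧
      (e : ℝ) + lam * y.length ≤ y.length then
    some (e, blockScore w logCut lam y b)
  else none

theorem scoredCandidates_eq (w : ℕ → ℝ) (lam : ℝ) (y : List ℝ) :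
    scoredCandidates w logCut lam y =
      (List.range (⌊3 / lam⌋₊ + ⌊3 / lam⌋₊)).filterMap (candidate w lam y) := by
  unfold scoredCandidates
  rw [blocks_eq]
  generalize List.range (⌊3 / lam⌋₊ + ⌊3 / lam⌋₊) = l
  induction l with
  | nil => rfl
  | cons c l ih =>
    simp only [List.map_cons, List.filter_cons, List.filterMap_cons, candidate]
    by_cases h1 : gridPt lam y.length (blockOf ⌊3 / lam⌋₊ c).1 ((blockOf ⌊3 / lam⌋₊ c).2 + 2) ≤
      y.length
    · simp only [h1, decide_true, if_true, List.map_cons, List.filter_cons, true_and,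
        decide_eq_true_eq]
      split_ifs with h2
      · rw [ih]
      · rw [ih]
    · simp only [h1, decide_false, false_and, if_false, Bool.false_eq_true]
      exact ih

theorem gridPt_mono {lam : ℝ} (h : 0 ≤ lam) (n t : ℕ) {i j : ℕ} (hij : i ≤ j) :
    gridPt lam n t i ≤ gridPt lam n t j := by
  unfold gridPt
  gcongr

theorem gridPt_succ_le {lam : ℝ} (h : 0 ≤ lam) (n t i : ℕ) :
    gridPt lam n t (i + 1) - gridPt lam n t i + 1 ≤ ⌊n * (lam / 3)⌋₊ + 2 := by
  unfold gridPt
  set d : ℝ := n * (lam / 3)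
  have hd : 0 ≤ d := by positivity
  set x : ℝ := d * (i + 1 / (t + 1))
  have hx : 0 ≤ x := by positivity
  have e : d * (((i + 1 : ℕ) : ℝ) + 1 / (t + 1)) = x + d := by simp only [x]; push_cast; ring
  rw [e]
  have h1 := Nat.lt_floor_add_one x
  have h2 := Nat.lt_floor_add_one d
  have h3 : ⌊x + d⌋₊ < ⌊x⌋₊ + ⌊d⌋₊ + 2 := by
    rw [Nat.floor_lt (by positivity)]; push_cast; linarith
  omega

theorem length_seg {y : List ℝ} {a b : ℕ} (hb : b ≤ y.length) : (seg y a b).length = b - a := by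
  simp [seg]; omega

theorem getD_seg {y : List ℝ} {a b t : ℕ} (ht : t < b - a) :
    (seg y a b).getD t 0 = y.getD (a + t) 0 := by
  simp [seg, List.getD_eq_getElem?_getD, ht]

/-- The sequence `f` contains the sample `y` from position `o` on. -/
def Contains (f : ℕ → ℝ) (o : ℕ) (y : List ℝ) : Prop :=
  ∀ t < y.length, y.getD t 0 = f (o + t)

theorem empDist_seg {w f : ℕ → ℝ} {o o' Z : ℕ} {y y' : List ℝ} (hy : Contains f o y)
    (hy' : Contains f o' y') (hZ : o + y.length ≤ Z) (hZ' : o' + y'.length ≤ Z) {a b a' b' : ℕ}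
    (hb : b ≤ y.length) (hb' : b' ≤ y'.length) :
    empDist w logCut (seg y a b) (seg y' a' b') =
      stretchDist w f Z (o + a) (o + b) (o' + a') (o' + b') := by
  have e := fun a b o : ℕ => Nat.add_sub_add_left o b a
  refine empDist_eq_stretchDist ?_ ?_ ?_ ?_ (by omega) (by omega)
  · rw [length_seg hb, e]
  · intro t ht
    rw [e] at ht
    rw [getD_seg ht, hy _ (by omega), add_assoc]
  · rw [length_seg hb', e]
  · intro t ht
    rw [e] at ht
    rw [getD_seg ht, hy' _ (by omega), add_assoc]

theorem argmax_map {α β γ : Type*} [LinearOrder γ] (f : β → γ) (g : α → β) (l : List α) :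
    (l.map g).argmax f = (l.argmax fun a => f (g a)).map g := by
  induction l using List.reverseRecOn with
  | nil => rfl
  | append_singleton l a ih =>
    rw [List.map_append, List.map_singleton, List.argmax_concat, List.argmax_concat, ih]
    cases l.argmax fun a => f (g a) with
    | none => rfl
    | some c => simp only [Option.map_some]; split_ifs <;> rfl

theorem argmax_congr {α γ : Type*} [LinearOrder γ] {f g : α → γ} {l : List α}
    (h : ∀ a ∈ l, f a = g a) : l.argmax f = l.argmax g := by
  induction l using List.reverseRecOn with
  | nil => rfl
  | append_singleton l a ih =>
    rw [List.argmax_concat, List.argmax_concat, ih fun x hx => h x (by simp [hx])]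
    cases hc : l.argmax g with
    | none => rfl
    | some c => simp only [h a (by simp), h c (by simp [List.argmax_mem hc])]

/-! ### Computing the scored candidates -/

/-- The data of a sample in memory: the sample `y` starts at position `o` of the sequence in the
real array `5`. -/
structure ListEnv (w f : ℕ → ℝ) (lam : ℝ) (Z o : ℕ) (y : List ℝ) (σ : State) : Prop where
  table : TableReady w f Z σ
  start : σ.nvar 160 = o
  len : σ.nvar 161 = y.length
  count : σ.nvar 2 = ⌊3 / lam⌋₊
  lamEq : σ.rvar 0 = lam
  contains : Contains f o y
  fits : o + y.length ≤ Z

theorem ListEnv.agree {w f lam Z o y σ τ B A} (h : ListEnv w f lam Z o y σ) (hag : Agree B A σ τ)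
    (hB : 162 ≤ B) (hA : 9 ≤ A) : ListEnv w f lam Z o y τ :=
  ⟨h.table.agree hag (by omega) hA, (hag.nvar _ (by omega)).trans h.start,
    (hag.nvar _ (by omega)).trans h.len, (hag.nvar _ (by omega)).trans h.count,
    (hag.rvar _ (by omega)).trans h.lamEq, h.contains, h.fits⟩

/-- Sets the constants that the loop over the blocks uses. -/
def candInit : Prog :=
  line [realOfNat 200 161, realMul 200 0 200, natAdd 201 2 2, natConst 200 3, realOfNat 201 200,
    realDiv 201 0 201, realOfNat 202 161, realMul 201 202 201, natAdd 200 161 3, natConst 204 0]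

/-- The grid points of the block with the number in the register `202`, in the registers
`222`, `232`, `242`, `252`. -/
def gridProg : Prog :=
  .seq (.ifNat 202 2 (line [natSub 206 202 4, natConst 207 1])
    (line [natSub 206 202 2, natConst 207 2]))
  (.seq (line [natAdd 207 207 3, realOfNat 206 3, realOfNat 207 207, realDiv 206 206 207,
    realOfNat 210 206, realAdd 210 210 206, realMul 210 201 210,
    natAdd 206 206 3, realOfNat 211 206, realAdd 211 211 206, realMul 211 201 211,
    natAdd 206 206 3, realOfNat 212 206, realAdd 212 212 206, realMul 212 201 212,
    natAdd 206 206 3, realOfNat 213 206, realAdd 213 213 206, realMul 213 201 213])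
  (.seq (floorLoop 220 200 210) (.seq (floorLoop 230 200 211) (.seq (floorLoop 240 200 212)
    (floorLoop 250 200 213)))))

/-- The constants that the loop over the blocks uses. -/
structure CandEnv (w f : ℕ → ℝ) (lam : ℝ) (Z o : ℕ) (y : List ℝ) (σ : State) : Prop extends
    ListEnv w f lam Z o y σ where
  bound : σ.nvar 200 = y.length + 1
  margin : σ.rvar 200 = lam * y.length
  mesh : σ.rvar 201 = y.length * (lam / 3)

theorem CandEnv.agree {w f lam Z o y σ τ B A} (h : CandEnv w f lam Z o y σ) (hag : Agree B A σ τ)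
    (hB : 202 ≤ B) (hA : 9 ≤ A) : CandEnv w f lam Z o y τ :=
  ⟨h.toListEnv.agree hag (by omega) hA, (hag.nvar _ (by omega)).trans h.bound,
    (hag.rvar _ (by omega)).trans h.margin, (hag.rvar _ (by omega)).trans h.mesh⟩

theorem spec_candInit {w f lam Z o y σ} (h : ListEnv w f lam Z o y σ) :
    Spec candInit σ 10 (fun τ => CandEnv w f lam Z o y τ ∧ τ.nvar 204 = 0 ∧
      τ.nvar 201 = ⌊3 / lam⌋₊ + ⌊3 / lam⌋₊) := by
  have hag : Agree 200 100 σ (exec [realOfNat 200 161, realMul 200 0 200, natAdd 201 2 2,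
      natConst 200 3, realOfNat 201 200, realDiv 201 0 201, realOfNat 202 161, realMul 201 202 201,
      natAdd 200 161 3, natConst 204 0] σ) := (runs_line _ σ).agree (by decide)
  refine Spec.ofLine (by simp) ⟨⟨h.agree hag (by norm_num) (by norm_num), ?_, ?_, ?_⟩, ?_, ?_⟩ <;>
    simp [h.len, h.count, h.lamEq, h.table.one]

theorem spec_gridProg {w f lam Z o y σ} (h : CandEnv w f lam Z o y σ) {c : ℕ}
    (hc : σ.nvar 202 = c) :
    Spec gridProg σ (28 * (y.length + 1) + 38) (fun τ =>
      let b := blockOf ⌊3 / lam⌋₊ c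
      τ.nvar 222 = min (y.length + 1) (gridPt lam y.length b.1 (b.2 - 1)) ∧
      τ.nvar 232 = min (y.length + 1) (gridPt lam y.length b.1 b.2) ∧
      τ.nvar 242 = min (y.length + 1) (gridPt lam y.length b.1 (b.2 + 1)) ∧
      τ.nvar 252 = min (y.length + 1) (gridPt lam y.length b.1 (b.2 + 2))) := by
  set b := blockOf ⌊3 / lam⌋₊ c with hb
  refine (Spec.seqF (T := 2 + 1) (T' := 19 + (((y.length + 1) * 7 + 4) + (((y.length + 1) * 7 + 4) +
    (((y.length + 1) * 7 + 4) + ((y.length + 1) * 7 + 4)))))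
    (R := fun τ => τ.nvar 206 + 1 = b.2 ∧ τ.nvar 207 = b.1)
    (Spec.ifNat (fun h' => Spec.ofLine (by simp) ?_) (fun h' => Spec.ofLine (by simp) ?_))
    206 100 (by decide) ?_).mono (by omega) fun _ h => h
  · rw [hc, h.count] at h'
    simp [hc, h.table.zero, hb, blockOf, h']
  · rw [hc, h.count] at h'
    simp [hc, h.count, hb, blockOf, h']
  rintro τ₁ ⟨h1, h2⟩ g1
  have E1 := h.agree g1 (by norm_num) (by norm_num)
  refine Spec.seqF (R := fun τ => τ.rvar 210 = (y.length : ℝ) * (lam / 3) *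
      (((b.2 - 1 : ℕ) : ℝ) + 1 / ((b.1 : ℝ) + 1)) ∧
    τ.rvar 211 = (y.length : ℝ) * (lam / 3) * (((b.2 : ℕ) : ℝ) + 1 / ((b.1 : ℝ) + 1)) ∧
    τ.rvar 212 = (y.length : ℝ) * (lam / 3) * (((b.2 + 1 : ℕ) : ℝ) + 1 / ((b.1 : ℝ) + 1)) ∧
    τ.rvar 213 = (y.length : ℝ) * (lam / 3) * (((b.2 + 2 : ℕ) : ℝ) + 1 / ((b.1 : ℝ) + 1)))
    (Spec.ofLine (by simp) ?_) 206 100 (by decide) ?_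
  · rw [← h1]
    simp [E1.mesh, h2, E1.table.one]
    constructor <;> ring
  rintro τ₂ ⟨v0, v1, v2, v3⟩ g2
  have n2 : τ₂.nvar 200 = y.length + 1 := (g2.nvar _ (by norm_num)).trans E1.bound
  refine Spec.seqF (spec_floorLoop (by norm_num) (by norm_num) n2) 220 100 (by decide)
    fun τ₃ h3 g3 => ?_
  refine Spec.seqF (spec_floorLoop (by norm_num) (by norm_num) ((g3.nvar _ (by norm_num)).trans n2))
    230 100 (by decide) fun τ₄ h4 g4 => ?_
  have g34 := g3.trans (g4.mono (B' := 220) (by norm_num) le_rfl)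
  refine Spec.seqF (spec_floorLoop (by norm_num) (by norm_num)
    ((g34.nvar _ (by norm_num)).trans n2)) 240 100 (by decide) fun τ₅ h5 g5 => ?_
  have g35 := g34.trans (g5.mono (B' := 220) (by norm_num) le_rfl)
  refine ((spec_floorLoop (by norm_num) (by norm_num)
    ((g35.nvar _ (by norm_num)).trans n2)).frame (B := 250) (A := 100) (by decide)).mono le_rfl
    fun τ₆ ⟨h6, g6⟩ => ⟨?_, ?_, ?_, ?_⟩
  · rw [g6.nvar _ (by norm_num), g5.nvar _ (by norm_num), g4.nvar _ (by norm_num), h3, v0]; rfl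
  · rw [g6.nvar _ (by norm_num), g5.nvar _ (by norm_num), h4, g3.rvar _ (by norm_num), v1]; rfl
  · rw [g6.nvar _ (by norm_num), h5, g34.rvar _ (by norm_num), v2]; rfl
  · rw [h6, g35.rvar _ (by norm_num), v3]; rfl

/-- Score and estimate of the block with grid points in the registers `222`, `232`, `242`, `252`:
the score is left in the real register `264`, the estimate in the register `275`. -/
def blockProg : Prog :=
  .seq (line [natAdd 254 232 242, realOfNat 254 254, natConst 255 2, realOfNat 255 255,
    realDiv 254 254 255])
  (.seq (floorLoop 260 200 254)
  (.seq (line [natAdd 280 160 232, natAdd 281 160 262, natAdd 282 160 262, natAdd 283 160 242])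
  (.seq distProg
  (.seq (line [realAdd 264 312 1, natSub 264 242 232, natAdd 264 264 3])
  (.seq (argmaxLoop 270 264 312
    (.seq (line [natAdd 281 232 270, natAdd 281 160 281, natAdd 282 281 4, natAdd 280 160 222,
      natAdd 283 160 252]) distProg))
  (line [natAdd 275 232 272]))))))

/-- The factor `⌊y.length * (lam / 3)⌋₊ + 2` bounds the number of positions in the block, each of
which requires one empirical distance. -/
theorem spec_blockProg {w f lam Z o y σ} (h : CandEnv w f lam Z o y σ) (hlam : 0 ≤ lam) {b : ℕ × ℕ}
    (hg0 : σ.nvar 222 = gridPt lam y.length b.1 (b.2 - 1))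
    (hg1 : σ.nvar 232 = gridPt lam y.length b.1 b.2)
    (hg2 : σ.nvar 242 = gridPt lam y.length b.1 (b.2 + 1))
    (hg3 : σ.nvar 252 = gridPt lam y.length b.1 (b.2 + 2))
    (hle : gridPt lam y.length b.1 (b.2 + 2) ≤ y.length) :
    Spec blockProg σ ((⌊y.length * (lam / 3)⌋₊ + 2) *
        (100 * ((Z + 1) * (Nat.log 2 Z + 1) ^ 2) + 20) +
        (100 * ((Z + 1) * (Nat.log 2 Z + 1) ^ 2) + 7 * (y.length + 1) + 19)) (fun τ =>
      τ.nvar 275 = blockEstimate w logCut lam y b ∧ τ.rvar 264 = blockScore w logCut lam y b) := by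
  set X := 100 * ((Z + 1) * (Nat.log 2 Z + 1) ^ 2) with hX
  have m01 := gridPt_mono hlam y.length b.1 (Nat.sub_le b.2 1)
  have m12 := gridPt_mono hlam y.length b.1 (Nat.le_succ b.2)
  have m23 := gridPt_mono hlam y.length b.1 (Nat.le_succ (b.2 + 1))
  have hH := gridPt_succ_le hlam y.length b.1 b.2
  have eEst : blockEstimate w logCut lam y b = ((List.range' (gridPt lam y.length b.1 b.2)
      (gridPt lam y.length b.1 (b.2 + 1) - gridPt lam y.length b.1 b.2 + 1)).argmax fun s =>
    empDist w logCut (seg y (gridPt lam y.length b.1 (b.2 - 1)) s)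
      (seg y s (gridPt lam y.length b.1 (b.2 + 2)))).getD 0 := rfl
  have eSc : blockScore w logCut lam y b = empDist w logCut (seg y (gridPt lam y.length b.1 b.2)
      ((gridPt lam y.length b.1 b.2 + gridPt lam y.length b.1 (b.2 + 1)) / 2))
      (seg y ((gridPt lam y.length b.1 b.2 + gridPt lam y.length b.1 (b.2 + 1)) / 2)
        (gridPt lam y.length b.1 (b.2 + 1))) := rfl
  rw [eEst, eSc]
  simp only [Nat.succ_eq_add_one] at m12 m23
  generalize gridPt lam y.length b.1 (b.2 - 1) = p0 at *
  generalize gridPt lam y.length b.1 b.2 = p1 at *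
  generalize gridPt lam y.length b.1 (b.2 + 1) = p2 at *
  generalize gridPt lam y.length b.1 (b.2 + 1 + 1) = p3 at *
  have hoZ := h.fits
  refine (Spec.seqF (T := 5) (T' := ((y.length + 1) * 7 + 4) + (4 + (X + (3 +
    (((p2 - p1 + 1) * ((5 + X) + 15) + 2) + 1))))) (Spec.ofLine (by simp) rfl) 254 100 (by decide)
    ?_).mono ?_ fun _ h => h
  swap
  · have : (p2 - p1 + 1) * ((5 + X) + 15) ≤ (⌊y.length * (lam / 3)⌋₊ + 2) * (X + 20) := by
      rw [show 5 + X + 15 = X + 20 by ring]; exact Nat.mul_le_mul_right _ hH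
    omega
  rintro _ rfl g1
  refine Spec.seqF (spec_floorLoop (by norm_num) (by norm_num)
    ((g1.nvar _ (by norm_num)).trans h.bound)) 260 100 (by decide) fun τ₂ h2 g2 => ?_
  have mid : τ₂.nvar 262 = (p1 + p2) / 2 := by
    rw [h2]
    simp [hg1, hg2]
    have : ⌊((p1 : ℝ) + p2) / 2⌋₊ = (p1 + p2) / 2 := by
      rw [← Nat.floor_div_eq_div (K := ℝ)]; push_cast; rfl
    rw [this]
    omega
  have f2 := g1.trans (g2.mono (by norm_num) le_rfl)
  refine Spec.seqF (Spec.ofLine (by simp) rfl) 280 100 (by decide) ?_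
  rintro _ rfl g3
  have f3 := f2.trans (g3.mono (by norm_num) le_rfl)
  have E3 := h.agree f3 (by norm_num) (by norm_num)
  have e232 : τ₂.nvar 232 = p1 := (f2.nvar _ (by norm_num)).trans hg1
  have e242 : τ₂.nvar 242 = p2 := (f2.nvar _ (by norm_num)).trans hg2
  have e160 : τ₂.nvar 160 = o := (f2.nvar _ (by norm_num)).trans h.start
  refine Spec.seqF (spec_distProg E3.table (a := o + p1) (b := o + (p1 + p2) / 2)
    (a' := o + (p1 + p2) / 2) (b' := o + p2) (by simp [e160, e232]) (by simp [e160, mid])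
    (by simp [e160, mid]) (by simp [e160, e242]) (by omega) (by omega) (by omega) (by omega))
    300 100 (by decide) fun τ₄ h4 g4 => ?_
  have f4 := f3.trans (g4.mono (by norm_num) le_rfl)
  have E4 := h.agree f4 (by norm_num) (by norm_num)
  refine Spec.seqF (Spec.ofLine (by simp) rfl) 264 100 (by decide) ?_
  rintro _ rfl g5
  have f5 := f4.trans (g5.mono (by norm_num) le_rfl)
  have E5 := h.agree f5 (by norm_num) (by norm_num)
  refine Spec.seqF (spec_argmaxLoop (A := 100) (i := 270) (x := 264) (r := 312) (n := p2 - p1 + 1)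
    (fun k => stretchDist w f Z (o + p0) (o + (p1 + k)) (o + (p1 + k)) (o + p3))
    (by decide) (by norm_num) ?_ (by norm_num) ?_) 270 100 (by decide) ?_
  · simp [f4.nvar 242 (by norm_num), f4.nvar 232 (by norm_num), hg1, hg2, E4.table.one]
  · intro k hk υ gυ ik
    have f6 := f5.trans (gυ.mono (by norm_num) le_rfl)
    have E6 := h.agree f6 (by norm_num) (by norm_num)
    refine Spec.seqF (Spec.ofLine (by simp) rfl) 280 100 (by decide) ?_
    rintro _ rfl g7
    have f7 := f6.trans (g7.mono (by norm_num) le_rfl)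
    have E7 := h.agree f7 (by norm_num) (by norm_num)
    have q1 := (f6.nvar 232 (by norm_num)).trans hg1
    have q0 := (f6.nvar 222 (by norm_num)).trans hg0
    have q3 := (f6.nvar 252 (by norm_num)).trans hg3
    exact spec_distProg E7.table (by simp [E6.start, q0]) (by simp [E6.start, q1, ik])
      (by simp [E6.start, q1, ik, E6.table.zero]) (by simp [E6.start, q3])
      (by omega) (by omega) (by omega) (by omega)
  · intro τ₆ h6 g6
    obtain ⟨h6, -⟩ := h6 (by omega)
    refine Spec.ofLine (by simp) ⟨?_, ?_⟩
    · rw [List.range'_eq_map_range, argmax_map, argmax_congr (g := fun k =>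
        stretchDist w f Z (o + p0) (o + (p1 + k)) (o + (p1 + k)) (o + p3)), h6]
      · simp [g6.nvar 232 (by norm_num), f4.nvar 232 (by norm_num), hg1]
      · intro k hk
        rw [List.mem_range] at hk
        exact empDist_seg h.contains h.contains hoZ hoZ (by omega) (by omega)
    · rw [empDist_seg h.contains h.contains hoZ hoZ (by omega) (by omega), ← h4]
      simp [g6.rvar 264 (by norm_num), E4.table.zeroR]

end

section
open Instr Prog

/-- The scored positions `U` are the first entries of the arrays `10`. -/
def Entries (U : List (ℕ × ℝ)) (σ : State) : Prop :=
  ∀ (k : ℕ) (x : ℕ × ℝ), U[k]? = some x → σ.narr 10 k = x.1 ∧ σ.rarr 10 k = x.2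

theorem Entries.agree {U σ τ B A} (h : Entries U σ) (hag : Agree B A σ τ) (hA : 11 ≤ A) :
    Entries U τ := by
  intro k x hx
  rw [hag.narr 10 (by omega), hag.rarr 10 (by omega)]
  exact h k x hx

theorem Entries.concat {U σ} {x : ℕ × ℝ} (h : Entries U σ) (h1 : σ.narr 10 U.length = x.1)
    (h2 : σ.rarr 10 U.length = x.2) : Entries (U ++ [x]) σ := by
  intro k z hk
  rw [List.getElem?_append] at hk
  split_ifs at hk with hlt
  · exact h k z hk
  · have : k - U.length = 0 := by
      by_contra h0
      rw [List.getElem?_eq_none (by simp; omega)] at hk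
      exact absurd hk (by simp)
    have e : k = U.length := by omega
    rw [this] at hk
    simp only [List.getElem?_cons_zero, Option.some.injEq] at hk
    subst hk e
    exact ⟨h1, h2⟩

/-- Tests the block with the number in the register `202` and appends its scored candidate, if
there is one, to the list in the arrays `10`. -/
def candStep : Prog :=
  .seq gridProg (.ifNat 161 252 .skip (.seq blockProg
    (.seq (line [realOfNat 272 275, realOfNat 273 161, realAdd 274 272 200])
      (.ifNat 4 275 (.ifReal 272 200 .skip (.ifReal 273 274 .skip
        (line [natStore 10 204 275, realStore 10 204 264, natAdd 204 204 3]))) .skip))))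

theorem spec_candStep {w f lam Z o y σ} (h : CandEnv w f lam Z o y σ) (hlam : 0 ≤ lam) {c : ℕ}
    (hc : σ.nvar 202 = c) {U : List (ℕ × ℝ)} (hU : Entries U σ) (hn : σ.nvar 204 = U.length) :
    Spec candStep σ (4 * (⌊y.length * (lam / 3)⌋₊ + 2) * (100 * ((Z + 1) * (Nat.log 2 Z + 1) ^ 2)))
      (fun τ => Entries (U ++ (candidate w lam y c).toList) τ ∧
        τ.nvar 204 = (U ++ (candidate w lam y c).toList).length) := by
  set b := blockOf ⌊3 / lam⌋₊ c with hb
  set X := 100 * ((Z + 1) * (Nat.log 2 Z + 1) ^ 2) with hX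
  have hX1 : 100 * (y.length + 1) ≤ X := by
    have h1 := h.fits
    have h2 : 1 ≤ (Nat.log 2 Z + 1) ^ 2 := Nat.one_le_pow _ _ (by omega)
    calc 100 * (y.length + 1) ≤ 100 * ((Z + 1) * 1) := by omega
      _ ≤ X := by rw [hX]; gcongr
  refine (Spec.seqF (T := 28 * (y.length + 1) + 38) (T' := ((⌊y.length * (lam / 3)⌋₊ + 2) *
    (X + 20) + (X + 7 * (y.length + 1) + 19) + (3 + (3 + 1 + 1 + 1))) + 1)
    (spec_gridProg h hc) 206 100 (by decide) fun τ₁ h1 g1 => ?_).mono ?_ fun _ h => h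
  swap
  · generalize ⌊y.length * (lam / 3)⌋₊ = H
    have e1 : (H + 2) * (X + 20) = H * X + 2 * X + H * 20 + 40 := by ring
    have e2 : 4 * (H + 2) * X = 4 * (H * X) + 8 * X := by ring
    have e3 : H * 20 ≤ H * X := Nat.mul_le_mul_left _ (by omega)
    rw [e1, e2]
    omega
  simp only [← hb] at h1
  obtain ⟨q0, q1, q2, q3⟩ := h1
  have E1 := h.agree g1 (by norm_num) (by norm_num)
  have U1 := hU.agree g1 (by norm_num)
  have n1 : τ₁.nvar 204 = U.length := (g1.nvar _ (by norm_num)).trans hn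
  refine Spec.ifNat (fun h' => Spec.skip ?_) fun h' => ?_
  · rw [E1.len, q3] at h'
    have : candidate w lam y c = none := by
      unfold candidate
      rw [if_neg]
      rintro ⟨h, -⟩
      rw [← hb] at h
      omega
    rw [this]
    simpa using ⟨U1, n1⟩
  rw [E1.len, q3] at h'
  have hle : gridPt lam y.length b.1 (b.2 + 2) ≤ y.length := by omega
  have m01 := gridPt_mono hlam y.length b.1 (Nat.sub_le b.2 1)
  have m12 := gridPt_mono hlam y.length b.1 (Nat.le_succ b.2)
  have m23 := gridPt_mono hlam y.length b.1 (Nat.le_succ (b.2 + 1))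
  simp only [Nat.succ_eq_add_one] at m12 m23
  have m23' : gridPt lam y.length b.1 (b.2 + 1) ≤ gridPt lam y.length b.1 (b.2 + 2) := m23
  refine Spec.seqF (spec_blockProg E1 hlam (b := b) (by rw [q0]; omega) (by rw [q1]; omega)
    (by rw [q2]; omega) (by rw [q3]; omega) hle) 254 100 (by decide) fun τ₂ ⟨e2, s2⟩ g2 => ?_
  have E2 := E1.agree g2 (by norm_num) (by norm_num)
  have U2 := U1.agree g2 (by norm_num)
  have n2 : τ₂.nvar 204 = U.length := (g2.nvar _ (by norm_num)).trans n1
  refine Spec.seqF (T := 3) (T' := 3 + 1 + 1 + 1) (Spec.ofLine (by simp) rfl) 272 100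
    (by decide) ?_
  rintro _ rfl g3
  have none_of : ¬ (0 < blockEstimate w logCut lam y b ∧
      lam * y.length ≤ blockEstimate w logCut lam y b ∧
      (blockEstimate w logCut lam y b : ℝ) + lam * y.length ≤ y.length) →
      candidate w lam y c = none := by
    intro hne
    unfold candidate
    rw [← hb, if_neg (fun h => hne h.2)]
  have U3 := U2.agree g3 (by norm_num)
  refine Spec.ifNat (fun k1 => Spec.ifReal (fun k2 => Spec.skip ?_) fun k2 =>
    Spec.ifReal (fun k3 => Spec.skip ?_) fun k3 => Spec.ofLine (by simp) ?_)
    fun k1 => Spec.skip ?_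
  · simp [e2, E2.margin] at k2
    rw [none_of fun h => absurd h.2.1 (not_le.2 k2)]
    simpa using ⟨U3, n2⟩
  · simp [e2, E2.margin, E2.len] at k3
    rw [none_of fun h => absurd h.2.2 (not_le.2 k3)]
    simpa using ⟨U3, n2⟩
  · simp [e2, E2.table.zero] at k1
    simp [e2, E2.margin] at k2
    simp [e2, E2.margin, E2.len] at k3
    have hs : candidate w lam y c = some (blockEstimate w logCut lam y b,
        blockScore w logCut lam y b) := by
      unfold candidate
      rw [← hb, if_pos ⟨hle, k1, k2, k3⟩]
    rw [hs]
    refine ⟨Entries.concat ?_ (by simp [n2, e2]) (by simp [n2, s2]), by simp [n2, E2.table.one]⟩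
    intro k x hx
    have hk : k < U.length := by
      by_contra hk
      rw [List.getElem?_eq_none (by omega)] at hx
      exact absurd hx (by simp)
    simp [n2, hk.ne]
    exact U2 k x hx
  · simp [e2, E2.table.zero] at k1
    rw [none_of fun h => absurd h.1 (by omega)]
    simpa using ⟨U3, n2⟩

/-- Computes the list of scored candidates. -/
def candProg : Prog := .seq candInit (forLoop 202 201 candStep)

theorem spec_candProg {w f lam Z o y σ} (h : ListEnv w f lam Z o y σ) (hlam : 0 ≤ lam) :
    Spec candProg σ (⌊3 / lam⌋₊ * (10 * (⌊y.length * (lam / 3)⌋₊ + 2) *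
        (100 * ((Z + 1) * (Nat.log 2 Z + 1) ^ 2))) + 12)
      (fun τ => CandEnv w f lam Z o y τ ∧ Entries (scoredCandidates w logCut lam y) τ ∧
        τ.nvar 204 = (scoredCandidates w logCut lam y).length) := by
  set X := 100 * ((Z + 1) * (Nat.log 2 Z + 1) ^ 2) with hX
  set H := ⌊y.length * (lam / 3)⌋₊ + 2 with hH
  set q := ⌊3 / lam⌋₊ with hq
  refine (Spec.seqF (T := 10) (T' := (q + q) * (4 * H * X + 3) + 2)
    (spec_candInit h) 200 10 (by decide) fun τ₁ h1 g1 => ?_).mono ?_ fun _ h => h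
  swap
  · have h2 : 3 ≤ H * X := by
      have : 1 ≤ (Z + 1) * (Nat.log 2 Z + 1) ^ 2 := Nat.succ_le_of_lt (by positivity)
      calc 3 ≤ 2 * 100 := by norm_num
        _ ≤ H * X := Nat.mul_le_mul (by omega) (by omega)
    have e1 : (q + q) * (4 * H * X + 3) = q * (8 * (H * X) + 6) := by ring
    have e2 : q * (10 * H * X) = q * (10 * (H * X)) := by ring
    have : q * (8 * (H * X) + 6) ≤ q * (10 * (H * X)) := Nat.mul_le_mul_left _ (by omega)
    omega
  obtain ⟨E1, n1, b1⟩ := h1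
  refine (spec_forLoop (A := 10) (n := q + q)
    (fun k τ => Entries ((List.range k).filterMap (candidate w lam y)) τ ∧
      τ.nvar 204 = ((List.range k).filterMap (candidate w lam y)).length)
    (by decide) (by norm_num) b1 (fun _ _ _ _ h => by simpa [Entries] using h)
    (by simpa [Entries] using n1) ?_).mono le_rfl fun τ h => ?_
  · intro k hk τ gτ ik hinv
    have := spec_candStep (E1.agree gτ (by norm_num) (by norm_num)) hlam ik hinv.1 hinv.2
    rw [List.range_succ, List.filterMap_append]
    refine this.mono le_rfl fun τ h => ?_
    convert h using 2 <;> cases hcd : candidate w lam y k <;> simp [hcd]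
  · rw [scoredCandidates_eq]
    exact ⟨E1.agree h.2 (by norm_num) (by norm_num), h.1⟩

end

section
open Instr Prog

/-! ### The greedy selection -/

open Classical in
theorem greedySelect_succ (r : ℝ) (k : ℕ) (U : List (ℕ × ℝ)) {c : ℕ × ℝ}
    (h : U.argmax Prod.snd = some c) :
    greedySelect r (k + 1) U =
      c.1 :: greedySelect r k (U.filter fun d => r ≤ |(d.1 : ℝ) - (c.1 : ℝ)|) := by
  rw [greedySelect, h]

theorem greedySelect_nil (r : ℝ) (k : ℕ) : greedySelect r k [] = [] := by
  cases k <;> rfl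

theorem exists_of_mem_greedySelect {r : ℝ} {k : ℕ} {U : List (ℕ × ℝ)} {c : ℕ}
    (h : c ∈ greedySelect r k U) : ∃ x ∈ U, x.1 = c := by
  induction k generalizing U with
  | zero => simp [greedySelect] at h
  | succ k ih =>
    cases hU : U.argmax Prod.snd with
    | none =>
      rw [List.argmax_eq_none] at hU
      subst hU
      simp [greedySelect] at h
    | some x =>
      rw [greedySelect_succ r k U hU, List.mem_cons] at h
      rcases h with h | h
      · exact ⟨x, List.argmax_mem hU, h.symm⟩
      · obtain ⟨z, hz, hzc⟩ := ih h
        exact ⟨z, List.mem_of_mem_filter hz, hzc⟩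

theorem pairwise_greedySelect (r : ℝ) (k : ℕ) (U : List (ℕ × ℝ)) :
    (greedySelect r k U).Pairwise fun a b : ℕ => r ≤ |(b : ℝ) - (a : ℝ)| := by
  induction k generalizing U with
  | zero => simp [greedySelect]
  | succ k ih =>
    cases hU : U.argmax Prod.snd with
    | none =>
      rw [List.argmax_eq_none] at hU
      subst hU
      simp [greedySelect]
    | some x =>
      rw [greedySelect_succ r k U hU, List.pairwise_cons]
      refine ⟨fun b hb => ?_, ih _⟩
      obtain ⟨z, hz, rfl⟩ := exists_of_mem_greedySelect hb
      simpa using List.of_mem_filter hz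

theorem nodup_greedySelect {r : ℝ} (hr : 0 < r) (k : ℕ) (U : List (ℕ × ℝ)) :
    (greedySelect r k U).Nodup :=
  (pairwise_greedySelect r k U).imp fun {a b} h e => by
    subst e; simp at h; linarith

theorem argmax_snd_eq {U : List (ℕ × ℝ)} {f : ℕ → ℝ} {k : ℕ}
    (hf : ∀ i x, U[i]? = some x → f i = x.2) (h : (List.range U.length).argmax f = some k) :
    ∃ x, U[k]? = some x ∧ U.argmax Prod.snd = some x := by
  have hk := List.mem_range.1 (List.argmax_mem h)
  refine ⟨U[k], List.getElem?_eq_getElem hk, ?_⟩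
  have e : U = (List.range U.length).map fun i => U.getD i (0, 0) := by
    refine List.ext_getElem (by simp) fun i h1 h2 => ?_
    simp [h1]
  conv_lhs => rw [e]
  rw [argmax_map, argmax_congr (g := f), h]
  · simp [hk]
  · intro i hi
    rw [List.mem_range] at hi
    rw [hf i U[i] (List.getElem?_eq_getElem hi)]
    simp [hi]

/-- The selection step: moves the position with the highest score to the marks in the array `11`,
and deletes the positions that are too close to it from the list in the arrays `10`. -/
def filterProg : Prog :=
  .seq (line [natConst 222 0])
  (forLoop 220 216
    (.seq (line [natLoad 224 10 220, realLoad 224 10 220, realOfNat 225 224, realSub 225 225 216])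
      (.seq (.ifReal 225 1 (line [realSub 225 1 225]) .skip)
        (.ifReal 225 200 .skip
          (line [natStore 10 222 224, realStore 10 222 224, natAdd 222 222 3])))))

open Classical in
theorem spec_filterProg {U : List (ℕ × ℝ)} {r : ℝ} {c : ℕ} {σ : State} (hU : Entries U σ)
    (hn : σ.nvar 216 = U.length) (hc : σ.rvar 216 = c) (hr : σ.rvar 200 = r) (h1 : σ.nvar 3 = 1)
    (h0 : σ.rvar 1 = 0) :
    Spec filterProg σ (U.length * 13 + 3) (fun τ =>
      Entries (U.filter fun d => r ≤ |(d.1 : ℝ) - (c : ℝ)|) τ ∧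
      τ.nvar 222 = (U.filter fun d => r ≤ |(d.1 : ℝ) - (c : ℝ)|).length ∧ τ.narr 11 = σ.narr 11) := by
  set P : ℕ × ℝ → Bool := fun d => r ≤ |(d.1 : ℝ) - (c : ℝ)| with hP
  refine (Spec.seqF (T := 1) (T' := U.length * (10 + 3) + 2) (Spec.ofLine (by simp) rfl) 220 10
    (by decide) ?_).mono (by omega) fun _ h => h
  rintro _ rfl g1
  refine (spec_forLoop (A := 10) (n := U.length)
    (fun k τ => Entries ((U.take k).filter P) τ ∧ τ.nvar 222 = ((U.take k).filter P).length ∧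
      (∀ j x, k ≤ j → U[j]? = some x → τ.narr 10 j = x.1 ∧ τ.rarr 10 j = x.2) ∧
      τ.narr 11 = σ.narr 11)
    (by decide) (by norm_num) ((g1.nvar _ (by norm_num)).trans hn)
    (fun _ _ _ _ h => by simpa [Entries] using h) ?_ ?_).mono le_rfl fun τ h => ?_
  · simp [Entries]
    exact fun j a b => hU j (a, b)
  · rintro k hk τ gτ ik ⟨hV, hw, hrest, hm⟩
    have f := g1.trans gτ
    have c1 : τ.nvar 3 = 1 := (f.nvar _ (by norm_num)).trans h1
    have c2 : τ.rvar 1 = 0 := (f.rvar _ (by norm_num)).trans h0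
    have c3 : τ.rvar 200 = r := (f.rvar _ (by norm_num)).trans hr
    have c4 : τ.rvar 216 = c := (f.rvar _ (by norm_num)).trans hc
    have hx : U[k]? = some U[k] := List.getElem?_eq_getElem hk
    obtain ⟨x1, x2⟩ := hrest k _ le_rfl hx
    have hlen : ((U.take k).filter P).length ≤ k :=
      (List.length_filter_le _ _).trans (by simp)
    have ht : U.take (k + 1) = U.take k ++ [U[k]] := by
      rw [List.take_add_one, hx]; rfl
    rw [ht, List.filter_append]
    refine (Spec.seq (T := 4) (T' := 2 + 4) (Spec.ofLine (by simp) rfl) ?_)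
    rintro _ rfl
    refine Spec.seq (R := fun υ => υ.rvar 225 = |((U[k]).1 : ℝ) - c| ∧ υ.rvar 224 = (U[k]).2 ∧
      υ.nvar 224 = (U[k]).1 ∧ υ.nvar 222 = τ.nvar 222 ∧ υ.nvar 3 = 1 ∧ υ.rvar 200 = r ∧
      υ.narr = τ.narr ∧ υ.rarr = τ.rarr)
      (Spec.ifReal (T := 1) (fun h' => Spec.ofLine (by simp) ?_) fun h' => Spec.skip ?_) ?_
    · simp [ik, x1, c2, c4] at h'
      have h2 : ((U[k]).1 : ℝ) - c < 0 := sub_neg.2 (by exact_mod_cast h')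
      simp [ik, x1, x2, c1, c2, c3, c4, abs_of_neg h2]
    · simp [ik, x1, c2, c4] at h'
      have h2 : 0 ≤ ((U[k]).1 : ℝ) - c := sub_nonneg.2 (by exact_mod_cast h')
      simp [ik, x1, x2, c1, c3, c4, abs_of_nonneg h2]
    rintro υ ⟨r1, r2, r3, r4, r5, r6, r7, r8⟩
    refine (Spec.ifReal (T := 3) (fun h' => Spec.skip ?_) fun h' => Spec.ofLine (by simp) ?_)
    · rw [r1, r6] at h'
      have hPx : P U[k] = false := by simpa [hP] using h'
      refine ⟨?_, ?_, fun j x hj hjx => ?_, r7 ▸ hm⟩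
      · simp only [List.filter_cons, hPx, List.filter_nil, List.append_nil, Bool.false_eq_true, if_false]
        intro j x hj
        rw [r7, r8]
        exact hV j x hj
      · simp [hPx, r4, hw]
      · rw [r7, r8]; exact hrest j x (by omega) hjx
    · rw [r1, r6, not_lt] at h'
      have hPx : P U[k] = true := by simpa [hP] using h'
      refine ⟨?_, ?_, fun j x hj hjx => ?_, ?_⟩
      · simp only [List.filter_cons, hPx, List.filter_nil, if_true]
        refine Entries.concat ?_ (by simp [r4, hw, r3]) (by simp [r4, hw, r2])
        intro j x hj
        have hjl : j < ((U.take k).filter P).length := by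
          by_contra hjl
          rw [List.getElem?_eq_none (by omega)] at hj
          exact absurd hj (by simp)
        simp [r4, hw, hjl.ne, r7, r8]
        exact hV j x hj
      · simp [hPx, r4, hw, r5]
      · have : j ≠ ((U.take k).filter P).length := by omega
        simp [r4, hw, this, r7, r8]
        exact hrest j x (by omega) hjx
      · funext p
        simp [r7, hm]
  · have h := h.1
    rw [List.take_length] at h
    exact ⟨h.1, h.2.1, h.2.2.2⟩

/-- The greedy selection from the list in the arrays `10`; the selected positions are marked in the
array `11`. -/
def greedyProg : Prog :=
  .seq (line [natAdd 201 204 4])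
  (.seq (forLoop 202 200 (line [natStore 11 202 4]))
    (forLoop 202 201 (.ifNat 4 204
      (.seq (argmaxLoop 210 204 218 (line [realLoad 218 10 210]))
        (.seq (line [natLoad 214 10 212, natStore 11 214 3, natAdd 216 204 4, realOfNat 216 214])
          (.seq filterProg (line [natAdd 204 222 4])))) .skip)))

theorem spec_greedyProg {w f lam Z o y σ} (h : CandEnv w f lam Z o y σ) {U : List (ℕ × ℝ)}
    (hU : Entries U σ) (hn : σ.nvar 204 = U.length) :
    Spec greedyProg σ (U.length * (U.length * 29 + 14) + 4 * (y.length + 1) + 5) (fun τ =>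
      CandEnv w f lam Z o y τ ∧ ∀ p ≤ y.length,
        τ.narr 11 p = if p ∈ greedySelect (lam * y.length) U.length U then 1 else 0) := by
  set n := U.length with hnU
  refine (Spec.seqF (T := 1) (T' := ((y.length + 1) * (1 + 3) + 2) +
    (n * ((n * (1 + 15) + 2 + (4 + (n * 13 + 3 + 1)) + 1) + 3) + 2))
    (Spec.ofLine (by simp) rfl) 201 11 (by decide) ?_).mono (by ring_nf; omega) fun _ h => h
  rintro _ rfl g1
  have E1 := h.toListEnv.agree g1 (by norm_num) (by norm_num)
  have b1 : σ.nvar 200 = y.length + 1 := h.bound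
  refine Spec.seqF (spec_forLoop (A := 11) (n := y.length + 1)
    (fun k τ => (∀ p < k, τ.narr 11 p = 0) ∧ τ.nvar 204 = n ∧ τ.nvar 201 = n)
    (by decide) (by norm_num) (by simp [b1]) (fun _ _ _ _ h => by simpa using h)
    (by simp [hn, h.table.zero]) ?_) 202 11 (by decide) ?_
  · rintro k hk τ gτ ik ⟨hk0, h204, h201⟩
    refine Spec.ofLine (by simp) ?_
    have hz : τ.nvar 4 = 0 := (gτ.nvar 4 (by norm_num)).trans E1.table.zero
    simp [ik, hz, h204, h201]
    intro p hp hpk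
    exact hk0 p (by omega)
  rintro τ₂ ⟨⟨m0, n0, n1⟩, -⟩ g2
  have E2 : CandEnv w f lam Z o y τ₂ := by
    refine ⟨E1.agree g2 (by norm_num) (by norm_num), ?_, ?_, ?_⟩
    · rw [g2.nvar _ (by norm_num)]; simp [b1]
    · rw [g2.rvar _ (by norm_num)]; simp [h.margin]
    · rw [g2.rvar _ (by norm_num)]; simp [h.mesh]
  have U2 : Entries U τ₂ := by
    have := hU.agree g1 (by norm_num)
    exact this.agree g2 (by norm_num)
  refine (spec_forLoop (A := 10) (n := n)
    (fun k τ => ∃ V sel, greedySelect (lam * y.length) n U =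
        sel ++ greedySelect (lam * y.length) (n - k) V ∧ Entries V τ ∧ τ.nvar 204 = V.length ∧
        V.length ≤ n ∧ ∀ p ≤ y.length, τ.narr 11 p = if p ∈ sel then 1 else 0)
    (by decide) (by norm_num) n1 (fun _ _ _ _ h => by simpa [Entries] using h)
    ⟨U, [], by simp, by simpa [Entries] using U2, by simpa using n0, le_rfl, fun p hp => by
      simpa using m0 p (by omega)⟩ ?_).mono le_rfl fun τ h => ?_
  · rintro k hk τ gτ ik ⟨V, sel, hsel, hV, hVn, hVle, hm⟩
    have E3 := E2.agree gτ (by norm_num) (by norm_num)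
    have hk' : n - k = (n - (k + 1)) + 1 := by omega
    refine Spec.ifNat (fun h' => ?_) fun h' => Spec.skip ?_
    · rw [E3.table.zero, hVn] at h'
      refine (Spec.seqF (T := V.length * (1 + 15) + 2) (T' := 4 + (V.length * 13 + 3 + 1))
        (spec_argmaxLoop (A := 100) (fun i => τ.rarr 10 i) (by decide)
        (by norm_num) hVn (by norm_num) ?_) 210 100 (by decide) fun τ₄ h4 g4 => ?_).mono ?_
        fun _ h => h
      · intro i hi υ gυ iυ
        refine Spec.ofLine (by simp) ?_
        simp [iυ, gυ.rarr 10]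
      · obtain ⟨h4, -⟩ := h4 (by omega)
        obtain ⟨x, hx, hax⟩ := argmax_snd_eq (fun i x hi => (hV i x hi).2) h4
        have E4 := E3.agree g4 (by norm_num) (by norm_num)
        have V4 := hV.agree g4 (by norm_num)
        have hx4 := (V4 _ _ hx).1
        refine Spec.seqF (Spec.ofLine (by simp) rfl) 214 11 (by decide) ?_
        rintro _ rfl g5
        have E5 := E4.agree g5 (by norm_num) (by norm_num)
        have V5 := V4.agree g5 (by norm_num)
        refine Spec.seqF (spec_filterProg (c := x.1) (r := lam * y.length) V5
          (by simp [g4.nvar 204 (by norm_num), hVn, E4.table.zero])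
          (by simp at hx4; simp [hx4]) E5.margin E5.table.one E5.table.zeroR) 220 10 (by decide)
          fun τ₆ ⟨e1, e2, e3⟩ g6 => ?_
        refine Spec.ofLine (by simp) ⟨_, sel ++ [x.1], ?_, by simpa [Entries] using e1, ?_,
          (List.length_filter_le _ _).trans hVle, ?_⟩
        · rw [hsel, hk', greedySelect_succ _ _ _ hax]
          simp
        · simp [e2, g6.nvar 4 (by norm_num), E4.table.zero]
        · intro p hp
          have := hm p hp
          simp at hx4
          simp [e3, hx4, E4.table.one, g4.narr 11, this]
          by_cases hpx : p = x.1 <;> simp [hpx]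
      · have : V.length * 16 ≤ n * 16 := by omega
        have : V.length * 13 ≤ n * 13 := by omega
        omega
    · rw [E3.table.zero, hVn] at h'
      have hV0 : V = [] := List.eq_nil_of_length_eq_zero (by omega)
      subst hV0
      exact ⟨[], sel, by rw [hsel, greedySelect_nil, greedySelect_nil], hV, hVn, hVle, hm⟩
  · obtain ⟨⟨V, sel, hsel, -, -, -, hm⟩, g⟩ := h
    refine ⟨E2.agree g (by norm_num) (by norm_num), ?_⟩
    rw [Nat.sub_self] at hsel
    rw [hsel]
    simpa [greedySelect] using hm

end

section
open Instr Prog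

/-! ### Computing the list of candidate change points -/

/-- The positions `B`, shifted by `o`, are in the array `9` from the address `p` on. -/
def HoldsBounds (B : List ℕ) (o p : ℕ) (σ : State) : Prop :=
  ∀ k x, B[k]? = some x → σ.narr 9 (p + k) = o + x

theorem HoldsBounds.concat {B o p σ} {x : ℕ} (h : HoldsBounds B o p σ)
    (hx : σ.narr 9 (p + B.length) = o + x) : HoldsBounds (B ++ [x]) o p σ := by
  intro k z hk
  rw [List.getElem?_append] at hk
  split_ifs at hk with hlt
  · exact h k z hk
  · have : k - B.length = 0 := by
      by_contra h0
      rw [List.getElem?_eq_none (by simp; omega)] at hk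
      exact absurd hk (by simp)
    have e : k = B.length := by omega
    rw [this] at hk
    simp only [List.getElem?_cons_zero, Option.some.injEq] at hk
    subst hk e
    exact hx

/-- Lists the marked positions, and the end points of the sample, in the array `9`. -/
def scanProg : Prog :=
  .seq (line [natStore 9 162 160, natAdd 204 162 3])
  (.seq (forLoop 202 200 (.seq (line [natLoad 206 11 202])
    (.ifNat 206 3 .skip (line [natAdd 206 160 202, natStore 9 204 206, natAdd 204 204 3]))))
  (line [natAdd 206 160 161, natStore 9 204 206]))

open Classical in
theorem spec_scanProg {w f lam Z o y σ} (h : CandEnv w f lam Z o y σ) {p : ℕ}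
    (hp : σ.nvar 162 = p) {sel : List ℕ}
    (hm : ∀ k ≤ y.length, σ.narr 11 k = if k ∈ sel then 1 else 0) :
    Spec scanProg σ (8 * (y.length + 1) + 6) (fun τ =>
      HoldsBounds (0 :: ((List.range (y.length + 1)).filter (· ∈ sel) ++ [y.length])) o p τ ∧
      τ.nvar 204 = p + (((List.range (y.length + 1)).filter (· ∈ sel)).length + 1) ∧
      ∀ k < p, τ.narr 9 k = σ.narr 9 k) := by
  have h160 := h.start
  have h161 := h.len
  refine (Spec.seqF (T := 2) (T' := ((y.length + 1) * (5 + 3) + 2) + 2)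
    (Spec.ofLine (by simp) rfl) 202 9 (by decide) ?_).mono (by ring_nf; omega) fun _ h => h
  rintro _ rfl g1
  refine Spec.seq ((spec_forLoop (A := 9) (n := y.length + 1)
    (fun k τ => HoldsBounds (0 :: (List.range k).filter (· ∈ sel)) o p τ ∧
      τ.nvar 204 = p + (((List.range k).filter (· ∈ sel)).length + 1) ∧
      (∀ k < p, τ.narr 9 k = σ.narr 9 k) ∧ τ.narr 11 = σ.narr 11)
    (by decide) (by norm_num) ((g1.nvar _ (by norm_num)).trans h.bound)
    (fun _ _ _ _ h => by simpa [HoldsBounds] using h) ?_ ?_)) ?_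
  · refine ⟨?_, ?_, ?_, ?_⟩
    · intro k x hk
      cases k with
      | zero => simp at hk; subst hk; simp [hp, h160]
      | succ k => simp at hk
    · simp [hp, h.table.one]
    · intro k hk
      simp [hp, hk.ne]
    · funext k; simp
  · rintro k hk τ gτ ik ⟨hB, hn, hold, hmk⟩
    have f := (g1.trans gτ)
    have c1 : τ.nvar 3 = 1 := (f.nvar _ (by norm_num)).trans h.table.one
    have c2 : τ.nvar 160 = o := (f.nvar _ (by norm_num)).trans h160
    refine Spec.seq (T := 1) (T' := 3 + 1) (Spec.ofLine (by simp) rfl) ?_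
    rintro _ rfl
    have hmk' : τ.narr 11 k = if k ∈ sel then 1 else 0 := by rw [hmk]; exact hm k (by omega)
    rw [List.range_succ, List.filter_append]
    refine Spec.ifNat (fun h' => Spec.skip ?_) fun h' => Spec.ofLine (by simp) ?_
    · simp [ik, hmk', c1] at h'
      simpa [List.filter_cons, h', HoldsBounds] using ⟨hB, hn, hold, hmk⟩
    · simp [ik, hmk', c1] at h'
      refine ⟨?_, ?_, ?_, ?_⟩
      · simp only [List.filter_cons, h', List.filter_nil, decide_true, if_true]
        rw [← List.cons_append]
        refine HoldsBounds.concat ?_ (by simp [hn, c2, ik])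
        intro j x hj
        have hjl : j < ((List.range k).filter (· ∈ sel)).length + 1 := by
          by_contra hjl
          rw [List.getElem?_eq_none (by simp; omega)] at hj
          exact absurd hj (by simp)
        simp only [exec_natLoad, exec_natAdd, exec_natStore, exec_nil]
        simp [hn, hjl.ne]
        exact hB j x hj
      · simp [h', hn, c1, add_assoc]
      · intro j hj
        have : j ≠ p + (((List.range k).filter (· ∈ sel)).length + 1) := by omega
        simp [hn, this]
        exact hold j hj
      · funext j
        simp [hmk]
  · rintro τ ⟨⟨hB, hn, hold, -⟩, gτ⟩
    have f := (g1.trans gτ)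
    have c2 : τ.nvar 160 = o := (f.nvar _ (by norm_num)).trans h160
    have c3 : τ.nvar 161 = y.length := (f.nvar _ (by norm_num)).trans h161
    refine Spec.ofLine (by simp) ⟨?_, by simp [hn], ?_⟩
    · rw [← List.cons_append]
      refine HoldsBounds.concat ?_ (by simp [hn, c2, c3])
      intro j x hj
      have hjl : j < ((List.range (y.length + 1)).filter (· ∈ sel)).length + 1 := by
        by_contra hjl
        rw [List.getElem?_eq_none (by simp; omega)] at hj
        exact absurd hj (by simp)
      simp [hn, hjl.ne]
      exact hB j x hj
    · intro j hj
      have : j ≠ p + (((List.range (y.length + 1)).filter (· ∈ sel)).length + 1) := by omega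
      simp [hn, this]
      exact hold j hj

theorem le_of_mem_scoredCandidates {w : ℕ → ℝ} {D : ℕ → ℕ∞} {lam : ℝ} {y : List ℝ}
    {x : ℕ × ℝ} (h : x ∈ scoredCandidates w D lam y) :
    0 < x.1 ∧ lam * y.length ≤ x.1 ∧ (x.1 : ℝ) + lam * y.length ≤ y.length := by
  unfold scoredCandidates at h
  simpa using List.of_mem_filter h

theorem nodup_select {w : ℕ → ℝ} {D : ℕ → ℕ∞} {lam : ℝ} (hlam : 0 < lam) (y : List ℝ) (k : ℕ) :
    (greedySelect (lam * y.length) k (scoredCandidates w D lam y)).Nodup := by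
  rcases Nat.eq_zero_or_pos y.length with h | h
  · have : scoredCandidates w D lam y = [] := by
      rw [List.eq_nil_iff_forall_not_mem]
      intro x hx
      obtain ⟨h1, -, h3⟩ := le_of_mem_scoredCandidates hx
      rw [h] at h3
      simp only [Nat.cast_zero, mul_zero, add_zero] at h3
      have : (0 : ℝ) < x.1 := by exact_mod_cast h1
      linarith
    rw [this, greedySelect_nil]
    exact List.nodup_nil
  · exact nodup_greedySelect (by positivity) _ _

theorem mem_listEstimator {w : ℕ → ℝ} {D : ℕ → ℕ∞} {lam : ℝ} {y : List ℝ} {s : ℕ} :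
    s ∈ listEstimator w D lam y ↔ s ∈ greedySelect (lam * y.length)
      (scoredCandidates w D lam y).length (scoredCandidates w D lam y) :=
  (List.mergeSort_perm _ _).mem_iff

theorem of_mem_listEstimator {w : ℕ → ℝ} {D : ℕ → ℕ∞} {lam : ℝ} {y : List ℝ}
    {s : ℕ} (h : s ∈ listEstimator w D lam y) :
    0 < s ∧ lam * y.length ≤ s ∧ (s : ℝ) + lam * y.length ≤ y.length := by
  rw [mem_listEstimator] at h
  obtain ⟨x, hx, rfl⟩ := exists_of_mem_greedySelect h
  exact le_of_mem_scoredCandidates hx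

theorem le_of_mem_listEstimator {w : ℕ → ℝ} {D : ℕ → ℕ∞} {lam : ℝ} (hlam : 0 < lam) {y : List ℝ}
    {s : ℕ} (h : s ∈ listEstimator w D lam y) : s ≤ y.length := by
  have h3 := (of_mem_listEstimator h).2.2
  have : 0 ≤ lam * y.length := by positivity
  exact_mod_cast (show (s : ℝ) ≤ y.length by linarith)

open Classical in
/-- The sorted output is obtained by a scan of the selected positions. -/
theorem listEstimator_eq_filter {w : ℕ → ℝ} {D : ℕ → ℕ∞} {lam : ℝ} (hlam : 0 < lam) (y : List ℝ) :
    listEstimator w D lam y = (List.range (y.length + 1)).filter (· ∈ greedySelect (lam * y.length)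
      (scoredCandidates w D lam y).length (scoredCandidates w D lam y)) := by
  set G := greedySelect (lam * y.length)
      (scoredCandidates w D lam y).length (scoredCandidates w D lam y) with hG
  have h1 : (listEstimator w D lam y).Pairwise (· ≤ ·) := by
    have := List.pairwise_mergeSort (le := fun a b : ℕ => decide (a ≤ b))
      (by simp; intro a b c; omega) (by simp; intro a b; omega) G
    simp only [decide_eq_true_eq] at this
    exact this
  have h2 : ((List.range (y.length + 1)).filter (· ∈ G)).Pairwise (· ≤ ·) :=
    (List.pairwise_le_range).filter _
  refine List.Perm.eq_of_pairwise (fun a b _ _ => le_antisymm) h1 h2 ?_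
  rw [List.perm_ext_iff_of_nodup]
  · intro a
    rw [mem_listEstimator, List.mem_filter, List.mem_range]
    simp only [decide_eq_true_eq]
    constructor
    · intro h
      exact ⟨Nat.lt_succ_of_le (le_of_mem_listEstimator hlam (mem_listEstimator.2 h)), h⟩
    · exact fun h => h.2
  · exact (List.mergeSort_perm _ _).nodup_iff.2 (nodup_select hlam y _)
  · exact List.nodup_range.filter _

theorem length_scoredCandidates_le (w : ℕ → ℝ) (lam : ℝ) (y : List ℝ) :
    (scoredCandidates w logCut lam y).length ≤ 2 * ⌊3 / lam⌋₊ := by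
  rw [scoredCandidates_eq, two_mul]
  exact (List.length_filterMap_le _ _).trans (by simp)

theorem length_greedySelect_le (r : ℝ) (k : ℕ) (U : List (ℕ × ℝ)) :
    (greedySelect r k U).length ≤ k := by
  induction k generalizing U with
  | zero => simp [greedySelect]
  | succ k ih =>
    cases hU : U.argmax Prod.snd with
    | none =>
      rw [List.argmax_eq_none] at hU
      subst hU
      simp [greedySelect]
    | some x =>
      rw [greedySelect_succ r k U hU, List.length_cons]
      exact Nat.succ_le_succ (ih _)

theorem length_listEstimator_le (w : ℕ → ℝ) (lam : ℝ) (y : List ℝ) :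
    (listEstimator w logCut lam y).length ≤ 2 * ⌊3 / lam⌋₊ := by
  unfold listEstimator
  rw [List.length_mergeSort]
  exact (length_greedySelect_le _ _ _).trans (length_scoredCandidates_le w lam y)

/-- The list-estimator of the sample described by the registers `160`, `161`; its output is stored
in the array `9` from the address in the register `162` on. -/
def listProg : Prog := .seq candProg (.seq greedyProg scanProg)

theorem spec_listProg {w f lam Z o y σ} (h : ListEnv w f lam Z o y σ) (hlam : 0 < lam) {p : ℕ}
    (hp : σ.nvar 162 = p) :
    Spec listProg σ (10 * (⌊3 / lam⌋₊ * (⌊y.length * (lam / 3)⌋₊ + 2) *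
        (100 * ((Z + 1) * (Nat.log 2 Z + 1) ^ 2))) + 150 * ⌊3 / lam⌋₊ ^ 2 +
        100 * ((Z + 1) * (Nat.log 2 Z + 1) ^ 2)) (fun τ =>
      HoldsBounds (0 :: (listEstimator w logCut lam y ++ [y.length])) o p τ ∧
      τ.nvar 204 = p + ((listEstimator w logCut lam y).length + 1) ∧
      ∀ k < p, τ.narr 9 k = σ.narr 9 k) := by
  have hT1 : 100 * (y.length + 1) ≤ 100 * ((Z + 1) * (Nat.log 2 Z + 1) ^ 2) := by
    have h1 := h.fits
    have h2 : 1 ≤ (Nat.log 2 Z + 1) ^ 2 := Nat.one_le_pow _ _ (by omega)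
    calc 100 * (y.length + 1) ≤ 100 * ((Z + 1) * 1) := by omega
      _ ≤ _ := by gcongr
  have hlen := length_scoredCandidates_le w lam y
  set U := scoredCandidates w logCut lam y with hU
  set X := 100 * ((Z + 1) * (Nat.log 2 Z + 1) ^ 2) with hX
  refine (Spec.seqF (T := ⌊3 / lam⌋₊ * (10 * (⌊y.length * (lam / 3)⌋₊ + 2) * X) + 12)
    (T' := (U.length * (U.length * 29 + 14) + 4 * (y.length + 1) + 5) + (8 * (y.length + 1) + 6))
    (spec_candProg h hlam.le) 200 10 (by decide) fun τ₁ h1 g1 => ?_).mono ?_ fun _ h => h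
  · obtain ⟨E1, U1, n1⟩ := h1
    refine Spec.seqF (spec_greedyProg E1 U1 n1) 201 10 (by decide) fun τ₂ h2 g2 => ?_
    obtain ⟨E2, m2⟩ := h2
    refine (spec_scanProg E2 (p := p)
      (by rw [g2.nvar _ (by norm_num), g1.nvar _ (by norm_num), hp]) m2).mono le_rfl fun τ h => ?_
    rw [listEstimator_eq_filter hlam]
    rw [g2.narr _ (by norm_num), g1.narr _ (by norm_num)] at h
    exact h
  · generalize ⌊3 / lam⌋₊ = q at *
    generalize ⌊y.length * (lam / 3)⌋₊ + 2 = H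
    have e1 : q * (10 * H * X) = 10 * (q * H * X) := by ring
    have e2 : U.length * (U.length * 29 + 14) ≤ 150 * q ^ 2 := by
      calc U.length * (U.length * 29 + 14) ≤ (2 * q) * ((2 * q) * 29 + 14) := by gcongr
        _ = 116 * q ^ 2 + 28 * q := by ring
        _ ≤ 150 * q ^ 2 := by nlinarith [Nat.le_self_pow (n := 2) (by norm_num) q]
    omega

end

section
open Instr Prog

/-! ### Computing the distance between samples -/

theorem iSup_fin_eq_of_argmax {n k : ℕ} {g : ℕ → ℝ} (h : (List.range n).argmax g = some k) :
    ⨆ i : Fin n, g i = g k := by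
  have hk := List.mem_range.1 (List.argmax_mem h)
  have : Nonempty (Fin n) := ⟨⟨k, hk⟩⟩
  refine le_antisymm (ciSup_le fun i => ?_)
    (le_ciSup (f := fun i : Fin n => g i) (Set.finite_range _).bddAbove ⟨k, hk⟩)
  exact List.le_of_mem_argmax (List.mem_range.2 i.2) h

theorem iInf_fin_eq_of_argmax {n k : ℕ} {g : ℕ → ℝ}
    (h : (List.range n).argmax (fun i => -g i) = some k) : ⨅ i : Fin n, g i = g k := by
  have hk := List.mem_range.1 (List.argmax_mem h)
  have : Nonempty (Fin n) := ⟨⟨k, hk⟩⟩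
  refine le_antisymm (ciInf_le (f := fun i : Fin n => g i) (Set.finite_range _).bddBelow ⟨k, hk⟩)
    (le_ciInf fun i => ?_)
  have := List.le_of_mem_argmax (List.mem_range.2 i.2) h
  linarith

/-- The boundaries of the segments of a sample. -/
def boundaries (w : ℕ → ℝ) (D : ℕ → ℕ∞) (lam : ℝ) (y : List ℝ) : List ℕ :=
  0 :: (listEstimator w D lam y ++ [y.length])

theorem length_segments (w : ℕ → ℝ) (D : ℕ → ℕ∞) (lam : ℝ) (y : List ℝ) :
    (segments w D lam y).length = (listEstimator w D lam y).length + 1 := by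
  simp [segments]

theorem length_boundaries (w : ℕ → ℝ) (D : ℕ → ℕ∞) (lam : ℝ) (y : List ℝ) :
    (boundaries w D lam y).length = (segments w D lam y).length + 1 := by
  simp [boundaries, length_segments]

theorem le_of_mem_boundaries {w : ℕ → ℝ} {D : ℕ → ℕ∞} {lam : ℝ} (hlam : 0 < lam) {y : List ℝ} {s : ℕ}
    (h : s ∈ boundaries w D lam y) : s ≤ y.length := by
  simp only [boundaries, List.mem_cons, List.mem_append, List.not_mem_nil, or_false] at h
  rcases h with h | h | h
  · omega
  · exact le_of_mem_listEstimator hlam h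
  · omega

theorem take_seg (y : List ℝ) (a b n : ℕ) : (seg y a b).take n = seg y a (min (a + n) b) := by
  rw [seg, seg, List.take_take]
  congr 1
  omega

/-- The first `n` terms of a segment. -/
theorem take_segments {w : ℕ → ℝ} {D : ℕ → ℕ∞} {lam : ℝ} {y : List ℝ} {n k : ℕ}
    (h : k < (segments w D lam y).length) :
    (segments w D lam y)[k].take n =
      seg y ((boundaries w D lam y).getD k 0)
        (min ((boundaries w D lam y).getD k 0 + n) ((boundaries w D lam y).getD (k + 1) 0)) := by
  rw [length_segments] at h
  rw [← take_seg]
  congr 1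
  simp only [segments, List.getElem_zipWith]
  congr 1
  · simp only [boundaries]
    cases k with
    | zero => simp
    | succ k =>
      have : k < (listEstimator w D lam y).length := by omega
      simp [List.getElem?_append, this]
  · simp only [boundaries]
    have : k < (listEstimator w D lam y ++ [y.length]).length := by simp; omega
    rw [List.getD_cons_succ, List.getD_eq_getElem _ _ this]

/-- The maximum over the segments of one sample of the minimum over the segments of another one of
the empirical distance of their first terms. The registers `164`, `165` and `166`, `167` hold the
addresses of the boundaries and the numbers of the segments, the register `168` the number of
terms. The result is left in the real register `202`. -/
def maxMinProg : Prog :=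
  argmaxLoop 200 165 203 (.seq (argmaxLoop 210 167 213
    (.seq (line [natAdd 220 164 200, natLoad 280 9 220, natAdd 220 220 3, natLoad 281 9 220,
      natAdd 221 280 168, natAdd 220 166 210, natLoad 282 9 220, natAdd 220 220 3, natLoad 283 9 220,
      natAdd 222 282 168])
    (.seq (.ifNat 221 281 (line [natAdd 281 221 4]) .skip)
    (.seq (.ifNat 222 283 (line [natAdd 283 222 4]) .skip)
    (.seq distProg (line [realSub 213 1 312]))))))
    (line [realSub 203 1 212]))

theorem spec_maxMinProg {w f lam Z o o' y y' σ} (h : TableReady w f Z σ) (hlam : 0 < lam)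
    (hy : Contains f o y) (hy' : Contains f o' y') (hZ : o + y.length ≤ Z)
    (hZ' : o' + y'.length ≤ Z) {p p' n : ℕ} (hp : σ.nvar 164 = p)
    (hc : σ.nvar 165 = (segments w logCut lam y).length) (hp' : σ.nvar 166 = p')
    (hc' : σ.nvar 167 = (segments w logCut lam y').length) (hn : σ.nvar 168 = n)
    (hB : HoldsBounds (boundaries w logCut lam y) o p σ)
    (hB' : HoldsBounds (boundaries w logCut lam y') o' p' σ) :
    Spec maxMinProg σ ((segments w logCut lam y).length * ((segments w logCut lam y').length *
        (100 * ((Z + 1) * (Nat.log 2 Z + 1) ^ 2) + 30) + 18) + 2)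
      (fun τ => τ.rvar 202 = maxMinDist w logCut n (segments w logCut lam y)
        (segments w logCut lam y')) := by
  set X := 100 * ((Z + 1) * (Nat.log 2 Z + 1) ^ 2) with hX
  set S := segments w logCut lam y with hS
  set S' := segments w logCut lam y' with hS'
  set B := boundaries w logCut lam y with hBd
  set B' := boundaries w logCut lam y' with hBd'
  set F : ℕ → ℕ → ℝ := fun a b => stretchDist w f Z (o + B.getD a 0)
    (o + min (B.getD a 0 + n) (B.getD (a + 1) 0)) (o' + B'.getD b 0)
    (o' + min (B'.getD b 0 + n) (B'.getD (b + 1) 0)) with hF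
  have lB : B.length = S.length + 1 := length_boundaries w logCut lam y
  have lB' : B'.length = S'.length + 1 := length_boundaries w logCut lam y'
  have gB : ∀ k < B.length, B[k]? = some (B.getD k 0) := fun k hk => by simp [hk]
  have gB' : ∀ k < B'.length, B'[k]? = some (B'.getD k 0) := fun k hk => by simp [hk]
  have bB : ∀ k < B.length, B.getD k 0 ≤ y.length := fun k hk =>
    le_of_mem_boundaries hlam (List.mem_of_getElem? (gB k hk))
  have bB' : ∀ k < B'.length, B'.getD k 0 ≤ y'.length := fun k hk =>
    le_of_mem_boundaries hlam (List.mem_of_getElem? (gB' k hk))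
  have c0 : 0 < S.length := by rw [hS, length_segments]; omega
  have c0' : 0 < S'.length := by rw [hS', length_segments]; omega
  have hFE : ∀ (a : Fin S.length) (b : Fin S'.length),
      empDist w logCut ((S.get a).take n) ((S'.get b).take n) = F a b := by
    intro a b
    have h1 := bB (a + 1) (by omega)
    have h2 := bB' (b + 1) (by omega)
    rw [List.get_eq_getElem, List.get_eq_getElem, take_segments a.2, take_segments b.2,
      empDist_seg hy hy' hZ hZ' ((min_le_right _ _).trans h1) ((min_le_right _ _).trans h2)]
  refine (spec_argmaxLoop (A := 100) (i := 200) (x := 165) (r := 203)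
    (T := S'.length * (X + 30) + 3) (fun a => ⨅ b : Fin S'.length, F a b)
    (by decide) (by norm_num) hc (by norm_num) ?_).mono (by ring_nf; omega) fun τ hτ => ?_
  · intro a ha τ g1 ia
    refine (Spec.seqF (T := S'.length * ((X + 15) + 15) + 2) (T' := 1)
      (spec_argmaxLoop (A := 100) (i := 210) (x := 167) (r := 213)
      (fun b => - F a b) (by decide) (by norm_num) ((g1.nvar _ (by norm_num)).trans hc')
      (by norm_num) ?_) 210 100 (by decide) ?_).mono le_rfl fun _ h => h
    · intro b hb υ g2 ib
      have g3 := g1.trans (g2.mono (by norm_num) le_rfl)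
      have T3 := h.agree g3 (by norm_num) (by norm_num)
      have ia' : υ.nvar 200 = a := (g2.nvar _ (by norm_num)).trans ia
      have q164 : υ.nvar 164 = p := (g3.nvar _ (by norm_num)).trans hp
      have q166 : υ.nvar 166 = p' := (g3.nvar _ (by norm_num)).trans hp'
      have q168 : υ.nvar 168 = n := (g3.nvar _ (by norm_num)).trans hn
      have q9 : υ.narr 9 = σ.narr 9 := g3.narr _ (by norm_num)
      have r1 := hB a _ (gB a (by omega))
      have r2 := hB (a + 1) _ (gB (a + 1) (by omega))
      have r3 := hB' b _ (gB' b (by omega))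
      have r4 := hB' (b + 1) _ (gB' (b + 1) (by omega))
      rw [← add_assoc] at r2 r4
      have s1 := bB a (by omega)
      have s2 := bB (a + 1) (by omega)
      have s3 := bB' b (by omega)
      have s4 := bB' (b + 1) (by omega)
      generalize hx1 : B.getD a 0 = x1 at *
      generalize hx2 : B.getD (a + 1) 0 = x2 at *
      generalize hx3 : B'.getD b 0 = x3 at *
      generalize hx4 : B'.getD (b + 1) 0 = x4 at *
      have hFab : F a b = stretchDist w f Z (o + x1) (o + min (x1 + n) x2) (o' + x3)
          (o' + min (x3 + n) x4) := by simp only [hF, hx1, hx2, hx3, hx4]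
      refine (Spec.seqF (T := 10) (T' := 2 + (2 + (X + 1))) (Spec.ofLine (by simp) rfl) 213 100
        (by decide) ?_).mono (by omega) fun _ h => h
      rintro _ rfl g4
      have T4 := T3.agree g4 (by norm_num) (by norm_num)
      have c4 : υ.nvar 4 = 0 := T3.zero
      have c3 : υ.nvar 3 = 1 := T3.one
      refine Spec.seqF (R := fun τ => τ.nvar 280 = o + x1 ∧ τ.nvar 281 = o + min (x1 + n) x2 ∧
        τ.nvar 282 = o' + x3 ∧ τ.nvar 283 = o' + x4 ∧ τ.nvar 222 = o' + x3 + n)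
        (Spec.ifNat (T := 1) (fun h' => Spec.ofLine (by simp) ?_) fun h' => Spec.skip ?_) 213 100
        (by decide) ?_
      · simp [ia', ib, q164, q166, q168, q9, r1, r2, r3, r4, c3, c4] at h' ⊢
        omega
      · simp [ia', ib, q164, q166, q168, q9, r1, r2, r3, r4, c3] at h' ⊢
        omega
      rintro τ₅ ⟨m1, m2, m3, m4, m5⟩ g5
      have T5 := T4.agree g5 (by norm_num) (by norm_num)
      refine Spec.seqF (R := fun τ => τ.nvar 280 = o + x1 ∧ τ.nvar 281 = o + min (x1 + n) x2 ∧
        τ.nvar 282 = o' + x3 ∧ τ.nvar 283 = o' + min (x3 + n) x4)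
        (Spec.ifNat (T := 1) (fun h' => Spec.ofLine (by simp) ?_) fun h' => Spec.skip ?_) 213 100
        (by decide) ?_
      · simp [m1, m2, m3, m4, m5, T5.zero] at h' ⊢
        omega
      · simp [m1, m2, m3, m4, m5] at h' ⊢
        omega
      rintro τ₆ ⟨m1, m2, m3, m4⟩ g6
      have T6 := T5.agree g6 (by norm_num) (by norm_num)
      refine Spec.seqF (spec_distProg T6 m1 m2 m3 m4 (by omega) (by omega) (by omega) (by omega))
        300 100 (by decide) fun τ₇ h7 g7 => Spec.ofLine (by simp) ?_
      have T7 := T6.agree g7 (by norm_num) (by norm_num)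
      simp [h7, T7.zeroR, hFab]
    · intro υ hυ g2
      have T3 := h.agree (g1.trans (g2.mono (by norm_num) le_rfl)) (by norm_num) (by norm_num)
      obtain ⟨k1, k2⟩ := hυ (by omega)
      refine Spec.ofLine (by simp) ?_
      rw [iInf_fin_eq_of_argmax k1]
      simp at k2
      simp [T3.zeroR, k2]
  · obtain ⟨k1, k2⟩ := hτ (by omega)
    rw [k2, maxMinDist, ← iSup_fin_eq_of_argmax k1]
    simp only [hFE]

end

section
open Instr Prog

/-- Copies the samples with the indices in the registers `40` and `32`, one after the other, to the
real array `5`; their lengths are left in the registers `50` and `52`, the total length and its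
successor in the registers `54` and `55`. -/
def loadProg : Prog :=
  .seq (line [natLoad 50 0 40, natLoad 51 2 40, natLoad 52 0 32, natLoad 53 2 32, natAdd 54 50 52,
    natAdd 55 54 3])
  (.seq (forLoop 56 50 (line [natAdd 58 51 56, realLoad 58 0 58, realStore 5 56 58]))
  (forLoop 56 52 (line [natAdd 58 53 56, realLoad 58 0 58, natAdd 59 50 56, realStore 5 59 58])))

/-- The global data of the clustering program that concern the samples `y` and `y'` with the
indices in the registers `40` and `32`. -/
structure DeltaEnv (w : ℕ → ℝ) (lam : ℝ) (y y' : List ℝ) (σ : State) : Prop where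
  count : σ.nvar 2 = ⌊3 / lam⌋₊
  one : σ.nvar 3 = 1
  zero : σ.nvar 4 = 0
  zeroR : σ.rvar 1 = 0
  lamEq : σ.rvar 0 = lam
  weights : σ.rarr 1 = w
  len : σ.narr 0 (σ.nvar 40) = y.length
  len' : σ.narr 0 (σ.nvar 32) = y'.length
  data : Contains (σ.rarr 0) (σ.narr 2 (σ.nvar 40)) y
  data' : Contains (σ.rarr 0) (σ.narr 2 (σ.nvar 32)) y'

theorem DeltaEnv.agree {w lam y y' σ τ} (h : DeltaEnv w lam y y' σ) {A : ℕ} (g : Agree 50 A σ τ)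
    (hA : 5 ≤ A) : DeltaEnv w lam y y' τ := by
  have n40 := g.nvar 40 (by norm_num)
  have n32 := g.nvar 32 (by norm_num)
  have a0 := g.narr 0 (by omega)
  have a2 := g.narr 2 (by omega)
  have r0 := g.rarr 0 (by omega)
  constructor
  · exact (g.nvar _ (by norm_num)).trans h.count
  · exact (g.nvar _ (by norm_num)).trans h.one
  · exact (g.nvar _ (by norm_num)).trans h.zero
  · exact (g.rvar _ (by norm_num)).trans h.zeroR
  · exact (g.rvar _ (by norm_num)).trans h.lamEq
  · exact (g.rarr _ (by omega)).trans h.weights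
  · rw [n40, a0, h.len]
  · rw [n32, a0, h.len']
  · rw [n40, a2, r0]; exact h.data
  · rw [n32, a2, r0]; exact h.data'

theorem spec_loadProg {w lam y y' σ} (h : DeltaEnv w lam y y' σ) :
    Spec loadProg σ (7 * (y.length + y'.length) + 10) (fun τ =>
      Contains (τ.rarr 5) 0 y ∧ Contains (τ.rarr 5) y.length y' ∧ τ.nvar 50 = y.length ∧
      τ.nvar 52 = y'.length ∧ τ.nvar 54 = y.length + y'.length ∧
      τ.nvar 55 = y.length + y'.length + 1) := by
  refine (Spec.seqF (T := 6) (T' := (y.length * (3 + 3) + 2) + (y'.length * (4 + 3) + 2))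
    (R := fun τ => τ.nvar 50 = y.length ∧ τ.nvar 51 = σ.narr 2 (σ.nvar 40) ∧
      τ.nvar 52 = y'.length ∧ τ.nvar 53 = σ.narr 2 (σ.nvar 32) ∧
      τ.nvar 54 = y.length + y'.length ∧ τ.nvar 55 = y.length + y'.length + 1)
    (Spec.ofLine (by simp) ?_) 50 5 (by decide) ?_).mono (by omega) fun _ h => h
  · simp [h.len, h.len', h.one]
  rintro τ ⟨e50, e51, e52, e53, e54, e55⟩ g1
  refine Spec.seqF (spec_forLoop (A := 5) (n := y.length) (T := 3)
    (fun k υ => ∀ t < k, y.getD t 0 = υ.rarr 5 t) (by decide) (by norm_num) e50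
    (fun _ _ _ _ h => by simpa using h) (by simp) ?_) 56 5 (by decide) ?_
  · intro k hk υ g2 ik hinv
    have g := g1.trans (g2.mono (by norm_num) le_rfl)
    refine Spec.ofLine (by simp) ?_
    have q51 : υ.nvar 51 = σ.narr 2 (σ.nvar 40) := (g2.nvar _ (by norm_num)).trans e51
    have q0 : υ.rarr 0 = σ.rarr 0 := g.rarr _ (by norm_num)
    intro t ht
    rcases Nat.lt_succ_iff_lt_or_eq.1 ht with ht | rfl
    · simpa [ik, ht.ne] using hinv t ht
    · simpa [ik, q51, q0] using h.data t hk
  rintro υ ⟨hy, -⟩ g2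
  have hy0 : Contains (υ.rarr 5) 0 y := fun t ht => by rw [hy t ht, zero_add]
  have f50 := (g2.nvar 50 (by norm_num)).trans e50
  have f52 := (g2.nvar 52 (by norm_num)).trans e52
  refine (spec_forLoop (A := 5) (n := y'.length) (T := 4)
    (fun k υ => Contains (υ.rarr 5) 0 y ∧ ∀ t < k, y'.getD t 0 = υ.rarr 5 (y.length + t))
    (by decide) (by norm_num) f52
    (fun _ _ _ _ h => by simpa using h) (by simpa using hy0) ?_).mono le_rfl fun ρ hρ => ?_
  · rintro k hk ρ g3 ik ⟨i1, i2⟩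
    have g := g1.trans ((g2.trans g3).mono (by norm_num) le_rfl)
    refine Spec.ofLine (by simp) ?_
    have q53 : ρ.nvar 53 = σ.narr 2 (σ.nvar 32) := ((g2.trans g3).nvar _ (by norm_num)).trans e53
    have q0 : ρ.rarr 0 = σ.rarr 0 := g.rarr _ (by norm_num)
    have q50 : ρ.nvar 50 = y.length := (g3.nvar _ (by norm_num)).trans f50
    refine ⟨fun t ht => ?_, fun t ht => ?_⟩
    · have hne : t ≠ y.length + k := by omega
      simpa [ik, q50, hne] using i1 t ht
    · rcases Nat.lt_succ_iff_lt_or_eq.1 ht with ht | rfl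
      · simpa [ik, q50, ht.ne] using i2 t ht
      · simpa [ik, q50, q53, q0] using h.data' t hk
  · obtain ⟨⟨i1, i2⟩, g3⟩ := hρ
    have g := g2.trans g3
    exact ⟨i1, i2, (g.nvar _ (by norm_num)).trans e50, (g.nvar _ (by norm_num)).trans e52,
      (g.nvar _ (by norm_num)).trans e54, (g.nvar _ (by norm_num)).trans e55⟩

/-- The estimate of the distance between the samples with the indices in the registers `40` and
`32`. The result is left in the real register `176`. -/
def deltaProg : Prog :=
  .seq loadProg
  (.seq tableProg
  (.seq (line [natConst 160 0, natAdd 161 50 4, natConst 162 0])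
  (.seq listProg
  (.seq (line [natAdd 165 204 4, natAdd 160 50 4, natAdd 161 52 4, natAdd 162 204 3])
  (.seq listProg
  (.seq (line [natSub 167 204 162, natConst 164 0, natAdd 166 162 4, realOfNat 170 50,
    realMul 170 0 170, realOfNat 171 52, realMul 171 0 171])
  (.seq (.ifReal 171 170 (line [realAdd 170 171 1]) .skip)
  (.seq (floorLoop 180 54 170)
  (.seq (line [natAdd 168 182 4])
  (.seq maxMinProg
  (.seq (line [realAdd 175 202 1, natAdd 180 164 4, natAdd 181 165 4, natAdd 164 166 4,
    natAdd 165 167 4, natAdd 166 180 4, natAdd 167 181 4])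
  (.seq maxMinProg
  (line [realAdd 176 202 175])))))))))))))

/-- Collects the costs of the parts of `deltaProg`: `X` bounds the cost of one empirical distance, `h`
and `h'` are the lengths of the blocks, `q` is half the number of blocks, and `s` and `s'` are the
numbers of candidates. -/
theorem deltaCost_le {q h h' s s' L L' Z K X : ℕ} (hZ : Z = L + L') (hq : 1 ≤ q)
    (hs : s ≤ 2 * q) (hs' : s' ≤ 2 * q) (hX : X = 100 * ((Z + 1) * (K + 1) ^ 2)) :
    (7 * (L + L') + 10) + (150 * ((Z + 1) ^ 2 * (K + 1) ^ 3) + (3 +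
      ((10 * (q * (h + 2) * X) + 150 * q ^ 2 + X) + (4 +
      ((10 * (q * (h' + 2) * X) + 150 * q ^ 2 + X) + (7 + (2 + ((Z * 7 + 4) + (1 +
      (((s + 1) * ((s' + 1) * (X + 30) + 18) + 2) + (7 +
      (((s' + 1) * ((s + 1) * (X + 30) + 18) + 2) + 1)))))))))))) ≤
    200 * ((Z + 1) ^ 2 * (K + 1) ^ 3) + 60 * ((q * (h + h' + 4) + q ^ 2) * X) := by
  have hX1 : 100 ≤ X := by
    rw [hX]
    exact Nat.le_mul_of_pos_right _ (by positivity)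
  have hZX : 100 * Z ≤ X := by
    rw [hX]
    have : 1 ≤ (K + 1) ^ 2 := Nat.one_le_pow _ _ (by omega)
    nlinarith
  have h3 : s + 1 ≤ 3 * q := by omega
  have h3' : s' + 1 ≤ 3 * q := by omega
  have m1 : (s + 1) * ((s' + 1) * (X + 30) + 18) ≤ 3 * q * (3 * q * (X + 30) + 18) := by gcongr
  have m2 : (s' + 1) * ((s + 1) * (X + 30) + 18) ≤ 3 * q * (3 * q * (X + 30) + 18) := by gcongr
  have hq2 : q ≤ q ^ 2 := by nlinarith
  have e1 : q ^ 2 * 100 ≤ q ^ 2 * X := Nat.mul_le_mul_left _ hX1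
  have e2 : X ≤ q ^ 2 * X := Nat.le_mul_of_pos_left _ (by positivity)
  have e3 : 3 * q * (3 * q * (X + 30) + 18) = 9 * (q ^ 2 * X) + 270 * q ^ 2 + 54 * q := by ring
  have e4 : (q * (h + h' + 4) + q ^ 2) * X = q * (h + 2) * X + q * (h' + 2) * X + q ^ 2 * X := by
    ring
  rw [e3] at m1 m2
  rw [e4, ← hZ]
  omega

theorem spec_deltaProg {w lam y y' σ} (h : DeltaEnv w lam y y' σ) (hlam : 0 < lam)
    (hlam1 : lam < 1) {Z : ℕ} (hZ : Z = y.length + y'.length) :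
    Spec deltaProg σ (200 * ((Z + 1) ^ 2 * (Nat.log 2 Z + 1) ^ 3) +
      60 * ((⌊3 / lam⌋₊ * (⌊y.length * (lam / 3)⌋₊ + ⌊y'.length * (lam / 3)⌋₊ + 4) +
        ⌊3 / lam⌋₊ ^ 2) * (100 * ((Z + 1) * (Nat.log 2 Z + 1) ^ 2))))
      (fun τ => τ.rvar 176 = empDelta w logCut lam y y') := by
  have hq : 1 ≤ ⌊3 / lam⌋₊ := Nat.le_floor (by
    rw [Nat.cast_one, le_div_iff₀ hlam]; linarith)
  refine Spec.mono ?_ (deltaCost_le hZ hq (length_listEstimator_le w lam y)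
    (length_listEstimator_le w lam y') rfl) fun _ h => h
  set X := 100 * ((Z + 1) * (Nat.log 2 Z + 1) ^ 2) with hX
  rw [← length_segments w logCut, ← length_segments w logCut]
  refine Spec.seqF (spec_loadProg h) 50 5 (by decide) ?_
  rintro τ₁ ⟨c1, c2, l1, l2, z1, z2⟩ g1
  have h1 := h.agree g1 le_rfl
  rw [← hZ] at z1 z2
  refine Spec.seqF (spec_tableProg h1.one h1.zero h1.zeroR h1.weights z1 z2) 60 5 (by decide) ?_
  rintro τ₂ ⟨T2, -⟩ g2
  have h2 := h1.agree (g2.mono (by norm_num) le_rfl) le_rfl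
  generalize hf : τ₁.rarr 5 = f at c1 c2 T2
  have k50 : τ₂.nvar 50 = y.length := (g2.nvar _ (by norm_num)).trans l1
  have k52 : τ₂.nvar 52 = y'.length := (g2.nvar _ (by norm_num)).trans l2
  refine Spec.seqF (R := fun τ => τ.nvar 160 = 0 ∧ τ.nvar 161 = y.length ∧ τ.nvar 162 = 0)
    (Spec.ofLine (by simp) (by simp [k50, h2.zero])) 160 100 (by decide) ?_
  rintro τ₃ ⟨a1, a2, a3⟩ g3
  have T3 := T2.agree g3 (by norm_num) (by norm_num)
  have h3 := h2.agree (g3.mono (by norm_num) le_rfl) (by norm_num)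
  refine Spec.seqF (spec_listProg (y := y) ⟨T3, a1, a2, h3.count, h3.lamEq, c1, by omega⟩ hlam a3)
    200 9 (by decide) ?_
  rintro τ₄ ⟨b1, b2, -⟩ g4
  have T4 := T3.agree g4 (by norm_num) (by norm_num)
  have h4 := h3.agree (g4.mono (by norm_num) le_rfl) (by norm_num)
  refine Spec.seqF (R := fun τ => τ.nvar 160 = y.length ∧ τ.nvar 161 = y'.length ∧
      τ.nvar 162 = (segments w logCut lam y).length + 1 ∧
      τ.nvar 165 = (segments w logCut lam y).length)
    (Spec.ofLine (by simp) ?_) 160 100 (by decide) ?_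
  · have g := (g3.mono (B' := 160) (A' := 9) le_rfl (by norm_num)).trans (g4.mono (by norm_num) le_rfl)
    have k50' : τ₄.nvar 50 = y.length := (g.nvar _ (by norm_num)).trans k50
    have k52' : τ₄.nvar 52 = y'.length := (g.nvar _ (by norm_num)).trans k52
    simp [k50', k52', h4.zero, h4.one, b2, length_segments]
  rintro τ₅ ⟨d1, d2, d3, d4⟩ g5
  have T5 := T4.agree g5 (by norm_num) (by norm_num)
  have h5 := h4.agree (g5.mono (by norm_num) le_rfl) (by norm_num)
  refine Spec.seqF (spec_listProg (y := y') ⟨T5, d1, d2, h5.count, h5.lamEq, c2, by omega⟩ hlam d3)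
    200 9 (by decide) ?_
  rintro τ₆ ⟨e1, e2, e3⟩ g6
  have T6 := T5.agree g6 (by norm_num) (by norm_num)
  have h6 := h5.agree (g6.mono (by norm_num) le_rfl) (by norm_num)
  have B1 : HoldsBounds (boundaries w logCut lam y) 0 0 τ₆ := by
    intro k x hk
    have hlt : k < (boundaries w logCut lam y).length := (List.getElem?_eq_some_iff.1 hk).1
    rw [length_boundaries] at hlt
    rw [zero_add, e3 k hlt, g5.narr 9 (by norm_num), ← b1 k x hk, zero_add]
  have G : Agree 160 9 τ₂ τ₆ := ((g3.mono (by norm_num) (by norm_num)).trans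
    (g4.mono (by norm_num) le_rfl)).trans ((g5.mono (by norm_num) (by norm_num)).trans
    (g6.mono (by norm_num) le_rfl))
  have k50' : τ₆.nvar 50 = y.length := (G.nvar _ (by norm_num)).trans k50
  have k52' : τ₆.nvar 52 = y'.length := (G.nvar _ (by norm_num)).trans k52
  have k162 : τ₆.nvar 162 = (segments w logCut lam y).length + 1 :=
    (g6.nvar _ (by norm_num)).trans d3
  have k165 : τ₆.nvar 165 = (segments w logCut lam y).length := (g6.nvar _ (by norm_num)).trans d4
  refine Spec.seqF (R := fun τ => τ.nvar 164 = 0 ∧ τ.nvar 166 = (segments w logCut lam y).length + 1 ∧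
      τ.nvar 165 = (segments w logCut lam y).length ∧
      τ.nvar 167 = (segments w logCut lam y').length ∧ τ.rvar 170 = lam * y.length ∧
      τ.rvar 171 = lam * y'.length)
    (Spec.ofLine (by simp) ?_) 164 100 (by decide) ?_
  · simp [k50', k52', k162, k165, e2, length_segments, h6.lamEq, h6.zero]
  rintro τ₇ ⟨i1, i2, i3, i4, i5, i6⟩ g7
  have h7 := h6.agree (g7.mono (by norm_num) le_rfl) (by norm_num)
  refine Spec.seqF (T := 2) (R := fun τ => τ.rvar 170 = min (lam * y.length) (lam * y'.length))
    (Spec.ifReal (T := 1) (fun h' => Spec.ofLine (by simp) ?_) fun h' => Spec.skip ?_)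
    170 100 (by decide) ?_
  · rw [i5, i6] at h'
    simp [i6, h7.zeroR, min_eq_right h'.le]
  · rw [i5, i6] at h'
    rw [i5, min_eq_left (not_lt.1 h')]
  intro τ₈ j1 g8
  have G8 : Agree 164 100 τ₆ τ₈ := g7.trans (g8.mono (by norm_num) le_rfl)
  have T8 := T6.agree G8 (by norm_num) (by norm_num)
  refine Spec.seqF (spec_floorLoop (by norm_num) (by norm_num) T8.size) 180 100 (by decide) ?_
  intro τ₉ m1 g9
  set n := ⌊min (lam * y.length) (lam * y'.length)⌋₊ with hn
  have hnZ : n ≤ Z := by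
    have e : lam * (y.length : ℝ) ≤ y.length := mul_le_of_le_one_left (by positivity) hlam1.le
    have : n ≤ y.length := Nat.floor_le_of_le ((min_le_left _ _).trans e)
    omega
  rw [j1, min_eq_right hnZ] at m1
  have G9 := G8.trans (g9.mono (by norm_num) le_rfl)
  have T9 := T6.agree G9 (by norm_num) (by norm_num)
  refine Spec.seqF (R := fun τ => τ.nvar 168 = n) (Spec.ofLine (by simp) (by simp [m1, T9.zero]))
    168 100 (by decide) ?_
  intro τ₁₀ m2 g10
  have G10 := G9.trans (g10.mono (by norm_num) le_rfl)
  have T10 := T6.agree G10 (by norm_num) (by norm_num)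
  have H10 := (g8.mono (B' := 168) (by norm_num) le_rfl).trans
    ((g9.mono (by norm_num) le_rfl).trans g10)
  have q164 := (H10.nvar 164 (by norm_num)).trans i1
  have q166 := (H10.nvar 166 (by norm_num)).trans i2
  have q165 := (H10.nvar 165 (by norm_num)).trans i3
  have q167 := (H10.nvar 167 (by norm_num)).trans i4
  have n10 := G10.narr 9 (by norm_num)
  have B10 : HoldsBounds (boundaries w logCut lam y) 0 0 τ₁₀ := fun k x hk => by rw [n10]; exact B1 k x hk
  have B10' : HoldsBounds (boundaries w logCut lam y') y.length ((segments w logCut lam y).length + 1)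
    τ₁₀ := fun k x hk => by rw [n10]; exact e1 k x hk
  refine Spec.seqF (spec_maxMinProg T10 hlam c1 c2 (by omega) hZ.ge q164 q165 q166 q167 m2 B10 B10')
    200 100 (by decide) ?_
  intro τ₁₁ p1 g11
  have T11 := T10.agree g11 (by norm_num) (by norm_num)
  refine Spec.seqF (R := fun τ => τ.rvar 175 = τ₁₁.rvar 202 ∧
      τ.nvar 166 = 0 ∧ τ.nvar 164 = (segments w logCut lam y).length + 1 ∧
      τ.nvar 167 = (segments w logCut lam y).length ∧
      τ.nvar 165 = (segments w logCut lam y').length ∧ τ.nvar 168 = n)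
    (Spec.ofLine (by simp) ?_) 164 100 (by decide) ?_
  · have r164 := (g11.nvar 164 (by norm_num)).trans q164
    have r166 := (g11.nvar 166 (by norm_num)).trans q166
    have r165 := (g11.nvar 165 (by norm_num)).trans q165
    have r167 := (g11.nvar 167 (by norm_num)).trans q167
    have r168 := (g11.nvar 168 (by norm_num)).trans m2
    simp [r164, r165, r166, r167, r168, T11.zero, T11.zeroR]
  rintro τ₁₂ ⟨p2, s1, s2, s3, s4, s5⟩ g12
  have G12 := (g11.mono (B' := 164) (by norm_num) le_rfl).trans g12
  have T12 := T10.agree G12 (by norm_num) (by norm_num)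
  have n12 := G12.narr 9 (by norm_num)
  refine Spec.seqF (spec_maxMinProg T12 hlam c2 c1 hZ.ge (by omega) s2 s4 s1 s3 s5
    (fun k x hk => by rw [n12]; exact B10' k x hk) (fun k x hk => by rw [n12]; exact B10 k x hk))
    200 100 (by decide) ?_
  intro τ₁₃ p3 g13
  have r175 := (g13.rvar 175 (by norm_num)).trans p2
  refine Spec.ofLine (by simp) ?_
  simp [r175, p3, p1, empDelta, hn, add_comm]

end

/-! ### Farthest-point initialisation -/

section centres
variable {N : ℕ} [NeZero N] (δ : Fin N → Fin N → ℝ)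

/-- The `ℓ`-th cluster centre. -/
def centre (ℓ : ℕ) : Fin N := (centres δ (ℓ + 1)).getD ℓ 0

/-- The distance of `i` to the first `ℓ` centres, and `0` if there is none. -/
def minDist (ℓ : ℕ) (i : Fin N) : ℝ :=
  ⨅ j : Fin (centres δ ℓ).length, δ i ((centres δ ℓ).get j)

theorem length_centres (ℓ : ℕ) : (centres δ ℓ).length = ℓ := by
  induction ℓ with
  | zero => rfl
  | succ ℓ ih =>
    cases ℓ with
    | zero => rfl
    | succ ℓ => rw [centres, List.length_append, List.length_singleton, ih]

theorem centres_succ (ℓ : ℕ) : centres δ (ℓ + 1) = centres δ ℓ ++ [centre δ ℓ] := by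
  cases ℓ with
  | zero => rfl
  | succ ℓ =>
    unfold centre
    rw [centres]
    simp [length_centres]

theorem centres_eq_map (ℓ : ℕ) : centres δ ℓ = (List.range ℓ).map (centre δ) := by
  induction ℓ with
  | zero => rfl
  | succ ℓ ih => rw [centres_succ, ih, List.range_succ, List.map_append]; rfl

theorem getD_centres {m ℓ : ℕ} (h : ℓ < m) : (centres δ m).getD ℓ 0 = centre δ ℓ := by
  simp [centres_eq_map, h]

theorem minDist_eq (ℓ : ℕ) (i : Fin N) : minDist δ ℓ i = ⨅ j : Fin ℓ, δ i (centre δ j) := by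
  unfold minDist
  refine Equiv.iInf_congr (finCongr (length_centres δ ℓ)) fun j => ?_
  simp [centres_eq_map]

theorem argmax_const_finRange : (List.finRange N).argmax (fun _ => (0 : ℝ)) = some 0 := by
  obtain ⟨n, rfl⟩ := Nat.exists_eq_succ_of_ne_zero (NeZero.ne N)
  rw [List.finRange_succ, List.argmax_cons]
  cases (List.map Fin.succ (List.finRange n)).argmax (fun _ => (0 : ℝ)) <;> simp

/-- The rule for the choice of the next centre also covers the first centre, since all distances
to the empty set of centres are `0`. -/
theorem argmax_minDist (ℓ : ℕ) : (List.finRange N).argmax (minDist δ ℓ) = some (centre δ ℓ) := by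
  cases ℓ with
  | zero =>
    have h0 : minDist δ 0 = fun _ => 0 := funext fun i => by
      rw [minDist_eq]; exact Real.iInf_of_isEmpty _
    rw [h0, argmax_const_finRange]
    rfl
  | succ ℓ =>
    cases h : (List.finRange N).argmax (minDist δ (ℓ + 1)) with
    | none =>
      rw [List.argmax_eq_none, List.finRange_eq_nil_iff] at h
      exact absurd h (NeZero.ne N)
    | some c =>
      unfold centre
      rw [centres]
      have h' := h
      unfold minDist at h'
      simp [length_centres] at h' ⊢
      rw [h']
      rfl

theorem label_eq (m : ℕ) (i : Fin N) :
    label δ m i = ((List.range m).argmin fun ℓ => δ i (centre δ ℓ)).getD 0 := by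
  unfold label
  congr 1
  refine argmax_congr (γ := ℝᵒᵈ) fun ℓ hℓ => ?_
  rw [getD_centres δ (List.mem_range.1 hℓ)]

theorem argmin_eq_label {m : ℕ} (hm : m ≠ 0) (i : Fin N) :
    ((List.range m).argmin fun ℓ => δ i (centre δ ℓ)) = some (label δ m i) := by
  rw [label_eq]
  cases h : (List.range m).argmin fun ℓ => δ i (centre δ ℓ) with
  | none => rw [List.argmin_eq_none, List.range_eq_nil] at h; exact absurd h hm
  | some c => rfl

theorem minDist_eq_label {m : ℕ} (hm : m ≠ 0) (i : Fin N) :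
    minDist δ m i = δ i (centre δ (label δ m i)) := by
  have h := argmin_eq_label δ hm i
  rw [minDist_eq]
  refine iInf_fin_eq_of_argmax (g := fun j => δ i (centre δ j)) ?_
  exact List.argmax_eq_some_iff.2 ⟨(List.argmin_eq_some_iff.1 h).1,
    fun a ha => neg_le_neg ((List.argmin_eq_some_iff.1 h).2.1 a ha),
    fun a ha hle => (List.argmin_eq_some_iff.1 h).2.2 a ha (neg_le_neg_iff.1 hle)⟩

theorem label_zero (i : Fin N) : label δ 0 i = 0 := rfl

theorem label_one (i : Fin N) : label δ 1 i = 0 := rfl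

/-- The effect of one more centre on the labels; ties are resolved in favour of the earlier centre. -/
theorem label_succ {m : ℕ} (hm : m ≠ 0) (i : Fin N) :
    label δ (m + 1) i = if δ i (centre δ m) < minDist δ m i then m else label δ m i := by
  rw [label_eq, List.range_succ, List.argmin_concat, argmin_eq_label δ hm, minDist_eq_label δ hm]
  simp only
  split_ifs <;> rfl

theorem minDist_zero (i : Fin N) : minDist δ 0 i = 0 := by
  rw [minDist_eq]; exact Real.iInf_of_isEmpty _

theorem minDist_one (i : Fin N) : minDist δ 1 i = δ i (centre δ 0) := by
  rw [minDist_eq_label δ one_ne_zero, label_one]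

theorem minDist_succ {m : ℕ} (hm : m ≠ 0) (i : Fin N) :
    minDist δ (m + 1) i = if δ i (centre δ m) < minDist δ m i then δ i (centre δ m) else
      minDist δ m i := by
  rw [minDist_eq_label δ m.succ_ne_zero, label_succ δ hm]
  split_ifs with h
  · rfl
  · exact (minDist_eq_label δ hm i).symm

end centres

section
open Instr Prog

/-! ### The clustering program -/

/-- Leaves `⌊3 / lam⌋` in the register `2`, by counting up. -/
def countProg : Prog :=
  .seq (line [natConst 3 1, natConst 5 1, natConst 7 3, realOfNat 2 7, realDiv 2 2 0])
  (.whileNat 4 5 (.seq (line [natAdd 6 2 3, realOfNat 3 6])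
    (.ifReal 2 3 (line [natConst 5 0]) (line [natAdd 2 6 4]))))

theorem spec_countProg {lam : ℝ} {σ : State} (hlam : 0 < lam) (h2 : σ.nvar 2 = 0)
    (h4 : σ.nvar 4 = 0) (h0 : σ.rvar 0 = lam) :
    Spec countProg σ (5 * ⌊3 / lam⌋₊ + 11) (fun τ => τ.nvar 2 = ⌊3 / lam⌋₊ ∧ τ.nvar 3 = 1 ∧ τ.nvar 4 = 0) := by
  have key : ∀ r k (τ : State), k + r = ⌊3 / lam⌋₊ → τ.nvar 2 = k → τ.nvar 3 = 1 → τ.nvar 4 = 0 →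
      τ.nvar 5 = 1 → τ.rvar 2 = 3 / lam →
      Spec (.whileNat 4 5 (.seq (line [natAdd 6 2 3, realOfNat 3 6])
        (.ifReal 2 3 (line [natConst 5 0]) (line [natAdd 2 6 4])))) τ (5 * r + 6)
        (fun τ => τ.nvar 2 = ⌊3 / lam⌋₊ ∧ τ.nvar 3 = 1 ∧ τ.nvar 4 = 0) := by
    intro r
    induction r with
    | zero =>
      intro k τ hk q2 q3 q4 q5 q6
      have hlt : 3 / lam < (k : ℝ) + 1 := by
        have := Nat.lt_floor_add_one (3 / lam)
        rw [← hk] at this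
        exact_mod_cast this
      have hb : Runs _ _ _ _ := .seq (runs_line [natAdd 6 2 3, realOfNat 3 6] τ)
        (.ifRealTrue (r := 2) (s := 3) (q := line [natAdd 2 6 4]) (by simp [q2, q3, q6, hlt])
          (runs_line [natConst 5 0] _))
      exact ⟨_, _, .whileStep (by omega) hb (.whileStop (by simp [q4])), by simp,
        by simp [q2, ← hk], by simp [q3], by simp [q4]⟩
    | succ r ih =>
      intro k τ hk q2 q3 q4 q5 q6
      have hle : (k : ℝ) + 1 ≤ 3 / lam := by
        have h1 : k + 1 ≤ ⌊3 / lam⌋₊ := by omega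
        exact_mod_cast (Nat.le_floor_iff (by positivity)).1 h1
      have hb : Runs _ _ _ _ := .seq (runs_line [natAdd 6 2 3, realOfNat 3 6] τ)
        (.ifRealFalse (r := 2) (s := 3) (p := line [natConst 5 0]) (by simp [q2, q3, q6, hle])
          (runs_line [natAdd 2 6 4] _))
      obtain ⟨ρ, t, k1, k2, k3⟩ := ih (k + 1)
        (exec [natAdd 2 6 4] (exec [natAdd 6 2 3, realOfNat 3 6] τ)) (by omega) (by simp [q2, q3, q4]) (by simp [q3])
        (by simp [q4]) (by simp [q5]) (by simp [q6])
      refine ⟨ρ, _, .whileStep (by omega) hb k1, ?_, k3⟩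
      simp only [List.length_cons, List.length_nil]
      omega
  refine (Spec.seq (T := 5) (T' := 5 * ⌊3 / lam⌋₊ + 6) (Spec.ofLine (by simp) rfl) ?_).mono
    (by omega) fun _ h => h
  rintro _ rfl
  exact key _ 0 _ (by omega) (by simp [h2]) (by simp) (by simp [h4]) (by simp) (by simp [h0])

theorem narr_storeN_of_ne {σ : State} {a b i k : ℕ} (h : b ≠ a) :
    (σ.storeN a i k).narr b = σ.narr b :=
  Function.update_of_ne h _ _

/-- Leaves the positions of the samples in the array `2`. -/
def offsetProg : Prog :=
  .seq (line [natConst 12 0])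
    (forLoop 10 0 (line [natStore 2 10 12, natLoad 13 0 10, natAdd 12 12 13]))

theorem spec_offsetProg {N : ℕ} {σ : State} (h0 : σ.nvar 0 = N) :
    Spec offsetProg σ (N * 6 + 3) (fun τ =>
      (∀ i < N, τ.narr 2 i = ∑ j ∈ Finset.range i, σ.narr 0 j) ∧ τ.narr 4 = σ.narr 4 ∧
      τ.rarr 4 = σ.rarr 4) := by
  refine (Spec.seqF (T := 1) (T' := N * (3 + 3) + 2) (R := fun τ => τ.nvar 12 = 0)
    (Spec.ofLine (by simp) (by simp)) 10 100 (by decide) ?_).mono (by omega) fun _ h => h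
  intro τ h12 g
  refine (spec_forLoop (A := 2) (n := N) (T := 3) (fun k τ =>
    (∀ i < k, τ.narr 2 i = ∑ j ∈ Finset.range i, σ.narr 0 j) ∧
    τ.nvar 12 = ∑ j ∈ Finset.range k, σ.narr 0 j ∧ τ.narr 4 = σ.narr 4 ∧ τ.rarr 4 = σ.rarr 4)
    (by decide) (by norm_num)
    ((g.nvar _ (by norm_num)).trans h0) (fun _ _ _ _ h => by simpa using h)
    (by simp [h12, g.narr 4 (by norm_num), g.rarr 4 (by norm_num)])
    ?_).mono le_rfl fun _ h => ⟨h.1.1, h.1.2.2⟩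
  rintro k hk υ g2 ik ⟨i1, i2, i3, i4⟩
  have a0 : υ.narr 0 = σ.narr 0 := (g2.narr _ (by norm_num)).trans (g.narr _ (by norm_num))
  refine Spec.ofLine (by simp) ⟨fun i hi => ?_, ?_, ?_, ?_⟩
  · rcases Nat.lt_succ_iff_lt_or_eq.1 hi with hi | rfl
    · simpa [ik, hi.ne] using i1 i hi
    · simp [ik, i2]
  · simp [ik, i2, a0, Finset.sum_range_succ]
  · simp [narr_storeN_of_ne, i3]
  · simp [i4]

/-- Finds the centres and the labels: in the round `ℓ`, the sample farthest from the previous centres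
becomes a centre and is stored in the array `3`; then the real array `4` of distances to the centres
and the array `4` of labels are updated. -/
def centreProg : Prog :=
  forLoop 20 1 (.seq (argmaxLoop 30 0 33 (line [realLoad 33 4 30]))
    (.seq (line [natStore 3 20 32])
    (forLoop 40 0 (.seq deltaProg (.seq (line [realLoad 42 4 40])
      (.ifNat 4 20
        (.ifReal 176 42 (line [realStore 4 40 176, natStore 4 40 20]) .skip)
        (line [realStore 4 40 176, natStore 4 40 20])))))))

/-- The global data of the clustering program. -/
structure Globals {N : ℕ} (w : ℕ → ℝ) (lam : ℝ) (S : Fin N → List ℝ) (m : ℕ) (σ : State) :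
    Prop where
  num : σ.nvar 0 = N
  clusters : σ.nvar 1 = m
  count : σ.nvar 2 = ⌊3 / lam⌋₊
  one : σ.nvar 3 = 1
  zero : σ.nvar 4 = 0
  zeroR : σ.rvar 1 = 0
  lamEq : σ.rvar 0 = lam
  weights : σ.rarr 1 = w
  len : ∀ i : Fin N, σ.narr 0 i = (S i).length
  data : ∀ i : Fin N, Contains (σ.rarr 0) (σ.narr 2 i) (S i)

theorem Globals.agree {N w lam} {S : Fin N → List ℝ} {m σ τ B A} (h : Globals w lam S m σ)
    (g : Agree B A σ τ) (hB : 5 ≤ B) (hA : 3 ≤ A) : Globals w lam S m τ :=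
  ⟨(g.nvar _ (by omega)).trans h.num, (g.nvar _ (by omega)).trans h.clusters,
    (g.nvar _ (by omega)).trans h.count, (g.nvar _ (by omega)).trans h.one,
    (g.nvar _ (by omega)).trans h.zero, (g.rvar _ (by omega)).trans h.zeroR,
    (g.rvar _ (by omega)).trans h.lamEq, (g.rarr _ (by omega)).trans h.weights,
    fun i => by rw [g.narr _ (by omega)]; exact h.len i,
    fun i => by rw [g.narr _ (by omega), g.rarr _ (by omega)]; exact h.data i⟩

theorem Globals.deltaEnv {N w lam} {S : Fin N → List ℝ} {m σ} (h : Globals w lam S m σ)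
    {i c : Fin N} (hi : σ.nvar 40 = i) (hc : σ.nvar 32 = c) : DeltaEnv w lam (S i) (S c) σ :=
  ⟨h.count, h.one, h.zero, h.zeroR, h.lamEq, h.weights, by rw [hi, h.len], by rw [hc, h.len],
    by rw [hi]; exact h.data i, by rw [hc]; exact h.data c⟩

/-- Here `U` bounds the cost of one call of `deltaProg`. -/
theorem spec_centreProg {N : ℕ} [NeZero N] {w lam m σ} {S : Fin N → List ℝ}
    (h : Globals w lam S m σ) (hlam : 0 < lam) (hlam1 : lam < 1) (hz : ∀ i < N, σ.rarr 4 i = 0)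
    (hz' : ∀ i < N, σ.narr 4 i = 0) {U : ℕ}
    (hU : ∀ i c : Fin N, 200 * (((S i).length + (S c).length + 1) ^ 2 *
      (Nat.log 2 ((S i).length + (S c).length) + 1) ^ 3) +
      60 * ((⌊3 / lam⌋₊ * (⌊(S i).length * (lam / 3)⌋₊ + ⌊(S c).length * (lam / 3)⌋₊ + 4) +
        ⌊3 / lam⌋₊ ^ 2) * (100 * (((S i).length + (S c).length + 1) *
          (Nat.log 2 ((S i).length + (S c).length) + 1) ^ 2))) ≤ U) :
    Spec centreProg σ (m * (N * (U + 30) + 10) + 2) (fun τ =>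
      let δ := fun i j => empDelta w logCut lam (S i) (S j)
      (∀ ℓ < m, τ.narr 3 ℓ = centre δ ℓ) ∧ ∀ i : Fin N, τ.narr 4 i = label δ m i) := by
  set δ : Fin N → Fin N → ℝ := fun i j => empDelta w logCut lam (S i) (S j) with hδ
  refine (spec_forLoop (A := 3) (n := m) (T := N * (1 + 15) + 2 + (1 + (N * ((U + 5) + 3) + 2)))
    (fun ℓ τ => (∀ k < ℓ, τ.narr 3 k = centre δ k) ∧
      ∀ i : Fin N, τ.rarr 4 i = minDist δ ℓ i ∧ τ.narr 4 i = label δ ℓ i)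
    (by decide) (by norm_num) h.clusters (fun _ _ _ _ h => by simpa using h) ?_ ?_).mono ?_
    fun τ hτ => ⟨hτ.1.1, fun i => (hτ.1.2 i).2⟩
  · exact ⟨by simp, fun i => ⟨by simpa [minDist_zero] using hz i i.2,
      by simpa [label_zero] using hz' i i.2⟩⟩
  · rintro ℓ hℓ τ g1 iℓ ⟨i1, i2⟩
    have G1 := h.agree g1 (by norm_num) le_rfl
    set md : ℕ → ℝ := fun i => τ.rarr 4 i with hmd
    refine Spec.seqF (spec_argmaxLoop (A := 100) md (by decide) (by norm_num) G1.num (by norm_num)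
      fun i hi υ g2 ii => Spec.ofLine (by simp) ?_) 30 100 (by decide) fun υ hυ g2 => ?_
    · simp [ii, hmd, g2.rarr 4 (by norm_num)]
    have hc : υ.nvar 32 = centre δ ℓ := by
      have e1 : (List.range N).argmax md = ((List.finRange N).argmax (minDist δ ℓ)).map Fin.val := by
        rw [← List.map_coe_finRange_eq_range, argmax_map]
        congr 1
        exact argmax_congr fun i _ => (i2 i).1
      have := (hυ (NeZero.ne N)).1
      rw [e1, argmax_minDist] at this
      simpa using this.symm
    have G2 := G1.agree g2 (by norm_num) (by norm_num)
    have u20 : υ.nvar 20 = ℓ := (g2.nvar _ (by norm_num)).trans iℓ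
    refine Spec.seqF (R := fun ρ => (∀ k < ℓ + 1, ρ.narr 3 k = centre δ k) ∧
      ∀ i : Fin N, ρ.rarr 4 i = minDist δ ℓ i ∧ ρ.narr 4 i = label δ ℓ i) (T := 1)
      (Spec.ofLine (by simp) ⟨fun k hk => ?_, fun i => ?_⟩) 300 3 (by decide) ?_
    · rcases Nat.lt_succ_iff_lt_or_eq.1 hk with hk | rfl
      · simpa [u20, hk.ne, g2.narr 3 (by norm_num)] using i1 k hk
      · simp [u20, hc]
    · simpa [g2.narr 4 (by norm_num), g2.rarr 4 (by norm_num)] using i2 i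
    rintro ρ ⟨j1, j2⟩ g3
    have G3 := G2.agree g3 (by norm_num) le_rfl
    have r20 : ρ.nvar 20 = ℓ := (g3.nvar _ (by norm_num)).trans u20
    have r32 : ρ.nvar 32 = centre δ ℓ := (g3.nvar _ (by norm_num)).trans hc
    refine (spec_forLoop (A := 4) (n := N) (T := U + 5)
      (fun k τ => (∀ i : Fin N, (i : ℕ) < k → τ.rarr 4 i = minDist δ (ℓ + 1) i ∧
          τ.narr 4 i = label δ (ℓ + 1) i) ∧
        ∀ i : Fin N, k ≤ (i : ℕ) → τ.rarr 4 i = minDist δ ℓ i ∧ τ.narr 4 i = label δ ℓ i)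
      (by decide) (by norm_num) G3.num (fun _ _ _ _ h => by simpa using h)
      ⟨by simp, fun i _ => by simpa using j2 i⟩ ?_).mono le_rfl fun τ' hτ' => ?_
    · rintro k hk τ₁ g4 ik ⟨l1, l2⟩
      have G4 := G3.agree g4 (by norm_num) (by norm_num)
      obtain ⟨i, rfl⟩ : ∃ i : Fin N, (i : ℕ) = k := ⟨⟨k, hk⟩, rfl⟩
      have env := G4.deltaEnv (i := i) ik ((g4.nvar _ (by norm_num)).trans r32)
      refine (Spec.seqF ((spec_deltaProg env hlam hlam1 rfl).mono (hU i _) fun _ h => h) 50 5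
        (by decide) (T' := 1 + (2 + 1 + 1)) fun τ₂ d g5 => ?_).mono (by omega) fun _ h => h
      have d' : τ₂.rvar 176 = δ i (centre δ ℓ) := d
      have t20 : τ₂.nvar 20 = ℓ :=
        ((g5.nvar _ (by norm_num)).trans (g4.nvar _ (by norm_num))).trans r20
      have t40 : τ₂.nvar 40 = i := (g5.nvar _ (by norm_num)).trans ik
      have t4 : τ₂.nvar 4 = 0 := (g5.nvar _ (by norm_num)).trans G4.zero
      have a4 := g5.rarr 4 (by norm_num)
      have b4 := g5.narr 4 (by norm_num)
      obtain ⟨li1, li2⟩ := l2 i le_rfl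
      have old : ∀ j : Fin N, (j : ℕ) < i → (j : ℕ) ≠ i ∧ τ₂.rarr 4 j = minDist δ (ℓ + 1) j ∧
          τ₂.narr 4 j = label δ (ℓ + 1) j := fun j hj => ⟨hj.ne, by rw [a4, b4]; exact l1 j hj⟩
      have new : ∀ j : Fin N, i + 1 ≤ (j : ℕ) → (j : ℕ) ≠ i ∧ τ₂.rarr 4 j = minDist δ ℓ j ∧
          τ₂.narr 4 j = label δ ℓ j :=
        fun j hj => ⟨by omega, by rw [a4, b4]; exact l2 j (by omega)⟩
      have split : ∀ j : Fin N, (j : ℕ) < i + 1 → (j : ℕ) < i ∨ j = i := fun j hj => by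
        rcases Nat.lt_succ_iff_lt_or_eq.1 hj with h | h
        exacts [.inl h, .inr (Fin.ext h)]
      have upd : ∀ τ₃ : State, τ₃ = exec [realLoad 42 4 40] τ₂ →
          minDist δ (ℓ + 1) i = δ i (centre δ ℓ) → label δ (ℓ + 1) i = ℓ →
          Spec (line [realStore 4 40 176, natStore 4 40 20]) τ₃ 2 fun τ =>
            (∀ j : Fin N, (j : ℕ) < i + 1 → τ.rarr 4 j = minDist δ (ℓ + 1) j ∧
              τ.narr 4 j = label δ (ℓ + 1) j) ∧
            ∀ j : Fin N, i + 1 ≤ (j : ℕ) → τ.rarr 4 j = minDist δ ℓ j ∧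
              τ.narr 4 j = label δ ℓ j := by
        rintro _ rfl hm hl
        refine Spec.ofLine (by simp) ⟨fun j hj => ?_, fun j hj => ?_⟩
        · rcases split j hj with hj | rfl
          · simpa [t40, (old j hj).1] using (old j hj).2
          · simp [t40, t20, hm, hl, d']
        · simpa [t40, (new j hj).1] using (new j hj).2
      refine Spec.seq (Spec.ofLine (by simp) rfl) ?_
      rintro _ rfl
      refine Spec.ifNat (fun hlt => ?_) fun hlt => ?_
      · have hℓ0 : ℓ ≠ 0 := by
          simp [t4, t20] at hlt; omega
        have h42 : (exec [realLoad 42 4 40] τ₂).rvar 42 = minDist δ ℓ i := by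
          simp [t40, a4, li1]
        have h176 : (exec [realLoad 42 4 40] τ₂).rvar 176 = δ i (centre δ ℓ) := by
          simp [d']
        refine Spec.ifReal (fun hlt' => ?_) fun hlt' => Spec.skip ⟨fun j hj => ?_, fun j hj => ?_⟩
        · rw [h42, h176] at hlt'
          exact upd _ rfl (by rw [minDist_succ δ hℓ0, if_pos hlt'])
            (by rw [label_succ δ hℓ0, if_pos hlt'])
        · rw [h42, h176] at hlt'
          rcases split j hj with hj | rfl
          · simpa using (old j hj).2
          · rw [minDist_succ δ hℓ0, if_neg hlt', label_succ δ hℓ0, if_neg hlt', ← li1, ← li2]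
            simp [a4, b4]
        · simpa using (new j hj).2
      · have hℓ0 : ℓ = 0 := by
          simp [t4, t20] at hlt; omega
        refine (upd _ rfl ?_ ?_).mono (by norm_num) fun _ h => h
        · rw [hℓ0]; exact minDist_one δ i
        · rw [hℓ0]; exact label_one δ i
    · obtain ⟨⟨k1, -⟩, g4⟩ := hτ'
      exact ⟨fun k hk => by rw [g4.narr 3 (by norm_num)]; exact j1 k hk, fun i => k1 i i.2⟩
  · ring_nf; omega

end

section
open Instr Prog

/-- Writes the table of memberships to the array `1`, from the centres in the array `3` and the
labels in the array `4`. -/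
def outProg : Prog :=
  .seq (line [natConst 32 0])
  (forLoop 20 1 (.seq (line [natLoad 24 3 20])
    (forLoop 30 0 (.seq (line [natLoad 33 4 30, natConst 34 0])
      (.seq (.ifNat 33 20 .skip (.ifNat 20 33 .skip (line [natConst 34 1])))
      (.seq (.ifNat 30 24 .skip (.ifNat 24 30 .skip (line [natConst 34 1])))
      (line [natStore 1 32 34, natAdd 32 32 3])))))))

theorem mem_cluster {N : ℕ} [NeZero N] {δ : Fin N → Fin N → ℝ} {m ℓ : ℕ} (h : ℓ < m) {i : Fin N} :
    i ∈ cluster δ m ℓ ↔ label δ m i = ℓ ∨ i = centre δ ℓ := by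
  rw [cluster, getD_centres δ h]
  simp [or_comm]

theorem spec_outProg {N : ℕ} [NeZero N] {m : ℕ} {σ : State} {δ : Fin N → Fin N → ℝ}
    (h0 : σ.nvar 0 = N) (h1 : σ.nvar 1 = m) (h3 : σ.nvar 3 = 1)
    (hc : ∀ ℓ < m, σ.narr 3 ℓ = centre δ ℓ) (hl : ∀ i : Fin N, σ.narr 4 i = label δ m i) :
    Spec outProg σ (m * (N * 13 + 6) + 3) (fun τ => OutputsClusters τ m (cluster δ m)) := by
  classical
  have hN : 0 < N := Nat.pos_of_ne_zero (NeZero.ne N)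
  set out : ℕ → ℕ := fun p => if (⟨p % N, Nat.mod_lt _ hN⟩ : Fin N) ∈ cluster δ m (p / N) then 1 else 0
    with hout
  have out_eq : ∀ ℓ (i : Fin N), out (ℓ * N + i) = if i ∈ cluster δ m ℓ then 1 else 0 := by
    intro ℓ i
    have e1 : (ℓ * N + i) / N = ℓ := by
      rw [mul_comm, Nat.mul_add_div hN, Nat.div_eq_of_lt i.2, add_zero]
    have e2 : (ℓ * N + i) % N = i := by
      rw [mul_comm, Nat.mul_add_mod, Nat.mod_eq_of_lt i.2]
    simp only [hout, e1, e2]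
  refine (Spec.seqF (T := 1) (T' := m * ((1 + (N * (10 + 3) + 2)) + 3) + 2)
    (R := fun τ => τ.nvar 32 = 0) (Spec.ofLine (by simp) (by simp)) 32 100 (by decide) ?_).mono
    (by ring_nf; omega) fun _ h => h
  intro τ z g1
  refine (spec_forLoop (A := 1) (n := m) (T := 1 + (N * (10 + 3) + 2)) (fun ℓ τ =>
    (∀ p < ℓ * N, τ.narr 1 p = out p) ∧ τ.nvar 32 = ℓ * N ∧ τ.narr 3 = σ.narr 3 ∧
      τ.narr 4 = σ.narr 4) (by decide) (by norm_num) ((g1.nvar _ (by norm_num)).trans h1)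
    (fun _ _ _ _ h => by simpa using h)
    ⟨by simp, by simp [z], g1.narr _ (by norm_num), g1.narr _ (by norm_num)⟩ ?_).mono le_rfl
    fun τ hτ ℓ hℓ i => ?_
  · rintro ℓ hℓ υ g2 iℓ ⟨i1, i2, i3, i4⟩
    refine Spec.seqF (R := fun ρ => ρ.nvar 24 = centre δ ℓ ∧ ρ.nvar 32 = ℓ * N)
      (Spec.ofLine (by simp) (by simp [iℓ, i2, i3, hc ℓ hℓ])) 24 100 (by decide) ?_
    rintro ρ ⟨r24, r36⟩ g3
    have hn0 : ρ.nvar 0 = N := ((g3.nvar _ (by norm_num)).trans (g2.nvar _ (by norm_num))).trans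
      ((g1.nvar _ (by norm_num)).trans h0)
    have hn3 : ρ.nvar 3 = 1 := ((g3.nvar _ (by norm_num)).trans (g2.nvar _ (by norm_num))).trans
      ((g1.nvar _ (by norm_num)).trans h3)
    have hn20 : ρ.nvar 20 = ℓ := (g3.nvar _ (by norm_num)).trans iℓ
    refine (spec_forLoop (A := 1) (n := N) (T := 10) (fun k τ =>
      (∀ p < ℓ * N + k, τ.narr 1 p = out p) ∧ τ.nvar 32 = ℓ * N + k ∧ τ.narr 3 = σ.narr 3 ∧
      τ.narr 4 = σ.narr 4) (by decide) (by norm_num) hn0 (fun _ _ _ _ h => by simpa using h)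
      ⟨by simpa [g3.narr 1 (by norm_num)] using i1, by simpa using r36,
        (g3.narr 3 (by norm_num)).trans i3, (g3.narr 4 (by norm_num)).trans i4⟩ ?_).mono
      le_rfl fun τ hτ => ?_
    · rintro k hk τ g4 ik ⟨j1, j2, j3, j4⟩
      obtain ⟨i, rfl⟩ : ∃ i : Fin N, (i : ℕ) = k := ⟨⟨k, hk⟩, rfl⟩
      have t20 : τ.nvar 20 = ℓ := (g4.nvar _ (by norm_num)).trans hn20
      have t24 : τ.nvar 24 = centre δ ℓ := (g4.nvar _ (by norm_num)).trans r24
      have t3 : τ.nvar 3 = 1 := (g4.nvar _ (by norm_num)).trans hn3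
      refine (Spec.seqF (T := 2) (T' := (1 + 1 + 1) + ((1 + 1 + 1) + 2))
        (R := fun τ => τ.nvar 33 = label δ m i ∧ τ.nvar 34 = 0)
        (Spec.ofLine (by simp) (by simp [ik, j4, hl])) 33 100 (by decide) ?_).mono le_rfl
        fun _ h => h
      rintro τ₁ ⟨k1, k2⟩ g5
      have a20 : τ₁.nvar 20 = ℓ := (g5.nvar _ (by norm_num)).trans t20
      refine Spec.seqF (R := fun τ => τ.nvar 34 = if label δ m i = ℓ then 1 else 0)
        (Spec.ifNat (fun h => Spec.skip ?_) fun h => Spec.ifNat (fun h' => Spec.skip ?_)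
        fun h' => Spec.ofLine (by simp) ?_) 34 100 (by decide) ?_
      · rw [k1, a20] at h; rw [k2, if_neg (by omega)]
      · rw [k1, a20] at h'; rw [k2, if_neg (by omega)]
      · rw [k1, a20] at h h'; rw [if_pos (by omega)]; simp
      intro τ₂ m1 g6
      have G6 := g5.trans (g6.mono (by norm_num) le_rfl)
      have b30 : τ₂.nvar 30 = i := (G6.nvar _ (by norm_num)).trans ik
      have b24 : τ₂.nvar 24 = centre δ ℓ := (G6.nvar _ (by norm_num)).trans t24
      have hmem := mem_cluster (δ := δ) hℓ (i := i)
      have hval : (i = centre δ ℓ) ↔ (i : ℕ) = centre δ ℓ := Fin.ext_iff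
      refine Spec.seqF (R := fun τ => τ.nvar 34 = if i ∈ cluster δ m ℓ then 1 else 0)
        (Spec.ifNat (fun h => Spec.skip ?_) fun h => Spec.ifNat (fun h' => Spec.skip ?_)
        fun h' => Spec.ofLine (by simp) ?_) 34 100 (by decide) ?_
      · rw [b30, b24] at h
        have : i ≠ centre δ ℓ := fun e => by rw [← e] at h; omega
        simp [m1, hmem, this]
      · rw [b30, b24] at h'
        have : i ≠ centre δ ℓ := fun e => by rw [← e] at h'; omega
        simp [m1, hmem, this]
      · rw [b30, b24] at h h'
        have : i = centre δ ℓ := hval.2 (by omega)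
        rw [if_pos (hmem.2 (.inr this))]; simp
      intro τ₃ m2 g7
      have F6 := g6.trans g7
      have G7 := g5.trans (F6.mono (by norm_num) le_rfl)
      have c36 : τ₃.nvar 32 = ℓ * N + i := by
        have := (G7.nvar 32 (by norm_num)).trans j2
        exact this
      refine Spec.ofLine (by simp) ⟨fun p hp => ?_, ?_, ?_, ?_⟩
      · rw [← add_assoc] at hp
        rcases Nat.lt_succ_iff_lt_or_eq.1 hp with hp | rfl
        · simpa [c36, hp.ne, G7.narr 1 (by norm_num)] using j1 p hp
        · simp [c36, m2, out_eq]
      · simp [c36, G7.nvar 3 (by norm_num), t3, add_assoc]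
      · simp [narr_storeN_of_ne, G7.narr 3 (by norm_num), j3]
      · simp [narr_storeN_of_ne, G7.narr 4 (by norm_num), j4]
    · obtain ⟨⟨k1, k2, k3, k4⟩, -⟩ := hτ
      exact ⟨by rw [Nat.succ_mul]; exact k1, by rw [Nat.succ_mul]; exact k2, k3, k4⟩
  · rw [hτ.1.1 (ℓ * N + i), out_eq]
    calc ℓ * N + i < ℓ * N + N := by omega
      _ = (ℓ + 1) * N := by ring
      _ ≤ m * N := Nat.mul_le_mul_right _ hℓ

theorem getD_flatten (L : List (List ℝ)) {i t : ℕ} (hi : i < L.length)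
    (ht : t < (L.getD i []).length) :
    L.flatten.getD (∑ j ∈ Finset.range i, (L.getD j []).length + t) 0 = (L.getD i []).getD t 0 := by
  induction L generalizing i with
  | nil => simp at hi
  | cons a L ih =>
    cases i with
    | zero =>
      simp at ht
      simp [List.getElem?_append, ht]
    | succ i =>
      have := ih (i := i) (by simpa using hi) (by simpa using ht)
      rw [Finset.sum_range_succ']
      simp only [List.getD_cons_succ, List.getD_cons_zero, List.flatten_cons]
      rw [← this, List.getD_append_right _ _ _ _ (by omega)]
      congr 1
      omega

/-- The clustering program. -/
def clusterProg : Prog :=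
  .seq countProg (.seq offsetProg (.seq centreProg outProg))

theorem contains_flatten {N : ℕ} (S : Fin N → List ℝ) (w : ℕ → ℝ) (lam : ℝ) (m : ℕ) (i : Fin N) :
    Contains ((List.ofFn S).flatten.getD · 0)
      (∑ j ∈ Finset.range i, (inputState w lam S m).narr 0 j) (S i) := by
  have hg : ∀ j : ℕ, ((List.ofFn S).getD j []).length = (inputState w lam S m).narr 0 j := by
    intro j
    by_cases h : j < N <;> simp [inputState, h]
  have hi : (List.ofFn S).getD i [] = S i := by simp
  intro t ht
  have := getD_flatten (List.ofFn S) (i := i) (t := t) (by simp) (by rwa [hi])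
  simp only [hg] at this
  rw [hi] at this
  exact this.symm

theorem spec_clusterProg {N : ℕ} [NeZero N] {w : ℕ → ℝ} {lam : ℝ} {m : ℕ} {S : Fin N → List ℝ} (hlam : 0 < lam)
    (hlam1 : lam < 1) {U : ℕ}
    (hU : ∀ i c : Fin N, 200 * (((S i).length + (S c).length + 1) ^ 2 *
      (Nat.log 2 ((S i).length + (S c).length) + 1) ^ 3) +
      60 * ((⌊3 / lam⌋₊ * (⌊(S i).length * (lam / 3)⌋₊ + ⌊(S c).length * (lam / 3)⌋₊ + 4) +
        ⌊3 / lam⌋₊ ^ 2) * (100 * (((S i).length + (S c).length + 1) *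
          (Nat.log 2 ((S i).length + (S c).length) + 1) ^ 2))) ≤ U) :
    Spec clusterProg (inputState w lam S m)
      ((5 * ⌊3 / lam⌋₊ + 11) + ((N * 6 + 3) + ((m * (N * (U + 30) + 10) + 2) +
        (m * (N * 13 + 6) + 3)))) (fun τ => OutputsClusters τ m (algCluster w logCut lam S m)) := by
  have n0 : (inputState w lam S m).nvar 0 = N := by simp [inputState]
  refine Spec.seqF (spec_countProg (lam := lam) hlam (by simp [inputState]) (by simp [inputState])
    (by simp [inputState])) 2 100 (by decide) ?_
  rintro τ₁ ⟨q2, q3, q4⟩ g1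
  refine Spec.seqF (spec_offsetProg ((g1.nvar _ (by norm_num)).trans n0)) 10 2 (by decide) ?_
  rintro τ₂ ⟨o2, o3, o4⟩ g2
  have G2 : Agree 2 2 (inputState w lam S m) τ₂ :=
    (g1.mono le_rfl (by norm_num)).trans (g2.mono (by norm_num) le_rfl)
  have hG : Globals w lam S m τ₂ := by
    constructor
    · exact (G2.nvar _ (by norm_num)).trans n0
    · rw [G2.nvar _ (by norm_num)]; simp [inputState]
    · exact (g2.nvar _ (by norm_num)).trans q2
    · exact (g2.nvar _ (by norm_num)).trans q3
    · exact (g2.nvar _ (by norm_num)).trans q4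
    · rw [G2.rvar _ (by norm_num)]; simp [inputState]
    · rw [G2.rvar _ (by norm_num)]; simp [inputState]
    · rw [G2.rarr _ (by norm_num)]; simp [inputState]
    · intro i
      rw [G2.narr _ (by norm_num)]; simp [inputState]
    · intro i
      rw [G2.rarr _ (by norm_num), o2 i i.2, g1.narr 0 (by norm_num)]
      exact contains_flatten S w lam m i
  refine Spec.seqF (spec_centreProg hG hlam hlam1 ?_ ?_ hU) 20 3 (by decide) ?_
  · intro i _
    rw [o4, g1.rarr 4 (by norm_num)]; simp [inputState]
  · intro i _
    rw [o3, g1.narr 4 (by norm_num)]; simp [inputState]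
  rintro τ₃ ⟨c1, c2⟩ g3
  have G3 := hG.agree g3 (by norm_num) le_rfl
  exact spec_outProg G3.num G3.clusters G3.one c1 c2

end

/-- Pairs of samples have total length at most `2 * n`, which changes the logarithm by a constant factor
only. -/
theorem log_two_mul_add_one_le {n : ℕ} (hn : 2 ≤ n) :
    ((Nat.log 2 (2 * n) + 1 : ℕ) : ℝ) ≤ 5 * Real.log n := by
  have hn0 : n ≠ 0 := by omega
  have h1 : Nat.log 2 (2 * n) = Nat.log 2 n + 1 := by
    rw [mul_comm]; exact Nat.log_mul_base (by norm_num) hn0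
  have h2 : (2 : ℝ) ^ Nat.log 2 n ≤ n := by exact_mod_cast Nat.pow_log_le_self 2 hn0
  have h3 := Real.log_le_log (by positivity) h2
  rw [Real.log_pow] at h3
  have h4 : Real.log 2 ≤ Real.log n := Real.log_le_log (by norm_num) (by exact_mod_cast hn)
  have h5 := Real.log_two_gt_d9
  rw [h1]
  push_cast
  have h6 : (0 : ℝ) ≤ Nat.log 2 n := by positivity
  nlinarith

/-- The number of steps per sample and centre, as a function of the bound `n` on the lengths of the
samples and of `q = ⌊3 / lam⌋`. -/
theorem pairCost_le {n : ℕ} (hn : 2 ≤ n) {lam : ℝ} (hlam : 0 < lam) (hlam1 : lam < 1) :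
    ((200 * ((n + n + 1) ^ 2 * (Nat.log 2 (n + n) + 1) ^ 3) +
      60 * ((⌊3 / lam⌋₊ * (⌊(n : ℝ) * (lam / 3)⌋₊ + ⌊(n : ℝ) * (lam / 3)⌋₊ + 4) + ⌊3 / lam⌋₊ ^ 2) *
        (100 * ((n + n + 1) * (Nat.log 2 (n + n) + 1) ^ 2))) + 100 + 10 * ⌊3 / lam⌋₊ : ℕ) : ℝ) ≤
      10 ^ 8 * ((n : ℝ) ^ 2 * Real.log n ^ 3 + (lam ^ 2)⁻¹ * (n * Real.log n ^ 3)) := by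
  have hK := log_two_mul_add_one_le hn
  have hl : (1 : ℝ) / 2 ≤ Real.log n := by
    have h4 : Real.log 2 ≤ Real.log n := Real.log_le_log (by norm_num) (by exact_mod_cast hn)
    linarith [Real.log_two_gt_d9]
  rw [← two_mul n]
  set K := Nat.log 2 (2 * n) + 1
  set l := Real.log n
  set q := ⌊3 / lam⌋₊ with hq
  set h := ⌊(n : ℝ) * (lam / 3)⌋₊ with hh
  have hx : (lam ^ 2)⁻¹ = lam⁻¹ ^ 2 := (inv_pow lam 2).symm
  rw [hx]
  have hx1 : 1 ≤ lam⁻¹ := (one_le_inv₀ hlam).2 hlam1.le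
  have hqx : (q : ℝ) ≤ 3 * lam⁻¹ := Nat.floor_le (by positivity)
  have hhn : (h : ℝ) ≤ n * (lam / 3) := Nat.floor_le (by positivity)
  -- the blocks of one grid are disjoint, so together they have at most `n` positions
  have hqh : (q : ℝ) * h ≤ n := by
    calc (q : ℝ) * h ≤ (3 * lam⁻¹) * (n * (lam / 3)) := by gcongr
      _ = n := by field_simp
  set x := lam⁻¹
  have hnR : (2 : ℝ) ≤ n := by exact_mod_cast hn
  have e1 : (q : ℝ) * (h + h + 4) + q ^ 2 ≤ 2 * n + 21 * x ^ 2 := by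
    have : (q : ℝ) ^ 2 ≤ (3 * x) ^ 2 := by gcongr
    nlinarith
  have e2 : (2 * n + 1 : ℝ) ≤ 3 * n := by linarith
  have hl2 : l ^ 2 ≤ 2 * l ^ 3 := by nlinarith [sq_nonneg l]
  have hl3 : (1 : ℝ) ≤ 8 * l ^ 3 := by
    have : (1 / 2 : ℝ) ^ 3 ≤ l ^ 3 := by gcongr
    linarith
  have hl0 : 0 ≤ l := by linarith
  push_cast
  have f1 : (200 * ((2 * n + 1) ^ 2 * K ^ 3) : ℝ) ≤ 200 * ((3 * n) ^ 2 * (5 * l) ^ 3) := by gcongr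
  have f2 : (60 * ((q * (h + h + 4) + q ^ 2) * (100 * ((2 * n + 1) * K ^ 2))) : ℝ) ≤
      60 * ((2 * n + 21 * x ^ 2) * (100 * ((3 * n) * (5 * l) ^ 2))) := by gcongr
  have f3 : (60 * ((2 * n + 21 * x ^ 2) * (100 * ((3 * n) * (5 * l) ^ 2))) : ℝ) ≤
      60 * ((2 * n + 21 * x ^ 2) * (100 * ((3 * n) * (25 * (2 * l ^ 3))))) := by
    rw [mul_pow]; norm_num; gcongr
  have f4 : (100 + 10 * q : ℝ) ≤ 130 * x ^ 2 := by nlinarith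
  have f5 : (130 * x ^ 2 : ℝ) ≤ 130 * x ^ 2 * (n * (8 * l ^ 3)) :=
    le_mul_of_one_le_right (by positivity) (by nlinarith)
  have g1 : (0 : ℝ) ≤ n ^ 2 * l ^ 3 := by positivity
  have g2 : (0 : ℝ) ≤ x ^ 2 * (n * l ^ 3) := by positivity
  linarith

/-- The program computes the clusters within the required time. -/
theorem exists_clusterProg : ∃ (p : Prog) (c : ℝ) (d : ℕ),
      ∀ (w : ℕ → ℝ), (∀ j, 1 ≤ j → 0 < w j) → Summable w →
      ∀ lam : ℝ, 0 < lam → lam < 1 →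
      ∀ (N : ℕ) [NeZero N] (m : ℕ), 1 ≤ m →
      ∀ (n : ℕ), 2 ≤ n →
      ∀ (S : Fin N → List ℝ), (∀ i, (S i).length ≤ n) →
        ∃ (σ : State) (t : ℕ), Runs p (inputState w lam S m) σ t ∧
          OutputsClusters σ m (algCluster w (fun k => (Nat.log 2 k : ℕ∞)) lam S m) ∧
          (t : ℝ) ≤ c * (m * N * ((n : ℝ) ^ 2 * Real.log n ^ d +
            (lam ^ 2)⁻¹ * (n * Real.log n ^ d))) := by
  -- the cube of the logarithm comes from the table: window lengths, levels, comparison of windows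
  refine ⟨clusterProg, 10 ^ 8, 3, fun w _ _ lam hlam hlam1 N _ m hm n hn S hS => ?_⟩
  set U := 200 * ((n + n + 1) ^ 2 * (Nat.log 2 (n + n) + 1) ^ 3) +
      60 * ((⌊3 / lam⌋₊ * (⌊(n : ℝ) * (lam / 3)⌋₊ + ⌊(n : ℝ) * (lam / 3)⌋₊ + 4) + ⌊3 / lam⌋₊ ^ 2) *
        (100 * ((n + n + 1) * (Nat.log 2 (n + n) + 1) ^ 2))) with hU
  obtain ⟨σ, t, h1, h2, h3⟩ := spec_clusterProg (w := w) (m := m) (S := S) (U := U) hlam hlam1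
    fun i c => by
      have hi := hS i
      have hc := hS c
      have hL : Nat.log 2 ((S i).length + (S c).length) ≤ Nat.log 2 (n + n) :=
        Nat.log_mono_right (by omega)
      rw [hU]
      gcongr
  refine ⟨σ, t, h1, h3, ?_⟩
  have hN : 1 ≤ N := Nat.one_le_iff_ne_zero.2 (NeZero.ne N)
  have hmN : 1 ≤ m * N := Nat.mul_pos hm hN
  have ht : t ≤ m * N * (U + 100 + 10 * ⌊3 / lam⌋₊) := by
    refine h2.trans ?_
    have a1 : m ≤ m * N := Nat.le_mul_of_pos_right _ hN
    have a2 : N ≤ m * N := Nat.le_mul_of_pos_left _ hm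
    have a3 : ⌊3 / lam⌋₊ ≤ m * N * ⌊3 / lam⌋₊ := Nat.le_mul_of_pos_left _ hmN
    have e : m * N * (U + 100 + 10 * ⌊3 / lam⌋₊) =
        m * N * U + 100 * (m * N) + 10 * (m * N * ⌊3 / lam⌋₊) := by ring
    have e' : m * (N * (U + 30) + 10) = m * N * U + 30 * (m * N) + 10 * m := by ring
    have e'' : m * (N * 13 + 6) = 13 * (m * N) + 6 * m := by ring
    rw [e, e', e'']
    omega
  calc (t : ℝ) ≤ ((m * N * (U + 100 + 10 * ⌊3 / lam⌋₊) : ℕ) : ℝ) := by exact_mod_cast ht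
    _ = m * N * ((U + 100 + 10 * ⌊3 / lam⌋₊ : ℕ) : ℝ) := by push_cast; ring
    _ ≤ m * N * (10 ^ 8 * ((n : ℝ) ^ 2 * Real.log n ^ 3 + (lam ^ 2)⁻¹ * (n * Real.log n ^ 3))) := by
      gcongr
      exact pairCost_le hn hlam hlam1
    _ = _ := by ring

/-! ### Convergence of the empirical distance -/

/-- A family of weights on the dyadic cubes of side `2 ^ (-(v + 1))` in `ℝ ^ (u + 1)`. -/
abbrev CubeFamily : Type := (u : ℕ) → ℕ → (Fin (u + 1) → ℤ) → ℝ

/-- The weights form a probability distribution for each dimension and each side length. -/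
structure IsProbFamily (p : CubeFamily) : Prop where
  nonneg : ∀ u v k, 0 ≤ p u v k
  hasSum : ∀ u v, HasSum (p u v) 1

/-- The distributional distance of two families of weights. -/
def familyDist (w : ℕ → ℝ) (p q : CubeFamily) : ℝ :=
  ∑' u : ℕ, ∑' v : ℕ, w (u + 1) * w (v + 1) * ∑' k, |p u v k - q u v k|

/-- The empirical frequencies of the dyadic cubes in the first `n` terms of `x`. -/
def empFamily (n : ℕ) (x : ℕ → ℝ) : CubeFamily := fun _ v k => empFreq n x (dyadicCube (v + 1) k)

/-- The lengths of the sequences `Y n` tend to infinity along `l`, and their empirical frequencies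
converge to the family `p`. -/
structure EmpTendsto {ι : Type*} (l : Filter ι) (Y : ι → List ℝ) (p : CubeFamily) : Prop where
  length : Tendsto (fun n => (Y n).length) l atTop
  freq : ∀ u v k, Tendsto (fun n => empFamily (Y n).length (fun t => (Y n).getD t 0) u v k) l
    (𝓝 (p u v k))

theorem empFreq_nonneg (n : ℕ) (x : ℕ → ℝ) {u : ℕ} (B : Set (Fin u → ℝ)) : 0 ≤ empFreq n x B := by
  unfold empFreq
  split_ifs
  · exact div_nonneg (Finset.sum_nonneg fun i _ => Set.indicator_nonneg (fun _ _ => zero_le_one) _)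
      (Nat.cast_nonneg _)
  · exact le_rfl

open Classical in
theorem hasSum_empFamily {n u : ℕ} (x : ℕ → ℝ) (v : ℕ) (h : u + 1 ≤ n) :
    HasSum (empFamily n x u v) 1 := by
  have h1 : ∀ i, HasSum (fun k : Fin (u + 1) → ℤ =>
      (dyadicCube (v + 1) k).indicator (fun _ => (1 : ℝ)) (window x i (u + 1))) 1 := by
    intro i
    convert hasSum_ite_eq (cubeIndex x (u + 1) (v + 1) i) (1 : ℝ) using 2 with k
    rw [Set.indicator_apply]
    simp only [window_mem_dyadicCube_iff, eq_comm]
  have h2 := (hasSum_sum (s := Finset.range (n - (u + 1) + 1)) fun i _ => h1 i).div_const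
    ((n - (u + 1) + 1 : ℕ) : ℝ)
  have e1 : (∑ _i ∈ Finset.range (n - (u + 1) + 1), (1 : ℝ)) / ((n - (u + 1) + 1 : ℕ) : ℝ) = 1 := by
    rw [Finset.sum_const, Finset.card_range, nsmul_eq_mul, mul_one, div_self]
    exact Nat.cast_ne_zero.2 (Nat.succ_ne_zero _)
  have e2 : empFamily n x u v = fun k => (∑ i ∈ Finset.range (n - (u + 1) + 1),
      (dyadicCube (v + 1) k).indicator (fun _ => (1 : ℝ)) (window x i (u + 1))) /
        ((n - (u + 1) + 1 : ℕ) : ℝ) := by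
    funext k
    simp only [empFamily, empFreq, if_pos h]
  rw [e1] at h2
  rw [e2]
  exact h2

theorem empFamily_eq_zero {n u : ℕ} (x : ℕ → ℝ) (v : ℕ) (h : ¬ u + 1 ≤ n) :
    empFamily n x u v = fun _ => 0 := by
  funext k; simp only [empFamily, empFreq, if_neg h]

theorem summable_empFamily (n u v : ℕ) (x : ℕ → ℝ) : Summable (empFamily n x u v) := by
  by_cases h : u + 1 ≤ n
  · exact (hasSum_empFamily x v h).summable
  · rw [empFamily_eq_zero x v h]; exact summable_zero

theorem tsum_empFamily_le (n u v : ℕ) (x : ℕ → ℝ) : ∑' k, empFamily n x u v k ≤ 1 := by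
  by_cases h : u + 1 ≤ n
  · exact (hasSum_empFamily x v h).tsum_eq.le
  · rw [empFamily_eq_zero x v h]; simp

theorem tsum_abs_sub_le {K : Type*} {f g : K → ℝ} (hf : Summable f) (hg : Summable g)
    (hf0 : ∀ k, 0 ≤ f k) (hg0 : ∀ k, 0 ≤ g k) :
    Summable (fun k => |f k - g k|) ∧ ∑' k, |f k - g k| ≤ ∑' k, f k + ∑' k, g k := by
  have h : ∀ k, |f k - g k| ≤ f k + g k := fun k => by
    rw [abs_le]; constructor <;> linarith [hf0 k, hg0 k]
  have hs := (hf.add hg).of_nonneg_of_le (fun k => abs_nonneg _) h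
  exact ⟨hs, (hs.tsum_le_tsum h (hf.add hg)).trans (hf.tsum_add hg).le⟩

/-- Scheffé's lemma for discrete distributions. -/
theorem tendsto_tsum_abs_sub {ι K : Type*} {l : Filter ι} {f : ι → K → ℝ} {p : K → ℝ}
    (hf : ∀ᶠ n in l, HasSum (f n) 1) (hf0 : ∀ n k, 0 ≤ f n k) (hp : HasSum p 1)
    (h : ∀ k, Tendsto (fun n => f n k) l (𝓝 (p k))) :
    Tendsto (fun n => ∑' k, |f n k - p k|) l (𝓝 0) := by
  -- the positive part of `p - f n` is dominated by `p`, and `p - f n` has sum zero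
  have key : Tendsto (fun n => ∑' k, max (p k - f n k) 0) l (𝓝 (∑' _ : K, 0)) := by
    refine tendsto_tsum_of_dominated_convergence (bound := fun k => |p k|) hp.summable.abs
      (fun k => ?_) (Eventually.of_forall fun n k => ?_)
    · have := (tendsto_const_nhds (x := p k)).sub (h k)
      simpa using this.max (tendsto_const_nhds (x := (0 : ℝ)))
    · rw [Real.norm_of_nonneg (le_max_right _ _)]
      refine max_le ?_ (abs_nonneg _)
      linarith [hf0 n k, le_abs_self (p k)]
  rw [tsum_zero] at key
  have key2 := key.const_mul 2
  rw [mul_zero] at key2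
  refine key2.congr' ?_
  filter_upwards [hf] with n hn
  have e : ∀ k, |f n k - p k| = 2 * max (p k - f n k) 0 + (f n k - p k) := fun k => by
    rcases le_total (p k) (f n k) with h | h
    · rw [abs_of_nonneg (by linarith), max_eq_right (by linarith)]; ring
    · rw [abs_of_nonpos (by linarith), max_eq_left (by linarith)]; ring
  have hs : Summable fun k => 2 * max (p k - f n k) 0 := by
    refine Summable.mul_left 2 ((hp.summable.abs.add hn.summable).of_nonneg_of_le
      (fun k => le_max_right _ _) fun k => max_le ?_ ?_)
    · linarith [hf0 n k, le_abs_self (p k)]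
    · linarith [hf0 n k, abs_nonneg (p k)]
  rw [tsum_congr e, hs.tsum_add (hn.summable.sub hp.summable),
    hn.summable.tsum_sub hp.summable, hn.tsum_eq, hp.tsum_eq, tsum_mul_left]
  ring

theorem tendsto_tsum_abs_sub_of_tendsto {ι K : Type*} {l : Filter ι} {f g : ι → K → ℝ}
    {p q : K → ℝ} (hf : ∀ n, Summable (f n)) (hg : ∀ n, Summable (g n)) (hp : Summable p)
    (hq : Summable q) (h1 : Tendsto (fun n => ∑' k, |f n k - p k|) l (𝓝 0))
    (h2 : Tendsto (fun n => ∑' k, |g n k - q k|) l (𝓝 0)) :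
    Tendsto (fun n => ∑' k, |f n k - g n k|) l (𝓝 (∑' k, |p k - q k|)) := by
  rw [tendsto_iff_dist_tendsto_zero]
  have h12 := h1.add h2
  rw [add_zero] at h12
  refine squeeze_zero (fun n => dist_nonneg) (fun n => ?_) h12
  have s1 := ((hf n).sub (hg n)).abs
  have s2 := (hp.sub hq).abs
  have s3 := ((hf n).sub hp).abs
  have s4 := ((hg n).sub hq).abs
  rw [Real.dist_eq, ← s1.tsum_sub s2, ← s3.tsum_add s4]
  have hle : ∀ k, |(|f n k - g n k| - |p k - q k|)| ≤ |f n k - p k| + |g n k - q k| := by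
    intro k
    refine (abs_abs_sub_abs_le _ _).trans ?_
    rw [show f n k - g n k - (p k - q k) = (f n k - p k) - (g n k - q k) by ring]
    exact abs_sub _ _
  simp only [← Real.norm_eq_abs] at hle ⊢
  exact tsum_of_norm_bounded (s3.add s4).hasSum hle

theorem tendsto_tsum_abs_sub_empFamily {ι : Type*} {l : Filter ι} {Y Y' : ι → List ℝ}
    {p p' : CubeFamily} (hY : EmpTendsto l Y p) (hY' : EmpTendsto l Y' p') (hp : IsProbFamily p)
    (hp' : IsProbFamily p') (u v : ℕ) :
    Tendsto (fun n => ∑' k, |empFamily (Y n).length (fun t => (Y n).getD t 0) u v k -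
      empFamily (Y' n).length (fun t => (Y' n).getD t 0) u v k|) l
      (𝓝 (∑' k, |p u v k - p' u v k|)) := by
  refine tendsto_tsum_abs_sub_of_tendsto (fun n => summable_empFamily _ _ _ _)
    (fun n => summable_empFamily _ _ _ _) (hp.hasSum u v).summable (hp'.hasSum u v).summable ?_ ?_
  · exact tendsto_tsum_abs_sub ((hY.length.eventually_ge_atTop (u + 1)).mono
      fun n hn => hasSum_empFamily _ v hn) (fun n k => empFreq_nonneg _ _ _)
      (hp.hasSum u v) (hY.freq u v)
  · exact tendsto_tsum_abs_sub ((hY'.length.eventually_ge_atTop (u + 1)).mono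
      fun n hn => hasSum_empFamily _ v hn) (fun n k => empFreq_nonneg _ _ _)
      (hp'.hasSum u v) (hY'.freq u v)

/-- The empirical distance of two sequences with limiting frequencies tends to the distance of the
limits. The cut-off disappears in the limit by dominated convergence. -/
theorem tendsto_empDist {ι : Type*} {l : Filter ι} {w : ℕ → ℝ} (hw : ∀ j, 1 ≤ j → 0 < w j)
    (hws : Summable w) {D : ℕ → ℕ∞} (hD : Tendsto D atTop (𝓝 ⊤)) {Y Y' : ι → List ℝ}
    {p p' : CubeFamily} (hY : EmpTendsto l Y p) (hY' : EmpTendsto l Y' p') (hp : IsProbFamily p)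
    (hp' : IsProbFamily p') :
    Tendsto (fun n => empDist w D (Y n) (Y' n)) l (𝓝 (familyDist w p p')) := by
  have hws1 : Summable fun j => w (j + 1) := (summable_nat_add_iff 1).2 hws
  have hw0 : ∀ j, 0 ≤ w (j + 1) := fun j => (hw _ (by omega)).le
  have hmin : Tendsto (fun n => min (Y n).length (Y' n).length) l atTop :=
    tendsto_atTop.2 fun b => by
      filter_upwards [hY.length.eventually_ge_atTop b, hY'.length.eventually_ge_atTop b] with n h h'
      exact le_min h h'
  have hDl : ∀ c : ℕ, ∀ᶠ n in l, (c : ℕ∞) ≤ D (min (Y n).length (Y' n).length) := fun c =>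
    ((hD.comp hmin).eventually (lt_mem_nhds (ENat.natCast_lt_top c))).mono fun n h => h.le
  have hb : ∀ n u v, ‖if ((u + 1 : ℕ) : ℕ∞) ≤ D (min (Y n).length (Y' n).length) ∧
        ((v + 1 : ℕ) : ℕ∞) ≤ D (min (Y n).length (Y' n).length) then
      w (u + 1) * w (v + 1) * ∑' k : Fin (u + 1) → ℤ,
        |empFreq (Y n).length (fun t => (Y n).getD t 0) (dyadicCube (v + 1) k) -
          empFreq (Y' n).length (fun t => (Y' n).getD t 0) (dyadicCube (v + 1) k)|
    else 0‖ ≤ w (u + 1) * 2 * w (v + 1) := by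
    intro n u v
    have hww := mul_nonneg (hw0 u) (hw0 v)
    split_ifs
    · obtain ⟨-, h2⟩ := tsum_abs_sub_le (summable_empFamily (Y n).length u v
        (fun t => (Y n).getD t 0)) (summable_empFamily (Y' n).length u v
        (fun t => (Y' n).getD t 0)) (fun k => empFreq_nonneg _ _ _) (fun k => empFreq_nonneg _ _ _)
      have h3 := h2.trans (add_le_add (tsum_empFamily_le _ _ _ _) (tsum_empFamily_le _ _ _ _))
      rw [Real.norm_of_nonneg (mul_nonneg hww (tsum_nonneg fun k => abs_nonneg _))]
      calc _ ≤ w (u + 1) * w (v + 1) * (1 + 1) := mul_le_mul_of_nonneg_left h3 hww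
        _ = _ := by ring
    · rw [norm_zero]; nlinarith
  refine tendsto_tsum_of_dominated_convergence (bound := fun u => w (u + 1) * 2 * ∑' v, w (v + 1))
    ((hws1.mul_right _).mul_right _) (fun u => ?_) (Eventually.of_forall fun n u => ?_)
  · refine tendsto_tsum_of_dominated_convergence (bound := fun v => w (u + 1) * 2 * w (v + 1))
      (hws1.mul_left _) (fun v => ?_) (Eventually.of_forall fun n v => hb n u v)
    refine ((tendsto_tsum_abs_sub_empFamily hY hY' hp hp' u v).const_mul
      (w (u + 1) * w (v + 1))).congr' ?_
    filter_upwards [hDl (u + 1), hDl (v + 1)] with n h1 h2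
    rw [if_pos ⟨h1, h2⟩]
    rfl
  · refine (norm_tsum_le_tsum_norm ((hws1.mul_left _).of_nonneg_of_le (fun v => norm_nonneg _)
      fun v => hb n u v)).trans ?_
    rw [← tsum_mul_left]
    exact ((hws1.mul_left _).of_nonneg_of_le (fun v => norm_nonneg _)
      fun v => hb n u v).tsum_le_tsum (fun v => hb n u v) (hws1.mul_left _)

/-- Homogeneity of the distributional distance. -/
theorem familyDist_of_sub_eq (w : ℕ → ℝ) {p q r s : CubeFamily} (c : ℝ)
    (h : ∀ u v k, p u v k - q u v k = c * (r u v k - s u v k)) :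
    familyDist w p q = |c| * familyDist w r s := by
  simp only [familyDist, h, abs_mul, tsum_mul_left, mul_left_comm _ |c|]

theorem familyDist_self (w : ℕ → ℝ) (p : CubeFamily) : familyDist w p p = 0 := by
  simp [familyDist]

/-- The distributional distance separates distributions on the dyadic cubes. -/
theorem familyDist_pos {w : ℕ → ℝ} (hw : ∀ j, 1 ≤ j → 0 < w j) (hws : Summable w)
    {p q : CubeFamily} (hp : IsProbFamily p) (hq : IsProbFamily q) (hne : p ≠ q) :
    0 < familyDist w p q := by
  have hws1 : Summable fun j => w (j + 1) := (summable_nat_add_iff 1).2 hws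
  have hw0 : ∀ j, 0 < w (j + 1) := fun j => hw _ (by omega)
  have hs : ∀ u v, Summable fun k => |p u v k - q u v k| := fun u v =>
    (tsum_abs_sub_le (hp.hasSum u v).summable (hq.hasSum u v).summable (hp.nonneg u v)
      (hq.nonneg u v)).1
  have hle : ∀ u v, ∑' k, |p u v k - q u v k| ≤ 2 := fun u v => by
    have := (tsum_abs_sub_le (hp.hasSum u v).summable (hq.hasSum u v).summable (hp.nonneg u v)
      (hq.nonneg u v)).2
    rw [(hp.hasSum u v).tsum_eq, (hq.hasSum u v).tsum_eq] at this
    linarith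
  have h0 : ∀ u v, 0 ≤ ∑' k, |p u v k - q u v k| := fun u v => tsum_nonneg fun k => abs_nonneg _
  have t0 : ∀ u v, 0 ≤ w (u + 1) * w (v + 1) * ∑' k, |p u v k - q u v k| := fun u v =>
    mul_nonneg (mul_pos (hw0 u) (hw0 v)).le (h0 u v)
  have tb : ∀ u v, w (u + 1) * w (v + 1) * ∑' k, |p u v k - q u v k| ≤
      w (u + 1) * 2 * w (v + 1) := fun u v => by
    calc _ ≤ w (u + 1) * w (v + 1) * 2 :=
        mul_le_mul_of_nonneg_left (hle u v) (mul_pos (hw0 u) (hw0 v)).le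
      _ = _ := by ring
  have ts : ∀ u, Summable fun v => w (u + 1) * w (v + 1) * ∑' k, |p u v k - q u v k| := fun u =>
    (hws1.mul_left _).of_nonneg_of_le (t0 u) (tb u)
  have ts' : Summable fun u => ∑' v, w (u + 1) * w (v + 1) * ∑' k, |p u v k - q u v k| := by
    refine ((hws1.mul_right 2).mul_right (∑' v, w (v + 1))).of_nonneg_of_le
      (fun u => tsum_nonneg (t0 u)) fun u => ?_
    rw [← tsum_mul_left]
    exact (ts u).tsum_le_tsum (tb u) (hws1.mul_left _)
  obtain ⟨u, hu⟩ := Function.ne_iff.1 hne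
  obtain ⟨v, hv⟩ := Function.ne_iff.1 hu
  obtain ⟨k, hk⟩ := Function.ne_iff.1 hv
  refine ts'.tsum_pos (fun u => tsum_nonneg (t0 u)) u ((ts u).tsum_pos (t0 u) v ?_)
  exact mul_pos (mul_pos (hw0 u) (hw0 v))
    ((hs u v).tsum_pos (fun k => abs_nonneg _) k (abs_pos.2 (sub_ne_zero.2 hk)))

/-! ### Laws of processes and weights of dyadic cubes -/

/-- The probabilities of the dyadic cubes under the finite-dimensional laws of a process. -/
def lawFamily (μ : Measure (ℕ → ℝ)) : CubeFamily := fun u v k =>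
  μ.real {x | window x 0 (u + 1) ∈ dyadicCube (v + 1) k}

/-- The index of the dyadic cube of side `2 ^ (-v)` that contains a point. -/
def cubeMap (u v : ℕ) (x : Fin u → ℝ) : Fin u → ℤ := fun j => ⌊x j * 2 ^ v⌋

theorem measurable_cubeMap (u v : ℕ) : Measurable (cubeMap u v) :=
  measurable_pi_lambda _ fun j => Int.measurable_floor.comp ((measurable_pi_apply j).mul_const _)

theorem dyadicCube_eq_preimage {u : ℕ} (v : ℕ) (k : Fin u → ℤ) :
    dyadicCube v k = cubeMap u v ⁻¹' {k} := by
  ext x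
  rw [mem_dyadicCube_iff, Set.mem_preimage, Set.mem_singleton_iff, funext_iff]
  rfl

theorem measurableSet_dyadicCube {u : ℕ} (v : ℕ) (k : Fin u → ℤ) : MeasurableSet (dyadicCube v k) := by
  rw [dyadicCube_eq_preimage]
  exact measurable_cubeMap u v (measurableSet_singleton k)

theorem measurable_window (i u : ℕ) : Measurable fun x : ℕ → ℝ => window x i u :=
  measurable_pi_lambda _ fun _ => measurable_pi_apply _

theorem isProbFamily_lawFamily (μ : Measure (ℕ → ℝ)) [IsProbabilityMeasure μ] :
    IsProbFamily (lawFamily μ) := by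
  refine ⟨fun u v k => measureReal_nonneg, fun u v => ?_⟩
  have hU : (⋃ k, {x : ℕ → ℝ | window x 0 (u + 1) ∈ dyadicCube (v + 1) k}) = Set.univ := by
    refine Set.eq_univ_of_forall fun x => Set.mem_iUnion.2 ⟨cubeMap (u + 1) (v + 1) (window x 0 (u + 1)), ?_⟩
    rw [Set.mem_ofPred_eq, dyadicCube_eq_preimage]
    rfl
  have h := measure_iUnion (μ := μ)
    (f := fun k => {x : ℕ → ℝ | window x 0 (u + 1) ∈ dyadicCube (v + 1) k}) (fun k k' hkk => by
      rw [Function.onFun, Set.disjoint_left]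
      intro x hx hx'
      rw [Set.mem_ofPred_eq, dyadicCube_eq_preimage] at hx hx'
      exact hkk (hx.symm.trans hx'))
    fun k => measurable_window 0 (u + 1) (measurableSet_dyadicCube _ k)
  rw [hU, measure_univ] at h
  have := ENNReal.hasSum_toReal (f := fun k =>
    μ {x : ℕ → ℝ | window x 0 (u + 1) ∈ dyadicCube (v + 1) k}) (by rw [← h]; exact ENNReal.one_ne_top)
  rw [← ENNReal.tsum_toReal_eq (fun k => measure_ne_top _ _), ← h, ENNReal.toReal_one] at this
  exact this

theorem tendsto_floor_mul_div (a : ℝ) :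
    Tendsto (fun v : ℕ => (⌊a * 2 ^ (v + 1)⌋ : ℝ) / 2 ^ (v + 1)) atTop (𝓝 a) := by
  have h0 : Tendsto (fun v : ℕ => a - (1 / 2 : ℝ) ^ (v + 1)) atTop (𝓝 (a - 0)) :=
    tendsto_const_nhds.sub ((tendsto_pow_atTop_nhds_zero_of_lt_one (by norm_num) (by norm_num)).comp
      (tendsto_add_atTop_nat 1))
  rw [sub_zero] at h0
  refine tendsto_of_tendsto_of_tendsto_of_le_of_le h0 tendsto_const_nhds (fun v => ?_) fun v => ?_
  · have h2 : (0 : ℝ) < 2 ^ (v + 1) := by positivity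
    simp only
    rw [le_div_iff₀ h2, sub_mul, one_div, inv_pow, inv_mul_cancel₀ h2.ne']
    linarith [Int.lt_floor_add_one (a * 2 ^ (v + 1))]
  · have h2 : (0 : ℝ) < 2 ^ (v + 1) := by positivity
    simp only
    rw [div_le_iff₀ h2]
    exact Int.floor_le _

/-- A probability measure on `ℝ ^ u` is determined by the dyadic cubes: it is the weak limit of its
discretizations. -/
theorem measure_ext_of_dyadicCube {u : ℕ} {M M' : Measure (Fin u → ℝ)} [IsProbabilityMeasure M]
    [IsProbabilityMeasure M'] (h : ∀ v k, M (dyadicCube (v + 1) k) = M' (dyadicCube (v + 1) k)) :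
    M = M' := by
  have hmap : ∀ v, M.map (cubeMap u (v + 1)) = M'.map (cubeMap u (v + 1)) := by
    intro v
    refine Measure.ext_of_singleton fun k => ?_
    rw [Measure.map_apply (measurable_cubeMap _ _) (measurableSet_singleton k),
      Measure.map_apply (measurable_cubeMap _ _) (measurableSet_singleton k),
      ← dyadicCube_eq_preimage, h]
  refine ext_of_forall_integral_eq_of_IsFiniteMeasure fun f => ?_
  set g : ℕ → (Fin u → ℤ) → ℝ := fun v k => f fun j => (k j : ℝ) / 2 ^ (v + 1) with hg
  have hlim : ∀ (L : Measure (Fin u → ℝ)) [IsProbabilityMeasure L],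
      Tendsto (fun v => ∫ k, g v k ∂(L.map (cubeMap u (v + 1)))) atTop (𝓝 (∫ x, f x ∂L)) := by
    intro L _
    have e : ∀ v, ∫ k, g v k ∂(L.map (cubeMap u (v + 1))) = ∫ x, g v (cubeMap u (v + 1) x) ∂L :=
      fun v => integral_map (measurable_cubeMap _ _).aemeasurable
        (measurable_of_countable _).aestronglyMeasurable
    simp only [e]
    refine tendsto_integral_of_dominated_convergence (fun _ => ‖f‖)
      (fun v => ((measurable_of_countable (g v)).comp (measurable_cubeMap _ _)).aestronglyMeasurable)
      (integrable_const _) (fun v => Eventually.of_forall fun x => f.norm_coe_le_norm _)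
      (Eventually.of_forall fun x => ?_)
    exact (f.continuous.tendsto x).comp (tendsto_pi_nhds.2 fun j => tendsto_floor_mul_div (x j))
  have h1 := hlim M
  simp only [hmap] at h1
  exact tendsto_nhds_unique h1 (hlim M')

/-- A process is determined by its weights of the dyadic cubes. -/
theorem lawFamily_injective {μ ν : Measure (ℕ → ℝ)} [IsProbabilityMeasure μ]
    [IsProbabilityMeasure ν] (h : lawFamily μ = lawFamily ν) : μ = ν := by
  have hw : ∀ u, μ.map (fun x => window x 0 (u + 1)) = ν.map (fun x => window x 0 (u + 1)) := by
    intro u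
    have := Measure.isProbabilityMeasure_map (μ := μ) (measurable_window 0 (u + 1)).aemeasurable
    have := Measure.isProbabilityMeasure_map (μ := ν) (measurable_window 0 (u + 1)).aemeasurable
    refine measure_ext_of_dyadicCube fun v k => ?_
    rw [Measure.map_apply (measurable_window _ _) (measurableSet_dyadicCube _ _),
      Measure.map_apply (measurable_window _ _) (measurableSet_dyadicCube _ _)]
    have := congrFun (congrFun (congrFun h u) v) k
    exact (measureReal_eq_measureReal_iff).1 this
  have hI : ∀ I : Finset ℕ, ν.map I.restrict = μ.map (I.restrict (π := fun _ => ℝ)) := by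
    intro I
    obtain ⟨u, hu⟩ : ∃ u, ∀ i ∈ I, i < u + 1 :=
      ⟨I.sup id, fun i hi => Nat.lt_succ_of_le (Finset.le_sup (f := id) hi)⟩
    have hr : Measurable fun (z : Fin (u + 1) → ℝ) (i : I) => z ⟨i, hu i i.2⟩ :=
      measurable_pi_lambda _ fun i => measurable_pi_apply _
    have e : (I.restrict : (ℕ → ℝ) → I → ℝ) =
        (fun (z : Fin (u + 1) → ℝ) (i : I) => z ⟨i, hu i i.2⟩) ∘ fun x => window x 0 (u + 1) := by
      funext x i
      simp [window]
    rw [e, ← Measure.map_map hr (measurable_window _ _), ← Measure.map_map hr (measurable_window _ _),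
      hw]
  have hP : ∀ I : Finset ℕ, IsFiniteMeasure (μ.map (I.restrict (π := fun _ => ℝ))) := fun I =>
    inferInstance
  have h1 : IsProjectiveLimit (α := fun _ : ℕ => ℝ) μ
      (fun I : Finset ℕ => μ.map (I.restrict (π := fun _ => ℝ))) := fun I => rfl
  have h2 : IsProjectiveLimit (α := fun _ : ℕ => ℝ) ν
      (fun I : Finset ℕ => μ.map (I.restrict (π := fun _ => ℝ))) := hI
  exact h1.unique h2

/-! ### Rates of sequences of positions -/

/-- The sequence of positions `s` grows like `σ n` along `l`. -/
def HasRate (l : Filter ℕ) (s : ℕ → ℕ) (σ : ℝ) : Prop :=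
  Tendsto (fun n => (s n : ℝ) / n) l (𝓝 σ)

section rate
variable {l : Filter ℕ} {s t : ℕ → ℕ} {σ τ : ℝ}

theorem tendsto_inv_natCast (hl : l ≤ atTop) : Tendsto (fun n : ℕ => (n : ℝ)⁻¹) l (𝓝 0) :=
  tendsto_inv_atTop_nhds_zero_nat.mono_left hl

theorem hasRate_const (hl : l ≤ atTop) (c : ℕ) : HasRate l (fun _ => c) 0 :=
  (tendsto_const_div_atTop_nhds_zero_nat (c : ℝ)).mono_left hl

theorem HasRate.add (h : HasRate l s σ) (h' : HasRate l t τ) :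
    HasRate l (fun n => s n + t n) (σ + τ) := by
  refine (Tendsto.add h h').congr fun n => ?_
  push_cast; ring

theorem HasRate.min (h : HasRate l s σ) (h' : HasRate l t τ) :
    HasRate l (fun n => min (s n) (t n)) (min σ τ) := by
  refine (Tendsto.min h h').congr fun n => ?_
  rw [Nat.cast_min, min_div_div_right (Nat.cast_nonneg n)]

theorem HasRate.tsub (h : HasRate l s σ) (h' : HasRate l t τ) :
    HasRate l (fun n => s n - t n) (max (σ - τ) 0) := by
  refine ((Tendsto.sub h h').max tendsto_const_nhds).congr fun n => ?_
  rcases le_total (t n) (s n) with hle | hle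
  · rw [Nat.cast_sub hle, sub_div, max_eq_left]
    rw [← sub_div]
    exact div_nonneg (sub_nonneg.2 (by exact_mod_cast hle)) (Nat.cast_nonneg _)
  · simp only
    rw [Nat.sub_eq_zero_of_le hle, Nat.cast_zero, zero_div, max_eq_right]
    rw [← sub_div]
    exact div_nonpos_of_nonpos_of_nonneg (sub_nonpos.2 (by exact_mod_cast hle)) (Nat.cast_nonneg _)

theorem HasRate.sub_of_le (h : HasRate l s σ) (h' : HasRate l t τ) (hle : τ ≤ σ) :
    HasRate l (fun n => s n - t n) (σ - τ) := by
  have := h.tsub h'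
  rwa [max_eq_left (sub_nonneg.2 hle)] at this

theorem hasRate_floor (hl : l ≤ atTop) {z : ℕ → ℝ} (hz : ∀ n, 0 ≤ z n)
    (h : Tendsto (fun n => z n / n) l (𝓝 σ)) : HasRate l (fun n => ⌊z n⌋₊) σ := by
  have h1 := h.sub (tendsto_inv_natCast hl)
  rw [sub_zero] at h1
  refine tendsto_of_tendsto_of_tendsto_of_le_of_le h1 h (fun n => ?_) fun n => ?_
  · simp only
    rw [← one_div, ← sub_div]
    exact div_le_div_of_nonneg_right (Nat.sub_one_lt_floor _).le (Nat.cast_nonneg n)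
  · exact div_le_div_of_nonneg_right (Nat.floor_le (hz n)) (Nat.cast_nonneg n)

theorem hasRate_floor_mul (hl : l ≤ atTop) {c : ℝ} (hc : 0 ≤ c) :
    HasRate l (fun n => ⌊n * c⌋₊) c := by
  refine hasRate_floor hl (fun n => by positivity) ?_
  refine tendsto_const_nhds.congr' ?_
  filter_upwards [hl (eventually_gt_atTop 0)] with n hn
  have : (n : ℝ) ≠ 0 := by positivity
  field_simp

theorem HasRate.le [l.NeBot] (h : HasRate l s σ) (h' : HasRate l t τ)
    (hle : ∀ᶠ n in l, s n ≤ t n) : σ ≤ τ :=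
  le_of_tendsto_of_tendsto h h' (hle.mono fun n hn =>
    div_le_div_of_nonneg_right (by exact_mod_cast hn) (Nat.cast_nonneg n))

theorem HasRate.eventually_lt (hl : l ≤ atTop) (h : HasRate l s σ) (h' : HasRate l t τ)
    (hlt : σ < τ) : ∀ᶠ n in l, s n < t n := by
  filter_upwards [Tendsto.eventually_lt h h' hlt, hl (eventually_gt_atTop 0)] with n hn h0
  have h0' : (0 : ℝ) < n := by exact_mod_cast h0
  exact_mod_cast (div_lt_div_iff_of_pos_right h0').1 hn

theorem HasRate.tendsto_atTop (hl : l ≤ atTop) (h : HasRate l s σ) (hσ : 0 < σ) :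
    Tendsto s l atTop := by
  have h1 : Tendsto (fun n : ℕ => (n : ℝ)) l atTop := tendsto_natCast_atTop_atTop.mono_left hl
  have h2 := h1.atTop_mul_pos hσ h
  refine tendsto_natCast_atTop_iff.1 (h2.congr' ?_)
  filter_upwards [hl (eventually_gt_atTop 0)] with n h0
  have : (n : ℝ) ≠ 0 := by positivity
  field_simp

/-- Along an ultrafilter every bounded sequence of positions has a rate. -/
theorem exists_hasRate {𝒰 : Ultrafilter ℕ} {s t : ℕ → ℕ} {τ : ℝ} (h : HasRate 𝒰 t τ)
    (hle : ∀ᶠ n in (𝒰 : Filter ℕ), s n ≤ t n) : ∃ σ, HasRate 𝒰 s σ := by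
  have hb : ∀ᶠ n in (𝒰 : Filter ℕ), (s n : ℝ) / n ∈ Set.Icc (0 : ℝ) (τ + 1) := by
    filter_upwards [hle, Tendsto.eventually_lt h tendsto_const_nhds (lt_add_one τ)] with n h1 h2
    exact ⟨by positivity, (div_le_div_of_nonneg_right (by exact_mod_cast h1)
      (Nat.cast_nonneg n)).trans h2.le⟩
  obtain ⟨σ, -, hσ⟩ := isCompact_Icc.ultrafilter_le_nhds (𝒰.map fun n => (s n : ℝ) / n)
    (le_principal_iff.2 hb)
  exact ⟨σ, hσ⟩

end rate

/-! ### Counting windows -/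

/-- The number of windows of length `u` that start before `t` and lie in `B`. -/
def windowCount (x : ℕ → ℝ) {u : ℕ} (B : Set (Fin u → ℝ)) (t : ℕ) : ℝ :=
  ∑ i ∈ Finset.range t, B.indicator (fun _ => (1 : ℝ)) (window x i u)

theorem windowCount_nonneg (x : ℕ → ℝ) {u : ℕ} (B : Set (Fin u → ℝ)) (t : ℕ) :
    0 ≤ windowCount x B t :=
  Finset.sum_nonneg fun _ _ => Set.indicator_nonneg (fun _ _ => zero_le_one) _

theorem windowCount_add (x : ℕ → ℝ) {u : ℕ} (B : Set (Fin u → ℝ)) (s t : ℕ) :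
    windowCount x B (s + t) = windowCount x B s +
      ∑ i ∈ Finset.range t, B.indicator (fun _ => (1 : ℝ)) (window x (s + i) u) :=
  Finset.sum_range_add _ _ _

theorem sum_indicator_mem_Icc (x : ℕ → ℝ) {u : ℕ} (B : Set (Fin u → ℝ)) (s t : ℕ) :
    ∑ i ∈ Finset.range t, B.indicator (fun _ => (1 : ℝ)) (window x (s + i) u) ∈
      Set.Icc (0 : ℝ) t := by
  refine ⟨Finset.sum_nonneg fun _ _ => Set.indicator_nonneg (fun _ _ => zero_le_one) _, ?_⟩
  refine (Finset.sum_le_card_nsmul _ _ 1 fun i _ => ?_).trans (by simp)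
  exact Set.indicator_apply_le' (fun _ => le_rfl) fun _ => zero_le_one

theorem abs_windowCount_sub_le (x : ℕ → ℝ) {u : ℕ} (B : Set (Fin u → ℝ)) (s t : ℕ) :
    |windowCount x B t - windowCount x B s| ≤ |(t : ℝ) - s| := by
  wlog h : s ≤ t generalizing s t
  · rw [abs_sub_comm, abs_sub_comm (t : ℝ)]
    exact this t s (by omega)
  obtain ⟨r, rfl⟩ := Nat.exists_eq_add_of_le h
  have := sum_indicator_mem_Icc x B s r
  rw [windowCount_add, add_sub_cancel_left, abs_of_nonneg this.1]
  push_cast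
  rw [add_sub_cancel_left, abs_of_nonneg (Nat.cast_nonneg r)]
  exact this.2

/-- Sequences of positions with the same rate have the same asymptotic counts. -/
theorem tendsto_windowCount_of_hasRate {l : Filter ℕ} (y : ℕ → ℕ → ℝ) {u : ℕ}
    (B : Set (Fin u → ℝ)) {s t : ℕ → ℕ} {σ c : ℝ} (hs : HasRate l s σ) (ht : HasRate l t σ)
    (h : Tendsto (fun n => windowCount (y n) B (s n) / n) l (𝓝 c)) :
    Tendsto (fun n => windowCount (y n) B (t n) / n) l (𝓝 c) := by
  refine tendsto_of_tendsto_of_dist h ?_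
  have h0 : Tendsto (fun n => dist ((s n : ℝ) / n) ((t n : ℝ) / n)) l (𝓝 0) := by
    have := Tendsto.dist hs ht
    rwa [dist_self] at this
  refine squeeze_zero (fun n => dist_nonneg) (fun n => ?_) h0
  rw [Real.dist_eq, Real.dist_eq, ← sub_div, ← sub_div, abs_div, abs_div]
  exact div_le_div_of_nonneg_right (abs_windowCount_sub_le _ _ _ _) (abs_nonneg _)

/-- The number of windows in the first `r n` positions of a row, where `r` has a rate. -/
theorem tendsto_windowCount_row {l : Filter ℕ} (hl : l ≤ atTop) {x : ℕ → ℝ} {u : ℕ}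
    {B : Set (Fin (u + 1) → ℝ)} {p : ℝ} (h : Tendsto (fun n => empFreq n x B) atTop (𝓝 p))
    {r : ℕ → ℕ} {ρ : ℝ} (hr : HasRate l r ρ) (hρ : 0 ≤ ρ) :
    Tendsto (fun n => windowCount x B (r n) / n) l (𝓝 (ρ * p)) := by
  rcases hρ.eq_or_lt with rfl | hρ
  · rw [zero_mul]
    refine squeeze_zero (fun n => div_nonneg (windowCount_nonneg _ _ _) (Nat.cast_nonneg n))
      (fun n => div_le_div_of_nonneg_right ?_ (Nat.cast_nonneg n)) hr
    have := abs_windowCount_sub_le x B 0 (r n)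
    simpa [windowCount, abs_of_nonneg (windowCount_nonneg x B (r n))] using
      (le_abs_self _).trans this
  · have hr' := hr.tendsto_atTop hl hρ
    have h1 : Tendsto (fun n => empFreq (r n + u) x B) l (𝓝 p) :=
      h.comp (tendsto_atTop_mono (fun n => Nat.le_add_right _ _) hr')
    refine (Tendsto.mul hr h1).congr' ?_
    filter_upwards [hr'.eventually_gt_atTop 0] with n hn
    have e : r n + u - (u + 1) + 1 = r n := by omega
    have hn' : (r n : ℝ) ≠ 0 := by positivity
    rw [empFreq, if_pos (by omega), e, windowCount]
    field_simp

/-! ### Samples of piecewise stationary processes -/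

section sample
variable {κ : ℕ} {θ : Fin (κ + 2) → ℝ} {x : Fin (κ + 1) → ℕ → ℝ}

/-- The `j`-th segment of a sample. -/
def pwSegment (θ : Fin (κ + 2) → ℝ) (x : Fin (κ + 1) → ℕ → ℝ) (n : ℕ) (j : Fin (κ + 1)) : List ℝ :=
  List.ofFn fun t : Fin (⌊n * θ j.succ⌋₊ - ⌊n * θ j.castSucc⌋₊) => x j t

theorem length_pwSegment (n : ℕ) (j : Fin (κ + 1)) :
    (pwSegment θ x n j).length = ⌊n * θ j.succ⌋₊ - ⌊n * θ j.castSucc⌋₊ := by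
  simp [pwSegment]

theorem pwSample_eq_flatten (θ : Fin (κ + 2) → ℝ) (x : Fin (κ + 1) → ℕ → ℝ) (n : ℕ) :
    pwSample θ x n = (List.ofFn (pwSegment θ x n)).flatten := by
  rw [pwSample, List.flatMap_def, List.ofFn_eq_map]
  rfl

theorem getD_ofFn {α : Type*} {N : ℕ} (f : Fin N → List α) (j : Fin N) :
    (List.ofFn f).getD j [] = f j := by
  simp

theorem sum_length_pwSample (h0 : θ 0 = 0) (hm : Monotone θ) (n : ℕ) (j : Fin (κ + 2)) :
    ∑ i ∈ Finset.range j, ((List.ofFn (pwSegment θ x n)).getD i []).length = ⌊n * θ j⌋₊ := by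
  induction j using Fin.induction with
  | zero => simp [h0]
  | succ j ih =>
    rw [Fin.val_succ, Finset.sum_range_succ]
    rw [Fin.val_castSucc] at ih
    have hle : ⌊n * θ j.castSucc⌋₊ ≤ ⌊n * θ j.succ⌋₊ :=
      Nat.floor_mono (mul_le_mul_of_nonneg_left (hm (Fin.castSucc_le_succ j)) (Nat.cast_nonneg n))
    rw [ih, getD_ofFn, length_pwSegment]
    omega

theorem length_flatten_eq_sum (L : List (List ℝ)) :
    L.flatten.length = ∑ i ∈ Finset.range L.length, (L.getD i []).length := by
  induction L with
  | nil => rfl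
  | cons a L ih =>
    rw [List.length_cons, Finset.sum_range_succ', List.flatten_cons, List.length_append, ih, add_comm]
    rfl

theorem length_pwSample (h0 : θ 0 = 0) (hm : Monotone θ) (n : ℕ) :
    (pwSample θ x n).length = ⌊n * θ (Fin.last (κ + 1))⌋₊ := by
  rw [← sum_length_pwSample (x := x) h0 hm n, pwSample_eq_flatten, length_flatten_eq_sum,
    List.length_ofFn, Fin.val_last]

/-- The terms of the `j`-th segment of a sample are the first terms of row `j`. -/
theorem getD_pwSample (h0 : θ 0 = 0) (hm : Monotone θ) (n : ℕ) (j : Fin (κ + 1)) {t : ℕ}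
    (ht : ⌊n * θ j.castSucc⌋₊ + t < ⌊n * θ j.succ⌋₊) :
    (pwSample θ x n).getD (⌊n * θ j.castSucc⌋₊ + t) 0 = x j t := by
  have ht' : t < ⌊n * θ j.succ⌋₊ - ⌊n * θ j.castSucc⌋₊ := by omega
  have hj : ((List.ofFn (pwSegment θ x n)).getD (j.castSucc : Fin (κ + 2)) []) =
    pwSegment θ x n j := getD_ofFn _ j
  rw [pwSample_eq_flatten, ← sum_length_pwSample (x := x) h0 hm n j.castSucc,
    getD_flatten _ (by rw [List.length_ofFn, Fin.val_castSucc]; exact j.2), hj]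
  · simp [pwSegment, ht']
  · rw [hj, length_pwSegment]; exact ht'

end sample

/-! ### Empirical frequencies in pieces of a sample -/

/-- The rows `x` have the limiting empirical frequencies `p`, and the normalized change points `θ`
are at least `lam` apart. -/
structure IsGeneric {κ : ℕ} (lam : ℝ) (θ : Fin (κ + 2) → ℝ) (x : Fin (κ + 1) → ℕ → ℝ)
    (p : Fin (κ + 1) → CubeFamily) : Prop where
  lam_pos : 0 < lam
  zero : θ 0 = 0
  lt_one : ∀ k : Fin (κ + 1), θ k.succ < 1
  sep : ∀ k : Fin (κ + 1), lam ≤ θ k.succ - θ k.castSucc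
  freq : ∀ j u v k, Tendsto (fun n => empFamily n (x j) u v k) atTop (𝓝 (p j u v k))
  prob : ∀ j, IsProbFamily (p j)
  ne : ∀ k : Fin κ, p k.castSucc ≠ p k.succ

section generic
variable {κ : ℕ} {lam : ℝ} {θ : Fin (κ + 2) → ℝ} {x : Fin (κ + 1) → ℕ → ℝ}
  {p : Fin (κ + 1) → CubeFamily}

theorem IsGeneric.strictMono (h : IsGeneric lam θ x p) : StrictMono θ :=
  Fin.strictMono_iff_lt_succ.2 fun k => by linarith [h.sep k, h.lam_pos]

theorem IsGeneric.nonneg (h : IsGeneric lam θ x p) (j : Fin (κ + 2)) : 0 ≤ θ j :=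
  h.zero ▸ h.strictMono.monotone (Fin.zero_le j)

theorem IsGeneric.length (h : IsGeneric lam θ x p) (n : ℕ) :
    (pwSample θ x n).length = ⌊n * θ (Fin.last (κ + 1))⌋₊ :=
  length_pwSample h.zero h.strictMono.monotone n

theorem IsGeneric.hasRate_length (h : IsGeneric lam θ x p) {l : Filter ℕ} (hl : l ≤ atTop) :
    HasRate l (fun n => (pwSample θ x n).length) (θ (Fin.last (κ + 1))) := by
  simp only [h.length]
  exact hasRate_floor_mul hl (h.nonneg _)

/-- In a segment of the sample, the counts grow at the rate of the limiting frequency. -/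
theorem IsGeneric.tendsto_windowCount (h : IsGeneric lam θ x p) {l : Filter ℕ} (hl : l ≤ atTop)
    (u v : ℕ) (k : Fin (u + 1) → ℤ) (j : Fin (κ + 1)) {c : ℝ}
    (hc : Tendsto (fun n => windowCount (fun t => (pwSample θ x n).getD t 0) (dyadicCube (v + 1) k)
      ⌊n * θ j.castSucc⌋₊ / n) l (𝓝 c)) {t : ℕ → ℕ} {τ : ℝ} (ht : HasRate l t τ)
    (h1 : θ j.castSucc ≤ τ) (h2 : τ ≤ θ j.succ) :
    Tendsto (fun n => windowCount (fun t => (pwSample θ x n).getD t 0) (dyadicCube (v + 1) k)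
      (t n) / n) l (𝓝 (c + (τ - θ j.castSucc) * p j u v k)) := by
  have hb := hasRate_floor_mul hl (h.nonneg j.castSucc)
  have he := hasRate_floor_mul hl (h.nonneg j.succ)
  -- the windows that start in the first `r n` positions of the segment end in the segment
  set r : ℕ → ℕ := fun n => min (t n) ⌊n * θ j.succ⌋₊ - (⌊n * θ j.castSucc⌋₊ + u) with hr
  have hrr : HasRate l r (τ - θ j.castSucc) := by
    have := (ht.min he).sub_of_le (hb.add (hasRate_const hl u)) (by
      rw [add_zero, min_eq_left h2]; exact h1)
    rwa [add_zero, min_eq_left h2] at this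
  have hs : HasRate l (fun n => ⌊n * θ j.castSucc⌋₊ + r n) τ := by
    have := hb.add hrr
    rwa [add_sub_cancel] at this
  refine tendsto_windowCount_of_hasRate (fun n t => (pwSample θ x n).getD t 0) _ hs ht ?_
  refine (hc.add (tendsto_windowCount_row hl (h.freq j u v k) hrr (sub_nonneg.2 h1))).congr
    fun n => ?_
  rw [windowCount_add, add_div, windowCount]
  congr 2
  refine Finset.sum_congr rfl fun i hi => ?_
  have hi' : i < r n := Finset.mem_range.1 hi
  congr 1
  funext m
  have hm := m.2
  simp only [window]
  rw [add_assoc]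
  exact (getD_pwSample h.zero h.strictMono.monotone n j (by simp only [hr] at hi'; omega)).symm

/-- The counts up to a change point grow linearly. -/
theorem IsGeneric.exists_tendsto_windowCount (h : IsGeneric lam θ x p) {l : Filter ℕ}
    (hl : l ≤ atTop) (u v : ℕ) (k : Fin (u + 1) → ℤ) (j : Fin (κ + 2)) :
    ∃ c, Tendsto (fun n => windowCount (fun t => (pwSample θ x n).getD t 0) (dyadicCube (v + 1) k)
      ⌊n * θ j⌋₊ / n) l (𝓝 c) := by
  induction j using Fin.induction with
  | zero => exact ⟨0, by simpa [h.zero, windowCount] using tendsto_const_nhds⟩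
  | succ j ih =>
    obtain ⟨c, hc⟩ := ih
    exact ⟨_, h.tendsto_windowCount hl u v k j hc (hasRate_floor_mul hl (h.nonneg j.succ))
      (h.strictMono.monotone (Fin.castSucc_le_succ j)) le_rfl⟩

theorem empFamily_seg {y : List ℝ} {a b u v : ℕ} (hb : b ≤ y.length) (hu : a + u < b)
    (k : Fin (u + 1) → ℤ) :
    empFamily (seg y a b).length (fun t => (seg y a b).getD t 0) u v k =
      (windowCount (fun t => y.getD t 0) (dyadicCube (v + 1) k) (b - u) -
        windowCount (fun t => y.getD t 0) (dyadicCube (v + 1) k) a) / ((b - (a + u) : ℕ) : ℝ) := by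
  have e1 : b - u = a + (b - (a + u)) := by omega
  have e2 : b - a - (u + 1) + 1 = b - (a + u) := by omega
  rw [empFamily, empFreq, length_seg hb, if_pos (by omega), e1, e2, windowCount_add,
    add_sub_cancel_left]
  congr 1
  refine Finset.sum_congr rfl fun i hi => ?_
  have hi' := Finset.mem_range.1 hi
  congr 1
  funext m
  have hm := m.2
  simp only [window]
  rw [getD_seg (by omega), add_assoc]

/-- The empirical frequencies of a piece of a sequence converge if the counts grow linearly. -/
theorem empTendsto_seg {l : Filter ℕ} (hl : l ≤ atTop) {Y : ℕ → List ℝ} {a b : ℕ → ℕ} {α β : ℝ}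
    (ha : HasRate l a α) (hb : HasRate l b β) (hαβ : α < β) (hle : ∀ᶠ n in l, b n ≤ (Y n).length)
    {q : CubeFamily} {cα cβ : (u v : ℕ) → (Fin (u + 1) → ℤ) → ℝ}
    (hcα : ∀ u v k, Tendsto (fun n => windowCount (fun t => (Y n).getD t 0)
      (dyadicCube (v + 1) k) (a n) / n) l (𝓝 (cα u v k)))
    (hcβ : ∀ u v k, Tendsto (fun n => windowCount (fun t => (Y n).getD t 0)
      (dyadicCube (v + 1) k) (b n) / n) l (𝓝 (cβ u v k)))
    (hq : ∀ u v k, cβ u v k - cα u v k = (β - α) * q u v k) :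
    EmpTendsto l (fun n => seg (Y n) (a n) (b n)) q := by
  refine ⟨?_, fun u v k => ?_⟩
  · refine ((hb.sub_of_le ha hαβ.le).tendsto_atTop hl (sub_pos.2 hαβ)).congr' ?_
    filter_upwards [hle] with n hn
    rw [length_seg hn]
  · have hau : HasRate l (fun n => a n + u) α := by
      have := ha.add (hasRate_const hl u)
      rwa [add_zero] at this
    have hm : HasRate l (fun n => b n - (a n + u)) (β - α) := hb.sub_of_le hau hαβ.le
    have hbu : HasRate l (fun n => b n - u) β := by
      have h0 := Tendsto.sub hb (hasRate_const hl u)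
      rw [sub_zero] at h0
      refine h0.congr' ?_
      filter_upwards [hau.eventually_lt hl hb hαβ] with n hn
      rw [Nat.cast_sub (by omega), sub_div]
    have h1 := tendsto_windowCount_of_hasRate (fun n t => (Y n).getD t 0) _ hb hbu (hcβ u v k)
    have h2 := (h1.sub (hcα u v k)).div hm (sub_pos.2 hαβ).ne'
    rw [hq, mul_div_cancel_left₀ _ (sub_pos.2 hαβ).ne'] at h2
    refine h2.congr' ?_
    filter_upwards [hle, hau.eventually_lt hl hb hαβ, hl (eventually_gt_atTop 0)] with n h3 h4 h5
    have h5' : (n : ℝ) ≠ 0 := by positivity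
    simp only [Pi.div_apply]
    rw [empFamily_seg h3 h4, ← sub_div, div_div_div_cancel_right₀ h5']

/-- A piece of the sample that lies, in the limit, in a single segment. -/
theorem IsGeneric.empTendsto_single (h : IsGeneric lam θ x p) {l : Filter ℕ} (hl : l ≤ atTop)
    {a b : ℕ → ℕ} {α β : ℝ} (ha : HasRate l a α) (hb : HasRate l b β) (hαβ : α < β)
    (hle : ∀ᶠ n in l, b n ≤ (pwSample θ x n).length) {j : Fin (κ + 1)} (h1 : θ j.castSucc ≤ α)
    (h2 : β ≤ θ j.succ) : EmpTendsto l (fun n => seg (pwSample θ x n) (a n) (b n)) (p j) := by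
  choose c hc using fun u v k => h.exists_tendsto_windowCount hl u v k j.castSucc
  exact empTendsto_seg hl ha hb hαβ hle
    (fun u v k => h.tendsto_windowCount hl u v k j (hc u v k) ha h1 (hαβ.le.trans h2))
    (fun u v k => h.tendsto_windowCount hl u v k j (hc u v k) hb (h1.trans hαβ.le) h2)
    fun u v k => by ring

/-- The mixture of two families. -/
def mixFamily (c : ℝ) (p q : CubeFamily) : CubeFamily := fun u v k =>
  (1 - c) * p u v k + c * q u v k

theorem IsProbFamily.mix {p q : CubeFamily} (hp : IsProbFamily p) (hq : IsProbFamily q) {c : ℝ}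
    (h0 : 0 ≤ c) (h1 : c ≤ 1) : IsProbFamily (mixFamily c p q) := by
  refine ⟨fun u v k => add_nonneg (mul_nonneg (sub_nonneg.2 h1) (hp.nonneg u v k))
    (mul_nonneg h0 (hq.nonneg u v k)), fun u v => ?_⟩
  have := ((hp.hasSum u v).mul_left (1 - c)).add ((hq.hasSum u v).mul_left c)
  rwa [mul_one, mul_one, sub_add_cancel] at this

/-- A piece of the sample that contains, in the limit, one change point. -/
theorem IsGeneric.empTendsto_mix (h : IsGeneric lam θ x p) {l : Filter ℕ} (hl : l ≤ atTop)
    {a b : ℕ → ℕ} {α β : ℝ} (ha : HasRate l a α) (hb : HasRate l b β) (hαβ : α < β)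
    (hle : ∀ᶠ n in l, b n ≤ (pwSample θ x n).length) {k : Fin κ}
    (h1 : θ k.castSucc.castSucc ≤ α) (h2 : α ≤ θ k.succ.castSucc) (h3 : θ k.succ.castSucc ≤ β)
    (h4 : β ≤ θ k.succ.succ) :
    EmpTendsto l (fun n => seg (pwSample θ x n) (a n) (b n))
      (mixFamily ((β - θ k.succ.castSucc) / (β - α)) (p k.castSucc) (p k.succ)) := by
  choose c hc using fun u v i => h.exists_tendsto_windowCount hl u v i k.castSucc.castSucc
  have e : k.castSucc.succ = k.succ.castSucc := Fin.succ_castSucc k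
  have hc' := fun u v i => h.tendsto_windowCount hl u v i k.castSucc (hc u v i)
    (hasRate_floor_mul hl (h.nonneg k.succ.castSucc)) (h1.trans h2) (by rw [e])
  refine empTendsto_seg hl ha hb hαβ hle
    (fun u v i => h.tendsto_windowCount hl u v i k.castSucc (hc u v i) ha h1 (by rw [e]; exact h2))
    (fun u v i => h.tendsto_windowCount hl u v i k.succ (hc' u v i) hb h3 h4)
    fun u v i => ?_
  have : β - α ≠ 0 := (sub_pos.2 hαβ).ne'
  simp only [mixFamily]
  field_simp
  ring

end generic

/-! ### Blocks of the sample -/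

section split
variable {w : ℕ → ℝ} {D : ℕ → ℕ∞} {κ : ℕ} {lam : ℝ} {θ : Fin (κ + 2) → ℝ}
  {x : Fin (κ + 1) → ℕ → ℝ} {p : Fin (κ + 1) → CubeFamily}

/-- An interval without inner change points lies in a single segment. -/
theorem exists_segment {α β : ℝ} (h0 : θ 0 ≤ α) (hαβ : α < β) (hβ : β ≤ θ (Fin.last (κ + 1)))
    (hno : ∀ k : Fin κ, ¬ (α < θ k.succ.castSucc ∧ θ k.succ.castSucc < β)) :
    ∃ j : Fin (κ + 1), θ j.castSucc ≤ α ∧ β ≤ θ j.succ := by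
  have key : ∀ j : Fin (κ + 2), β ≤ θ j → ∃ j : Fin (κ + 1), θ j.castSucc ≤ α ∧ β ≤ θ j.succ := by
    intro j
    induction j using Fin.induction with
    | zero => intro h; linarith
    | succ j ih =>
      intro h
      rcases le_or_gt β (θ j.castSucc) with h1 | h1
      · exact ih h1
      · refine ⟨j, ?_, h⟩
        rcases Fin.eq_zero_or_eq_succ j with rfl | ⟨k, rfl⟩
        · exact h0
        · by_contra h2
          exact hno k ⟨not_le.1 h2, h1⟩
  exact key _ hβ

/-- The limit of the empirical distance of the two parts of an interval with limits `A` and `B`,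
split at `σ`, relative to the distance of the distributions before and after the change point `τ`. -/
def splitFactor (A B τ σ : ℝ) : ℝ :=
  if σ ≤ τ then (B - τ) / (B - σ) else (τ - A) / (σ - A)

theorem splitFactor_pos {A B τ σ : ℝ} (h1 : A < τ) (h2 : τ < B) :
    0 < splitFactor A B τ σ := by
  unfold splitFactor
  split_ifs with h
  · exact div_pos (by linarith) (by linarith)
  · exact div_pos (by linarith) (by linarith)

theorem splitFactor_self {A B τ : ℝ} (h2 : τ < B) : splitFactor A B τ τ = 1 := by
  rw [splitFactor, if_pos le_rfl, div_self (by linarith)]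

/-- The limit of the objective function is maximal at the change point only. -/
theorem eq_of_one_le_splitFactor {A B τ σ : ℝ} (h1 : A < τ) (h2 : τ < B)
    (h : 1 ≤ splitFactor A B τ σ) : σ = τ := by
  unfold splitFactor at h
  split_ifs at h with hστ
  · rw [one_le_div (by linarith)] at h
    linarith
  · rw [one_le_div (by linarith)] at h
    linarith

variable (hw : ∀ j, 1 ≤ j → 0 < w j) (hws : Summable w) (hD : Tendsto D atTop (𝓝 ⊤))
include hw hws hD

/-- The limit of the objective function of the single-change-point estimate. -/
theorem IsGeneric.tendsto_empDist_split (h : IsGeneric lam θ x p) {l : Filter ℕ} (hl : l ≤ atTop)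
    {a s b : ℕ → ℕ} {A σ B : ℝ} (ha : HasRate l a A) (hs : HasRate l s σ) (hb : HasRate l b B)
    (hAσ : A < σ) (hσB : σ < B) (hsb : ∀ᶠ n in l, s n ≤ (pwSample θ x n).length)
    (hle : ∀ᶠ n in l, b n ≤ (pwSample θ x n).length) {k : Fin κ}
    (h1 : θ k.castSucc.castSucc ≤ A) (h2 : A < θ k.succ.castSucc) (h3 : θ k.succ.castSucc < B)
    (h4 : B ≤ θ k.succ.succ) :
    Tendsto (fun n => empDist w D (seg (pwSample θ x n) (a n) (s n))
        (seg (pwSample θ x n) (s n) (b n))) l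
      (𝓝 (splitFactor A B (θ k.succ.castSucc) σ * familyDist w (p k.castSucc) (p k.succ))) := by
  have e : k.castSucc.succ = k.succ.castSucc := Fin.succ_castSucc k
  have hp := h.prob k.castSucc
  have hq := h.prob k.succ
  unfold splitFactor
  split_ifs with hc
  · have hm := h.empTendsto_mix hl hs hb hσB hle (h1.trans hAσ.le) hc h3.le h4
    have hf := h.empTendsto_single hl ha hs hAσ hsb h1 (by rw [e]; exact hc)
    have hpos : 0 ≤ (B - θ k.succ.castSucc) / (B - σ) :=
      div_nonneg (by linarith) (by linarith)
    have := tendsto_empDist hw hws hD hf hm hp (hp.mix hq hpos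
      ((div_le_one (by linarith)).2 (by linarith)))
    rwa [familyDist_of_sub_eq w (r := p k.castSucc) (s := p k.succ)
      ((B - θ k.succ.castSucc) / (B - σ)) (fun u v k => by simp only [mixFamily]; ring),
      abs_of_nonneg hpos] at this
  · rw [not_le] at hc
    have hm := h.empTendsto_mix hl ha hs hAσ hsb h1 h2.le hc.le (hσB.le.trans h4)
    have hf := h.empTendsto_single hl hs hb hσB hle hc.le h4
    have hpos : 0 ≤ (σ - θ k.succ.castSucc) / (σ - A) :=
      div_nonneg (by linarith) (by linarith)
    have hpos' : 0 ≤ (θ k.succ.castSucc - A) / (σ - A) :=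
      div_nonneg (by linarith) (by linarith)
    have := tendsto_empDist hw hws hD hm hf (hp.mix hq hpos
      ((div_le_one (by linarith)).2 (by linarith))) hq
    rwa [familyDist_of_sub_eq w (r := p k.castSucc) (s := p k.succ)
      ((θ k.succ.castSucc - A) / (σ - A)) (fun u v k => by
        have : σ - A ≠ 0 := by linarith
        simp only [mixFamily]; field_simp; ring),
      abs_of_nonneg hpos'] at this

end split

/-- The limit of the normalized grid points of samples whose lengths grow at the rate `Θ`. -/
def gridLim (lam Θ : ℝ) (t i : ℕ) : ℝ := Θ * (lam / 3) * ((i : ℝ) + 1 / ((t : ℝ) + 1))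

theorem hasRate_gridPt {l : Filter ℕ} (hl : l ≤ atTop) {lam Θ : ℝ} (hlam : 0 ≤ lam) {L : ℕ → ℕ}
    (hL : HasRate l L Θ) (t i : ℕ) :
    HasRate l (fun n => gridPt lam (L n) t i) (gridLim lam Θ t i) := by
  refine hasRate_floor hl (fun n => by positivity) ?_
  refine (Tendsto.mul_const ((lam / 3) * ((i : ℝ) + 1 / ((t : ℝ) + 1))) hL).congr' ?_ |>.trans_eq ?_
  · exact Eventually.of_forall fun n => by ring
  · rw [gridLim, mul_assoc]

theorem gridLim_succ (lam Θ : ℝ) (t i : ℕ) :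
    gridLim lam Θ t (i + 1) = gridLim lam Θ t i + Θ * lam / 3 := by
  simp only [gridLim]; push_cast; ring

theorem mem_blocks {lam : ℝ} {n : ℕ} {c : ℕ × ℕ} :
    c ∈ blocks lam n ↔ ((c.1 = 1 ∨ c.1 = 2) ∧ 1 ≤ c.2 ∧ c.2 < 1 + ⌊3 / lam⌋₊) ∧
      gridPt lam n c.1 (c.2 + 2) ≤ n := by
  obtain ⟨t, i⟩ := c
  simp [blocks, List.mem_range'_1]
  grind

theorem finite_blockIndices (q : ℕ) :
    {c : ℕ × ℕ | (c.1 = 1 ∨ c.1 = 2) ∧ 1 ≤ c.2 ∧ c.2 < 1 + q}.Finite :=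
  ((Set.finite_Icc 1 2).prod (Set.finite_Icc 1 q)).subset fun c hc => by
    simp only [Set.mem_ofPred_eq] at hc
    simp only [Set.mem_prod, Set.mem_Icc]
    omega

/-- Every point which is not close to the ends of the sample lies in the interior of a block. This
is the reason for using two grids. -/
theorem exists_block {lam Θ τ : ℝ} (hlam : 0 < lam) (hΘ : 0 < Θ) (hΘ1 : Θ < 1) (h1 : lam ≤ τ)
    (h2 : τ + lam ≤ Θ) : ∃ c : ℕ × ℕ, (∀ n, c ∈ blocks lam n) ∧
      gridLim lam Θ c.1 c.2 < τ ∧ τ < gridLim lam Θ c.1 (c.2 + 1) := by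
  have hh : 0 < Θ * (lam / 3) := by positivity
  set z := τ / (Θ * (lam / 3)) with hz
  have hτ : τ = Θ * (lam / 3) * z := by rw [hz]; field_simp
  have hz3 : 3 < z := by
    rw [hz, lt_div_iff₀ hh]; nlinarith
  have hzle : z + 3 ≤ 3 / lam := by
    rw [le_div_iff₀ hlam]
    have : Θ * ((z + 3) * lam) ≤ Θ * 3 := by nlinarith
    exact le_of_mul_le_mul_left this hΘ
  have key : ∀ t i : ℕ, (t = 1 ∨ t = 2) → (i : ℝ) + 1 / ((t : ℝ) + 1) < z →
      z < ((i + 1 : ℕ) : ℝ) + 1 / ((t : ℝ) + 1) → ∃ c : ℕ × ℕ, (∀ n, c ∈ blocks lam n) ∧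
      gridLim lam Θ c.1 c.2 < τ ∧ τ < gridLim lam Θ c.1 (c.2 + 1) := by
    intro t i ht hi hi'
    have ht1 : 1 / ((t : ℝ) + 1) ≤ 1 / 2 := by
      rcases ht with rfl | rfl <;> norm_num
    have ht0 : 0 < 1 / ((t : ℝ) + 1) := by positivity
    push_cast at hi'
    refine ⟨(t, i), fun n => mem_blocks.2 ⟨⟨ht, ?_, ?_⟩, ?_⟩, ?_, ?_⟩
    · have : (0 : ℝ) < i := by linarith
      have : 0 < i := by exact_mod_cast this
      exact this
    · have : i ≤ ⌊3 / lam⌋₊ := Nat.le_floor (by linarith)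
      simp only; omega
    · refine Nat.floor_le_of_le ?_
      have h5 : (((i + 2 : ℕ) : ℝ) + 1 / ((t : ℝ) + 1)) ≤ 3 / lam := by push_cast; linarith
      calc (n : ℝ) * (lam / 3) * (((i + 2 : ℕ) : ℝ) + 1 / ((t : ℝ) + 1))
          ≤ n * (lam / 3) * (3 / lam) := by gcongr
        _ = n := by field_simp
    · rw [hτ]; exact mul_lt_mul_of_pos_left hi hh
    · rw [hτ, gridLim]; push_cast
      exact mul_lt_mul_of_pos_left hi' hh
  have hf1 := Nat.floor_le (show 0 ≤ z - 1 / 2 by linarith)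
  have hf2 := Nat.lt_floor_add_one (z - 1 / 2)
  -- the first grid fails only if the point is one of its grid points
  rcases hf1.eq_or_lt with he | hlt
  · refine key 2 ⌊z - 1 / 2⌋₊ (Or.inr rfl) ?_ ?_
    · rw [he]; norm_num; linarith
    · push_cast; rw [he]; norm_num; linarith
  · refine key 1 ⌊z - 1 / 2⌋₊ (Or.inl rfl) ?_ ?_
    · norm_num at hlt ⊢; linarith
    · push_cast; norm_num at hf2 ⊢; linarith

theorem hasRate_half_add {l : Filter ℕ} (hl : l ≤ atTop) {a b : ℕ → ℕ} {α β : ℝ}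
    (ha : HasRate l a α) (hb : HasRate l b β) :
    HasRate l (fun n => (a n + b n) / 2) ((α + β) / 2) := by
  have := hasRate_floor hl (z := fun n => ((a n + b n : ℕ) : ℝ) / 2) (fun n => by positivity)
    (((ha.add hb).div_const 2).congr fun n => by ring)
  refine this.congr fun n => ?_
  simp only
  rw [show ((a n + b n : ℕ) : ℝ) / 2 = ((a n + b n : ℕ) : ℝ) / (2 : ℕ) by norm_num,
    Nat.floor_div_eq_div]

/-- The estimate of a block maximizes the distance between the two sides. -/
theorem blockEstimate_spec (w : ℕ → ℝ) (D : ℕ → ℕ∞) {lam : ℝ} (hlam : 0 ≤ lam) (y : List ℝ)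
    (c : ℕ × ℕ) :
    gridPt lam y.length c.1 c.2 ≤ blockEstimate w D lam y c ∧
      blockEstimate w D lam y c ≤ gridPt lam y.length c.1 (c.2 + 1) ∧
      ∀ s, gridPt lam y.length c.1 c.2 ≤ s → s ≤ gridPt lam y.length c.1 (c.2 + 1) →
        empDist w D (seg y (gridPt lam y.length c.1 (c.2 - 1)) s)
            (seg y s (gridPt lam y.length c.1 (c.2 + 2))) ≤
          empDist w D (seg y (gridPt lam y.length c.1 (c.2 - 1)) (blockEstimate w D lam y c))
            (seg y (blockEstimate w D lam y c) (gridPt lam y.length c.1 (c.2 + 2))) := by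
  have hm := gridPt_mono hlam y.length c.1 (Nat.le_succ c.2)
  have hmem : ∀ s, s ∈ List.range' (gridPt lam y.length c.1 c.2)
      (gridPt lam y.length c.1 (c.2 + 1) - gridPt lam y.length c.1 c.2 + 1) ↔
      gridPt lam y.length c.1 c.2 ≤ s ∧ s ≤ gridPt lam y.length c.1 (c.2 + 1) := fun s => by
    simp only [Nat.succ_eq_add_one] at hm
    rw [List.mem_range'_1]; omega
  set f := fun s => empDist w D (seg y (gridPt lam y.length c.1 (c.2 - 1)) s)
      (seg y s (gridPt lam y.length c.1 (c.2 + 2))) with hf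
  obtain ⟨e, he⟩ : ∃ e, (List.range' (gridPt lam y.length c.1 c.2)
      (gridPt lam y.length c.1 (c.2 + 1) - gridPt lam y.length c.1 c.2 + 1)).argmax f = some e :=
    Option.ne_none_iff_exists'.1 fun h0 => by
      have := List.argmax_eq_none.1 h0
      simp at this
  have e1 : blockEstimate w D lam y c = e := by
    have : blockEstimate w D lam y c = ((List.range' (gridPt lam y.length c.1 c.2)
      (gridPt lam y.length c.1 (c.2 + 1) - gridPt lam y.length c.1 c.2 + 1)).argmax f).getD 0 := rfl
    rw [this, he]; rfl
  have e2 := (hmem e).1 (List.argmax_mem he)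
  rw [e1]
  exact ⟨e2.1, e2.2, fun s h1 h2 => List.le_of_mem_argmax ((hmem s).2 ⟨h1, h2⟩) he⟩

section block
variable {w : ℕ → ℝ} {D : ℕ → ℕ∞} {κ : ℕ} {lam : ℝ} {θ : Fin (κ + 2) → ℝ}
  {x : Fin (κ + 1) → ℕ → ℝ} {p : Fin (κ + 1) → CubeFamily}

theorem IsGeneric.last_pos (h : IsGeneric lam θ x p) : 0 < θ (Fin.last (κ + 1)) := by
  rw [← h.zero]; exact h.strictMono (Fin.last_pos)

theorem IsGeneric.last_lt_one (h : IsGeneric lam θ x p) : θ (Fin.last (κ + 1)) < 1 :=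
  h.lt_one (Fin.last κ)

theorem IsGeneric.hasRate_gridPt (h : IsGeneric lam θ x p) {l : Filter ℕ} (hl : l ≤ atTop)
    (t i : ℕ) : HasRate l (fun n => gridPt lam (pwSample θ x n).length t i)
      (gridLim lam (θ (Fin.last (κ + 1))) t i) :=
  PSClust.hasRate_gridPt hl h.lam_pos.le (h.hasRate_length hl) t i

/-- A block encloses at most one change point, even after its enlargement. -/
theorem IsGeneric.neighbours (h : IsGeneric lam θ x p) {t i : ℕ} (hi : 1 ≤ i) {k : Fin κ}
    (h1 : gridLim lam (θ (Fin.last (κ + 1))) t i < θ k.succ.castSucc)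
    (h2 : θ k.succ.castSucc < gridLim lam (θ (Fin.last (κ + 1))) t (i + 1)) :
    θ k.castSucc.castSucc ≤ gridLim lam (θ (Fin.last (κ + 1))) t (i - 1) ∧
      gridLim lam (θ (Fin.last (κ + 1))) t (i + 2) ≤ θ k.succ.succ := by
  obtain ⟨i, rfl⟩ := Nat.exists_eq_add_of_le' hi
  have s1 := h.sep k.castSucc
  have s2 := h.sep k.succ
  rw [Fin.succ_castSucc k] at s1
  have hlt : θ (Fin.last (κ + 1)) * lam < lam := by nlinarith [h.last_lt_one, h.lam_pos]
  rw [gridLim_succ] at h1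
  rw [gridLim_succ, gridLim_succ] at h2
  rw [Nat.add_sub_cancel, gridLim_succ, gridLim_succ, gridLim_succ]
  have h0 := mul_pos h.last_pos h.lam_pos
  constructor <;> linarith

variable (hw : ∀ j, 1 ≤ j → 0 < w j) (hws : Summable w) (hD : Tendsto D atTop (𝓝 ⊤))
include hw hws hD

/-- The score of a block that encloses a change point has a positive limit. -/
theorem IsGeneric.tendsto_blockScore (h : IsGeneric lam θ x p) {l : Filter ℕ} (hl : l ≤ atTop)
    {c : ℕ × ℕ} (hi : 1 ≤ c.2)
    (hle : ∀ᶠ n in l, gridPt lam (pwSample θ x n).length c.1 (c.2 + 2) ≤ (pwSample θ x n).length)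
    {k : Fin κ} (h1 : gridLim lam (θ (Fin.last (κ + 1))) c.1 c.2 < θ k.succ.castSucc)
    (h2 : θ k.succ.castSucc < gridLim lam (θ (Fin.last (κ + 1))) c.1 (c.2 + 1)) :
    ∃ d, 0 < d ∧ Tendsto (fun n => blockScore w D lam (pwSample θ x n) c) l (𝓝 d) := by
  have h0 := mul_pos h.last_pos h.lam_pos
  obtain ⟨hn1, hn2⟩ := h.neighbours hi h1 h2
  obtain ⟨i, hi'⟩ := Nat.exists_eq_add_of_le' hi
  have g1 := gridLim_succ lam (θ (Fin.last (κ + 1))) c.1 (c.2 - 1)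
  rw [Nat.sub_add_cancel hi] at g1
  have g2 := gridLim_succ lam (θ (Fin.last (κ + 1))) c.1 c.2
  have g3 := gridLim_succ lam (θ (Fin.last (κ + 1))) c.1 (c.2 + 1)
  have ha := h.hasRate_gridPt hl c.1 c.2
  have hb := h.hasRate_gridPt hl c.1 (c.2 + 1)
  refine ⟨_, ?_, h.tendsto_empDist_split hw hws hD hl ha (hasRate_half_add hl ha hb) hb
    (by linarith) (by linarith) ?_ ?_ (by linarith) h1 h2 (by linarith)⟩
  · exact mul_pos (splitFactor_pos h1 h2) (familyDist_pos hw hws (h.prob _) (h.prob _) (h.ne k))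
  · filter_upwards [hle] with n hn
    have m1 := gridPt_mono h.lam_pos.le (pwSample θ x n).length c.1 (Nat.le_add_right c.2 2)
    have m2 := gridPt_mono h.lam_pos.le (pwSample θ x n).length c.1
      (show c.2 + 1 ≤ c.2 + 2 by omega)
    omega
  · filter_upwards [hle] with n hn
    exact (gridPt_mono h.lam_pos.le _ c.1 (by omega)).trans hn

/-- The score of a block without inner change points tends to zero. -/
theorem IsGeneric.tendsto_blockScore_zero (h : IsGeneric lam θ x p) {l : Filter ℕ} [l.NeBot]
    (hl : l ≤ atTop) {c : ℕ × ℕ}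
    (hle : ∀ᶠ n in l, gridPt lam (pwSample θ x n).length c.1 (c.2 + 2) ≤ (pwSample θ x n).length)
    (hno : ∀ k : Fin κ, ¬ (gridLim lam (θ (Fin.last (κ + 1))) c.1 c.2 < θ k.succ.castSucc ∧
      θ k.succ.castSucc < gridLim lam (θ (Fin.last (κ + 1))) c.1 (c.2 + 1))) :
    Tendsto (fun n => blockScore w D lam (pwSample θ x n) c) l (𝓝 0) := by
  have h0 := mul_pos h.last_pos h.lam_pos
  have g2 := gridLim_succ lam (θ (Fin.last (κ + 1))) c.1 c.2
  have ha := h.hasRate_gridPt hl c.1 c.2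
  have hb := h.hasRate_gridPt hl c.1 (c.2 + 1)
  have hs := hasRate_half_add hl ha hb
  have hlb : ∀ᶠ n in l, gridPt lam (pwSample θ x n).length c.1 (c.2 + 1) ≤
      (pwSample θ x n).length := by
    filter_upwards [hle] with n hn
    exact (gridPt_mono h.lam_pos.le _ c.1 (by omega)).trans hn
  have hpos : θ 0 ≤ gridLim lam (θ (Fin.last (κ + 1))) c.1 c.2 := by
    rw [h.zero, gridLim]
    have := h.lam_pos
    have := h.last_pos
    positivity
  obtain ⟨j, hj1, hj2⟩ := exists_segment hpos (by linarith) (hb.le (h.hasRate_length hl) hlb) hno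
  have e1 := h.empTendsto_single hl ha hs (by linarith) (by
    filter_upwards [hlb] with n hn
    have m1 := gridPt_mono h.lam_pos.le (pwSample θ x n).length c.1 (Nat.le_add_right c.2 1)
    omega) hj1 (by linarith)
  have e2 := h.empTendsto_single hl hs hb (by linarith) hlb (j := j) (by linarith) hj2
  have := tendsto_empDist hw hws hD e1 e2 (h.prob j) (h.prob j)
  rwa [familyDist_self] at this

/-- The estimate of a block that encloses a change point is consistent. -/
theorem IsGeneric.hasRate_blockEstimate (h : IsGeneric lam θ x p) {𝒰 : Ultrafilter ℕ}
    (hl : (𝒰 : Filter ℕ) ≤ atTop) {c : ℕ × ℕ} (hi : 1 ≤ c.2)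
    (hle : ∀ᶠ n in (𝒰 : Filter ℕ),
      gridPt lam (pwSample θ x n).length c.1 (c.2 + 2) ≤ (pwSample θ x n).length)
    {k : Fin κ} (h1 : gridLim lam (θ (Fin.last (κ + 1))) c.1 c.2 < θ k.succ.castSucc)
    (h2 : θ k.succ.castSucc < gridLim lam (θ (Fin.last (κ + 1))) c.1 (c.2 + 1)) :
    HasRate 𝒰 (fun n => blockEstimate w D lam (pwSample θ x n) c) (θ k.succ.castSucc) := by
  have h0 := mul_pos h.last_pos h.lam_pos
  obtain ⟨hn1, hn2⟩ := h.neighbours hi h1 h2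
  have g1 := gridLim_succ lam (θ (Fin.last (κ + 1))) c.1 (c.2 - 1)
  rw [Nat.sub_add_cancel hi] at g1
  have g3 := gridLim_succ lam (θ (Fin.last (κ + 1))) c.1 (c.2 + 1)
  have hA := h.hasRate_gridPt hl c.1 (c.2 - 1)
  have ha := h.hasRate_gridPt hl c.1 c.2
  have hb := h.hasRate_gridPt hl c.1 (c.2 + 1)
  have hB := h.hasRate_gridPt hl c.1 (c.2 + 2)
  have hspec := fun n => blockEstimate_spec w D h.lam_pos.le (pwSample θ x n) c
  have hlb : ∀ᶠ n in (𝒰 : Filter ℕ), gridPt lam (pwSample θ x n).length c.1 (c.2 + 1) ≤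
      (pwSample θ x n).length := by
    filter_upwards [hle] with n hn
    exact (gridPt_mono h.lam_pos.le _ c.1 (by omega)).trans hn
  obtain ⟨σ, hσ⟩ := exists_hasRate hb (Eventually.of_forall fun n => (hspec n).2.1)
  have hσ1 := ha.le hσ (Eventually.of_forall fun n => (hspec n).1)
  have hσ2 := hσ.le hb (Eventually.of_forall fun n => (hspec n).2.1)
  have hτ := hasRate_floor_mul hl (h.nonneg k.succ.castSucc)
  have t1 := ha.eventually_lt hl hτ h1
  have t2 := hτ.eventually_lt hl hb h2
  have lim1 := h.tendsto_empDist_split hw hws hD hl hA hσ hB (by linarith) (by linarith)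
    (by filter_upwards [hlb] with n hn using (hspec n).2.1.trans hn) hle hn1 (by linarith)
    (by linarith) hn2
  have lim2 := h.tendsto_empDist_split hw hws hD hl hA hτ hB (by linarith) (by linarith)
    (by filter_upwards [hlb, t2] with n hn hn' using hn'.le.trans hn) hle hn1 (by linarith)
    (by linarith) hn2
  -- the true change point competes with the estimate
  have hcmp := le_of_tendsto_of_tendsto lim2 lim1 (by
    filter_upwards [t1, t2] with n h3 h4 using (hspec n).2.2 _ h3.le h4.le)
  have hd := familyDist_pos hw hws (h.prob _) (h.prob _) (h.ne k)
  have := le_of_mul_le_mul_right hcmp hd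
  rw [splitFactor_self (by linarith)] at this
  rwa [eq_of_one_le_splitFactor (by linarith) (by linarith) this] at hσ

end block

/-! ### Consistency of the list-estimator -/

/-- Each candidate is close to a selected candidate with at least the same score. -/
theorem exists_close_mem_greedySelect {r : ℝ} (hr : 0 < r) {k : ℕ} {U : List (ℕ × ℝ)}
    (hk : U.length ≤ k) {c : ℕ × ℝ} (hc : c ∈ U) :
    ∃ z ∈ U, z.1 ∈ greedySelect r k U ∧ c.2 ≤ z.2 ∧ |(c.1 : ℝ) - z.1| < r := by
  induction k generalizing U with
  | zero =>
    rw [List.eq_nil_of_length_eq_zero (Nat.le_zero.1 hk)] at hc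
    exact absurd hc List.not_mem_nil
  | succ k ih =>
    obtain ⟨z, hz⟩ : ∃ z, U.argmax Prod.snd = some z :=
      Option.ne_none_iff_exists'.1 fun h0 => by
        rw [List.argmax_eq_none.1 h0] at hc
        exact List.not_mem_nil hc
    rw [greedySelect_succ r k U hz]
    have hzU := List.argmax_mem hz
    rcases lt_or_ge |(c.1 : ℝ) - z.1| r with h | h
    · exact ⟨z, hzU, List.mem_cons_self, List.le_of_mem_argmax hc hz, h⟩
    · have hlen : (U.filter fun d => r ≤ |(d.1 : ℝ) - (z.1 : ℝ)|).length < U.length :=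
        List.length_filter_lt_length_iff_exists.2 ⟨z, hzU, by simpa using hr⟩
      obtain ⟨z', h1, h2, h3, h4⟩ := ih (Nat.le_of_lt_succ (hlen.trans_le hk))
        (List.mem_filter.2 ⟨hc, by simpa using h⟩)
      exact ⟨z', List.mem_of_mem_filter h1, List.mem_cons_of_mem _ h2, h3, h4⟩

theorem HasRate.eventually_mul_lt {l : Filter ℕ} (hl : l ≤ atTop) {s t : ℕ → ℕ} {σ τ c : ℝ}
    (hs : HasRate l s σ) (ht : HasRate l t τ) (h : c * σ < τ) :
    ∀ᶠ n in l, c * s n < t n := by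
  filter_upwards [Tendsto.eventually_lt (Tendsto.const_mul c hs) ht h,
    hl (eventually_gt_atTop 0)] with n hn h0
  rw [← mul_div_assoc] at hn
  exact (div_lt_div_iff_of_pos_right (by exact_mod_cast h0)).1 hn

section list
variable {w : ℕ → ℝ} {D : ℕ → ℕ∞} {κ : ℕ} {lam : ℝ} {θ : Fin (κ + 2) → ℝ}
  {x : Fin (κ + 1) → ℕ → ℝ} {p : Fin (κ + 1) → CubeFamily}

theorem mem_scoredCandidates {y : List ℝ} {z : ℕ × ℝ} :
    z ∈ scoredCandidates w D lam y ↔ (∃ c ∈ blocks lam y.length,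
      (blockEstimate w D lam y c, blockScore w D lam y c) = z) ∧
      0 < z.1 ∧ lam * y.length ≤ z.1 ∧ (z.1 : ℝ) + lam * y.length ≤ y.length := by
  simp [scoredCandidates, List.mem_filter]

variable (hw : ∀ j, 1 ≤ j → 0 < w j) (hws : Summable w) (hD : Tendsto D atTop (𝓝 ⊤))
include hw hws hD

/-- Each change point is the limit of a sequence of selected candidates: a candidate of high score
near the change point can only be discarded in favour of a candidate of higher score, which
comes from a block that encloses a change point within distance `lam`, hence the same one. -/
theorem IsGeneric.exists_mem_listEstimator (h : IsGeneric lam θ x p) {𝒰 : Ultrafilter ℕ}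
    (hl : (𝒰 : Filter ℕ) ≤ atTop) (k : Fin κ) :
    ∃ s : ℕ → ℕ, (∀ᶠ n in (𝒰 : Filter ℕ), s n ∈ listEstimator w D lam (pwSample θ x n)) ∧
      HasRate 𝒰 s (θ k.succ.castSucc) := by
  have hL := h.hasRate_length hl
  have hΘ := h.last_pos
  have hΘ1 := h.last_lt_one
  have hlamΘ : lam * θ (Fin.last (κ + 1)) < lam := by nlinarith [h.lam_pos]
  have s1 := h.sep k.castSucc
  have s2 := h.sep k.succ
  rw [Fin.succ_castSucc k] at s1
  have n1 := h.nonneg k.castSucc.castSucc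
  have n2 := h.strictMono.monotone (Fin.le_last k.succ.succ)
  obtain ⟨c, hcb, hc1, hc2⟩ := exists_block h.lam_pos hΘ hΘ1 (show lam ≤ θ k.succ.castSucc by
    linarith) (by linarith)
  have hc := mem_blocks.1 (hcb 0)
  have hle : ∀ c', (∀ᶠ n in (𝒰 : Filter ℕ), c' ∈ blocks lam (pwSample θ x n).length) →
      ∀ᶠ n in (𝒰 : Filter ℕ), gridPt lam (pwSample θ x n).length c'.1 (c'.2 + 2) ≤
        (pwSample θ x n).length := fun c' h' => h'.mono fun n hn => (mem_blocks.1 hn).2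
  have he := h.hasRate_blockEstimate hw hws hD hl hc.1.2.1
    (hle c (Eventually.of_forall fun n => hcb _)) hc1 hc2
  obtain ⟨d, hd, hscore⟩ := h.tendsto_blockScore hw hws hD hl hc.1.2.1
    (hle c (Eventually.of_forall fun n => hcb _)) hc1 hc2
  have hLe := hL.sub_of_le he (by linarith [h.lam_pos])
  have hclose : ∀ᶠ n in (𝒰 : Filter ℕ), ∃ c' ∈ {c : ℕ × ℕ | (c.1 = 1 ∨ c.1 = 2) ∧ 1 ≤ c.2 ∧
      c.2 < 1 + ⌊3 / lam⌋₊}, c' ∈ blocks lam (pwSample θ x n).length ∧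
      blockEstimate w D lam (pwSample θ x n) c' ∈ listEstimator w D lam (pwSample θ x n) ∧
      blockScore w D lam (pwSample θ x n) c ≤ blockScore w D lam (pwSample θ x n) c' ∧
      |(blockEstimate w D lam (pwSample θ x n) c : ℝ) -
        blockEstimate w D lam (pwSample θ x n) c'| < lam * (pwSample θ x n).length := by
    filter_upwards [hL.eventually_mul_lt hl he (c := lam) (by linarith),
      hL.eventually_mul_lt hl hLe (c := lam) (by linarith),
      (hL.tendsto_atTop hl hΘ).eventually_gt_atTop 0] with n h1 h2 h3
    have hpos : 0 < lam * (pwSample θ x n).length := mul_pos h.lam_pos (by exact_mod_cast h3)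
    have h4 : (0 : ℝ) < blockEstimate w D lam (pwSample θ x n) c := hpos.trans h1
    have h5 : blockEstimate w D lam (pwSample θ x n) c < (pwSample θ x n).length := by
      by_contra h6
      rw [Nat.sub_eq_zero_of_le (not_lt.1 h6), Nat.cast_zero] at h2
      linarith
    rw [Nat.cast_sub h5.le] at h2
    obtain ⟨z, hz, hzs, hz2, hz3⟩ := exists_close_mem_greedySelect hpos le_rfl
      (mem_scoredCandidates (w := w) (D := D).2 ⟨⟨c, hcb _, rfl⟩, by exact_mod_cast h4, h1.le,
        by simp only; linarith⟩)
    obtain ⟨⟨c', hc', rfl⟩, -⟩ := mem_scoredCandidates.1 hz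
    exact ⟨c', (mem_blocks.1 hc').1, hc', mem_listEstimator.2 hzs, hz2, hz3⟩
  obtain ⟨c', hcs, hc'⟩ := (Ultrafilter.eventually_exists_mem_iff (finite_blockIndices _)).1 hclose
  have hle' := hle c' (hc'.mono fun n hn => hn.1)
  -- a block without inner change points has a smaller score
  obtain ⟨k', h1, h2⟩ : ∃ k' : Fin κ,
      gridLim lam (θ (Fin.last (κ + 1))) c'.1 c'.2 < θ k'.succ.castSucc ∧
        θ k'.succ.castSucc < gridLim lam (θ (Fin.last (κ + 1))) c'.1 (c'.2 + 1) := by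
    by_contra hno
    have := le_of_tendsto_of_tendsto hscore (h.tendsto_blockScore_zero hw hws hD hl hle'
      fun k' hk' => hno ⟨k', hk'⟩) (hc'.mono fun n hn => hn.2.2.1)
    linarith
  have he' := h.hasRate_blockEstimate hw hws hD hl hcs.2.1 hle' h1 h2
  refine ⟨_, hc'.mono fun n hn => hn.2.1, ?_⟩
  -- change points at distance less than `lam` agree
  have hdist : |θ k.succ.castSucc - θ k'.succ.castSucc| ≤ lam * θ (Fin.last (κ + 1)) := by
    refine le_of_tendsto_of_tendsto (Tendsto.abs (Tendsto.sub he he')) (Tendsto.const_mul lam hL) ?_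
    filter_upwards [hc'] with n hn
    rw [← sub_div, abs_div, abs_of_nonneg (Nat.cast_nonneg n : (0 : ℝ) ≤ n), ← mul_div_assoc]
    exact div_le_div_of_nonneg_right hn.2.2.2.le (Nat.cast_nonneg n)
  have hkk : k' = k := by
    have key : ∀ a b : Fin κ, a < b → lam ≤ θ b.succ.castSucc - θ a.succ.castSucc := by
      intro a b hab
      have e1 := h.sep b.castSucc
      have e2 : θ a.succ.castSucc ≤ θ b.castSucc.castSucc :=
        h.strictMono.monotone (by
          rw [Fin.le_def]; simp only [Fin.val_castSucc, Fin.val_succ]; exact hab)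
      rw [Fin.succ_castSucc b] at e1
      linarith
    have hd := abs_le.1 hdist
    rcases lt_trichotomy k k' with hlt | heq | hlt
    · have := key _ _ hlt; linarith
    · exact heq.symm
    · have := key _ _ hlt; linarith
  rw [← hkk]
  exact he'

omit hw hws hD

/-- The boundaries of the estimated segments are at least `lam * y.length` apart. -/
theorem pairwise_boundaries (hlam : 0 < lam) (hlam1 : lam ≤ 1) {y : List ℝ} (hy : y ≠ []) :
    (boundaries w D lam y).Pairwise fun a b : ℕ => a < b ∧ (a : ℝ) + lam * y.length ≤ b := by
  have hL : 0 < lam * y.length :=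
    mul_pos hlam (by exact_mod_cast List.length_pos_iff.2 hy)
  have key : ∀ a b : ℕ, (a : ℝ) + lam * y.length ≤ b → a < b ∧ (a : ℝ) + lam * y.length ≤ b :=
    fun a b hab => ⟨by exact_mod_cast (show (a : ℝ) < b by linarith), hab⟩
  have hl1 : (listEstimator w D lam y).Pairwise fun a b : ℕ => a < b := by
    rw [listEstimator_eq_filter hlam y]
    exact List.pairwise_lt_range.filter _
  have hl2 : (listEstimator w D lam y).Pairwise fun a b : ℕ =>
      lam * y.length ≤ |(b : ℝ) - (a : ℝ)| :=
    (List.mergeSort_perm _ _).symm.pairwise (pairwise_greedySelect _ _ _)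
      fun {a b} hab => by rwa [abs_sub_comm]
  unfold boundaries
  refine List.pairwise_cons.2 ⟨fun b hb => key _ _ ?_, List.pairwise_append.2
    ⟨(hl1.and hl2).imp fun {a b} hab => key _ _ ?_, List.pairwise_singleton _ _,
      fun a ha b hb => key _ _ ?_⟩⟩
  · rw [Nat.cast_zero, zero_add]
    rcases List.mem_append.1 hb with hb | hb
    · exact (of_mem_listEstimator hb).2.1
    · rw [List.mem_singleton.1 hb]
      nlinarith [(Nat.cast_nonneg y.length : (0 : ℝ) ≤ y.length)]
  · have h1 : (a : ℝ) < b := by exact_mod_cast hab.1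
    have h2 := hab.2
    rw [abs_of_pos (by linarith)] at h2
    linarith
  · rw [List.mem_singleton.1 hb]
    exact (of_mem_listEstimator ha).2.2

theorem getD_mem {l : List ℕ} {i : ℕ} (h : i < l.length) : l.getD i 0 ∈ l := by
  rw [List.getD_eq_getElem _ _ h]; exact List.getElem_mem h

/-- In a sorted list, the successor of an entry is at most any larger entry. -/
theorem getD_succ_le_of_mem {l : List ℕ} (hl : l.Pairwise (· < ·)) {i a : ℕ} (ha : a ∈ l)
    (h : l.getD i 0 < a) : l.getD (i + 1) 0 ≤ a := by
  obtain ⟨j, hj, rfl⟩ := List.getElem_of_mem ha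
  rcases lt_or_ge (i + 1) l.length with hi | hi
  · rw [List.getD_eq_getElem _ _ (by omega)] at h
    rw [List.getD_eq_getElem _ _ hi]
    rcases lt_trichotomy (i + 1) j with hij | rfl | hij
    · exact (List.pairwise_iff_getElem.1 hl _ _ hi hj hij).le
    · exact le_rfl
    · rcases (Nat.lt_succ_iff.1 hij).eq_or_lt with rfl | hij'
      · exact absurd h (lt_irrefl _)
      · exact absurd h (List.pairwise_iff_getElem.1 hl _ _ hj (by omega) hij').not_gt
  · rw [List.getD_eq_default _ _ hi]; exact Nat.zero_le _

include hw hws hD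

/-- The first part of a segment between estimated change points lies, in the limit, in a single
segment of the sample: no change point is missed. -/
theorem IsGeneric.exists_empTendsto_segment (h : IsGeneric lam θ x p) {𝒰 : Ultrafilter ℕ}
    (hl : (𝒰 : Filter ℕ) ≤ atTop) {k m : ℕ → ℕ}
    (hk : ∀ᶠ n in (𝒰 : Filter ℕ), k n < (segments w D lam (pwSample θ x n)).length) {τ : ℝ}
    (hτ : 0 < τ) (hm : HasRate 𝒰 m τ) (hmle : ∀ n, (m n : ℝ) ≤ lam * (pwSample θ x n).length) :
    ∃ j σ, HasRate 𝒰 (fun n => (boundaries w D lam (pwSample θ x n)).getD (k n) 0) σ ∧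
      θ j.castSucc ≤ σ ∧ σ < θ j.succ ∧
      EmpTendsto (𝒰 : Filter ℕ)
        (fun n => ((segments w D lam (pwSample θ x n)).getD (k n) []).take (m n)) (p j) := by
  have hL := h.hasRate_length hl
  have hlam1 : lam ≤ 1 := by
    have := h.sep 0
    have := h.lt_one 0
    have := h.nonneg (Fin.castSucc 0)
    linarith
  have hne : ∀ᶠ n in (𝒰 : Filter ℕ), pwSample θ x n ≠ [] := by
    filter_upwards [(hL.tendsto_atTop hl h.last_pos).eventually_gt_atTop 0] with n hn
    exact List.length_pos_iff.1 hn
  set b : ℕ → ℕ := fun n => (boundaries w D lam (pwSample θ x n)).getD (k n) 0 with hb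
  set e : ℕ → ℕ := fun n => (boundaries w D lam (pwSample θ x n)).getD (k n + 1) 0 with he
  have hbL : ∀ᶠ n in (𝒰 : Filter ℕ), b n ≤ (pwSample θ x n).length := by
    filter_upwards [hk] with n hn
    exact le_of_mem_boundaries h.lam_pos (getD_mem (by rw [length_boundaries]; omega))
  have heL : ∀ᶠ n in (𝒰 : Filter ℕ), e n ≤ (pwSample θ x n).length := by
    filter_upwards [hk] with n hn
    exact le_of_mem_boundaries h.lam_pos (getD_mem (by rw [length_boundaries]; omega))
  have hbe : ∀ᶠ n in (𝒰 : Filter ℕ), b n + m n ≤ e n := by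
    filter_upwards [hk, hne] with n hn hn'
    have hlen := length_boundaries w D lam (pwSample θ x n)
    have h1 := (List.pairwise_iff_getElem.1 (pairwise_boundaries (w := w) (D := D) h.lam_pos hlam1
      hn') (k n) (k n + 1) (by omega) (by omega) (by omega)).2
    have h2 := hmle n
    simp only [hb, he]
    rw [List.getD_eq_getElem _ _ (by omega), List.getD_eq_getElem _ _ (by omega)]
    exact_mod_cast (show (((boundaries w D lam (pwSample θ x n))[k n]'(by omega) : ℕ) : ℝ) + m n ≤
      ((boundaries w D lam (pwSample θ x n))[k n + 1]'(by omega) : ℕ) by linarith)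
  obtain ⟨σ, hσ⟩ := exists_hasRate hL hbL
  have hf := hσ.add hm
  have hfL : ∀ᶠ n in (𝒰 : Filter ℕ), b n + m n ≤ (pwSample θ x n).length := by
    filter_upwards [hbe, heL] with n h1 h2 using h1.trans h2
  have hσ0 := (hasRate_const hl 0).le hσ (Eventually.of_forall fun n => Nat.zero_le _)
  obtain ⟨j, hj1, hj2⟩ := exists_segment (θ := θ) (α := σ) (β := σ + τ) (by rw [h.zero]; exact hσ0)
    (by linarith) (hf.le hL hfL) fun i hi => by
      obtain ⟨s, hs, hs'⟩ := h.exists_mem_listEstimator hw hws hD hl i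
      obtain ⟨n, h1, h2, h3, h4, h5⟩ := (hs.and ((hσ.eventually_lt hl hs' hi.1).and
        ((hs'.eventually_lt hl hf hi.2).and (hbe.and hne)))).exists
      have h6 := getD_succ_le_of_mem ((pairwise_boundaries (w := w) (D := D) h.lam_pos hlam1
        h5).imp fun h => h.1) (show s n ∈ boundaries w D lam (pwSample θ x n) by
          simp only [boundaries, List.mem_cons, List.mem_append]; tauto) h2
      simp only [he] at h4
      omega
  refine ⟨j, σ, hσ, hj1, by linarith, ?_⟩
  have := h.empTendsto_single hl hσ hf (by linarith) hfL hj1 hj2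
  have hcongr : ∀ᶠ n in (𝒰 : Filter ℕ), seg (pwSample θ x n) (b n) (b n + m n) =
      ((segments w D lam (pwSample θ x n)).getD (k n) []).take (m n) := by
    filter_upwards [hk, hbe] with n h1 h2
    rw [List.getD_eq_getElem _ _ h1, take_segments h1, min_eq_left h2]
  exact ⟨this.length.congr' (hcongr.mono fun n hn => by rw [hn]),
    fun u v i => (this.freq u v i).congr' (hcongr.mono fun n hn => by simp only [hn])⟩

/-- Every segment of the sample is represented by a segment between estimated change points. -/
theorem IsGeneric.exists_index_segment (h : IsGeneric lam θ x p) {𝒰 : Ultrafilter ℕ}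
    (hl : (𝒰 : Filter ℕ) ≤ atTop) {m : ℕ → ℕ} {τ : ℝ} (hτ : 0 < τ) (hm : HasRate 𝒰 m τ)
    (hmle : ∀ n, (m n : ℝ) ≤ lam * (pwSample θ x n).length) (j : Fin (κ + 1)) :
    ∃ k : ℕ → ℕ, (∀ᶠ n in (𝒰 : Filter ℕ), k n < (segments w D lam (pwSample θ x n)).length) ∧
      EmpTendsto (𝒰 : Filter ℕ)
        (fun n => ((segments w D lam (pwSample θ x n)).getD (k n) []).take (m n)) (p j) := by
  obtain ⟨s, hs, hs'⟩ : ∃ s : ℕ → ℕ, (∀ᶠ n in (𝒰 : Filter ℕ),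
      s n ∈ 0 :: listEstimator w D lam (pwSample θ x n)) ∧ HasRate 𝒰 s (θ j.castSucc) := by
    rcases Fin.eq_zero_or_eq_succ j with rfl | ⟨i, rfl⟩
    · exact ⟨fun _ => 0, Eventually.of_forall fun n => List.mem_cons_self, by
        rw [Fin.castSucc_zero, h.zero]; exact hasRate_const hl 0⟩
    · obtain ⟨s, hs, hs'⟩ := h.exists_mem_listEstimator hw hws hD hl i
      exact ⟨s, hs.mono fun n hn => List.mem_cons_of_mem _ hn, hs'⟩
  have hidx : ∀ n, ∃ k : ℕ, s n ∈ 0 :: listEstimator w D lam (pwSample θ x n) →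
      k < (segments w D lam (pwSample θ x n)).length ∧
        (boundaries w D lam (pwSample θ x n)).getD k 0 = s n := by
    intro n
    by_cases hn : s n ∈ 0 :: listEstimator w D lam (pwSample θ x n)
    · obtain ⟨k, hk, hks⟩ := List.getElem_of_mem hn
      refine ⟨k, fun _ => ⟨by rw [length_segments]; simpa using hk, ?_⟩⟩
      rw [boundaries, ← List.cons_append, List.getD_append _ _ _ _ hk, List.getD_eq_getElem _ _ hk,
        hks]
    · exact ⟨0, fun h' => absurd h' hn⟩
  choose k hk using hidx
  have hk1 : ∀ᶠ n in (𝒰 : Filter ℕ), k n < (segments w D lam (pwSample θ x n)).length :=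
    hs.mono fun n hn => (hk n hn).1
  obtain ⟨j', σ, hσ, h1, h2, h3⟩ := h.exists_empTendsto_segment hw hws hD hl hk1 hτ hm hmle
  have hσj : σ = θ j.castSucc := tendsto_nhds_unique hσ
    (hs'.congr' (hs.mono fun n hn => by simp only [(hk n hn).2]))
  rw [hσj] at h1 h2
  have h1' := h.strictMono.le_iff_le.1 h1
  have h2' := h.strictMono.lt_iff_lt.1 h2
  have : j' = j := by
    rw [Fin.le_def] at h1'
    rw [Fin.lt_def] at h2'
    simp only [Fin.val_castSucc, Fin.val_succ] at h1' h2'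
    exact Fin.ext (by omega)
  subst this
  exact ⟨k, hk1, h3⟩

end list

/-! ### Consistency of the estimated distance between samples -/

theorem empDist_nonneg {w : ℕ → ℝ} (hw : ∀ j, 1 ≤ j → 0 < w j) (D : ℕ → ℕ∞) (y y' : List ℝ) :
    0 ≤ empDist w D y y' := by
  refine tsum_nonneg fun u => tsum_nonneg fun v => ?_
  split_ifs
  · exact mul_nonneg (mul_pos (hw _ (by omega)) (hw _ (by omega))).le
      (tsum_nonneg fun k => abs_nonneg _)
  · exact le_rfl

theorem maxMinDist_nonneg {w : ℕ → ℝ} (hw : ∀ j, 1 ≤ j → 0 < w j) (D : ℕ → ℕ∞) (n : ℕ)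
    (S S' : List (List ℝ)) : 0 ≤ maxMinDist w D n S S' :=
  Real.iSup_nonneg fun _ => Real.iInf_nonneg fun _ => empDist_nonneg hw D _ _

theorem exists_maxMinDist_le {w : ℕ → ℝ} {D : ℕ → ℕ∞} {n : ℕ} {S S' : List (List ℝ)}
    (hS : S ≠ []) : ∃ a < S.length, ∀ b < S'.length,
      maxMinDist w D n S S' ≤ empDist w D ((S.getD a []).take n) ((S'.getD b []).take n) := by
  have : Nonempty (Fin S.length) := ⟨⟨0, List.length_pos_iff.2 hS⟩⟩
  obtain ⟨a, ha⟩ := exists_eq_ciSup_of_finite (f := fun a : Fin S.length =>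
    ⨅ b : Fin S'.length, empDist w D ((S.get a).take n) ((S'.get b).take n))
  refine ⟨a, a.2, fun b hb => ?_⟩
  rw [maxMinDist, ← ha, List.getD_eq_getElem _ _ a.2, List.getD_eq_getElem _ _ hb]
  exact ciInf_le (Set.finite_range _).bddBelow (⟨b, hb⟩ : Fin S'.length)

theorem exists_le_maxMinDist {w : ℕ → ℝ} {D : ℕ → ℕ∞} {n a : ℕ} {S S' : List (List ℝ)}
    (hS' : S' ≠ []) (ha : a < S.length) : ∃ b < S'.length,
      empDist w D ((S.getD a []).take n) ((S'.getD b []).take n) ≤ maxMinDist w D n S S' := by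
  have : Nonempty (Fin S'.length) := ⟨⟨0, List.length_pos_iff.2 hS'⟩⟩
  obtain ⟨b, hb⟩ := exists_eq_ciInf_of_finite (f := fun b : Fin S'.length =>
    empDist w D ((S.get ⟨a, ha⟩).take n) ((S'.get b).take n))
  refine ⟨b, b.2, ?_⟩
  rw [List.getD_eq_getElem _ _ ha, List.getD_eq_getElem _ _ b.2]
  refine hb.le.trans ?_
  exact le_ciSup (f := fun a : Fin S.length =>
    ⨅ b : Fin S'.length, empDist w D ((S.get a).take n) ((S'.get b).take n))
    (Set.finite_range _).bddAbove ⟨a, ha⟩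

theorem segments_ne_nil (w : ℕ → ℝ) (D : ℕ → ℕ∞) (lam : ℝ) (y : List ℝ) :
    segments w D lam y ≠ [] := by
  rw [← List.length_pos_iff, length_segments]; omega

section delta
variable {w : ℕ → ℝ} {D : ℕ → ℕ∞} {κ κ' : ℕ} {lam : ℝ} {θ : Fin (κ + 2) → ℝ}
  {x : Fin (κ + 1) → ℕ → ℝ} {p : Fin (κ + 1) → CubeFamily} {θ' : Fin (κ' + 2) → ℝ}
  {x' : Fin (κ' + 1) → ℕ → ℝ} {p' : Fin (κ' + 1) → CubeFamily}

/-- The number of terms that are compared by the estimated distance. -/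
def comparedLength (lam : ℝ) (y y' : List ℝ) : ℕ := ⌊min (lam * y.length) (lam * y'.length)⌋₊

theorem comparedLength_comm (lam : ℝ) (y y' : List ℝ) :
    comparedLength lam y y' = comparedLength lam y' y := by
  rw [comparedLength, min_comm, comparedLength]

theorem comparedLength_le (hlam : 0 ≤ lam) (y y' : List ℝ) :
    (comparedLength lam y y' : ℝ) ≤ lam * y.length :=
  (Nat.floor_le (le_min (by positivity) (by positivity))).trans (min_le_left _ _)

theorem IsGeneric.hasRate_comparedLength (h : IsGeneric lam θ x p) (h' : IsGeneric lam θ' x' p')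
    {l : Filter ℕ} (hl : l ≤ atTop) :
    ∃ τ, 0 < τ ∧ HasRate l (fun n => comparedLength lam (pwSample θ x n) (pwSample θ' x' n)) τ := by
  refine ⟨min (lam * θ (Fin.last (κ + 1))) (lam * θ' (Fin.last (κ' + 1))),
    lt_min (mul_pos h.lam_pos h.last_pos) (mul_pos h.lam_pos h'.last_pos), ?_⟩
  have hlam := h.lam_pos.le
  refine hasRate_floor hl (fun n => le_min (by positivity) (by positivity)) ?_
  refine ((Tendsto.const_mul lam (h.hasRate_length hl)).min
    (Tendsto.const_mul lam (h'.hasRate_length hl))).congr fun n => ?_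
  rw [← mul_div_assoc, ← mul_div_assoc, min_div_div_right (Nat.cast_nonneg n)]

variable (hw : ∀ j, 1 ≤ j → 0 < w j) (hws : Summable w) (hD : Tendsto D atTop (𝓝 ⊤))
include hw hws hD

/-- If all laws of the first sample occur in the second one, each estimated segment of the first sample
has a counterpart in the second one. -/
theorem IsGeneric.tendsto_maxMinDist_zero (h : IsGeneric lam θ x p)
    (h' : IsGeneric lam θ' x' p') (hpp : ∀ j, ∃ j', p j = p' j') {𝒰 : Ultrafilter ℕ}
    (hl : (𝒰 : Filter ℕ) ≤ atTop) :
    Tendsto (fun n => maxMinDist w D (comparedLength lam (pwSample θ x n) (pwSample θ' x' n))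
      (segments w D lam (pwSample θ x n)) (segments w D lam (pwSample θ' x' n))) 𝒰 (𝓝 0) := by
  obtain ⟨τ, hτ, hm⟩ := h.hasRate_comparedLength h' hl
  choose k hk hk' using fun n => exists_maxMinDist_le (w := w) (D := D)
    (n := comparedLength lam (pwSample θ x n) (pwSample θ' x' n))
    (S' := segments w D lam (pwSample θ' x' n)) (segments_ne_nil w D lam (pwSample θ x n))
  obtain ⟨j, -, -, -, -, hj⟩ := h.exists_empTendsto_segment hw hws hD hl
    (Eventually.of_forall hk) hτ hm (fun n => comparedLength_le h.lam_pos.le _ _)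
  obtain ⟨j', hjj⟩ := hpp j
  obtain ⟨b, hb, hb'⟩ := h'.exists_index_segment hw hws hD hl hτ hm
    (fun n => by rw [comparedLength_comm]; exact comparedLength_le h.lam_pos.le _ _) j'
  have lim := tendsto_empDist hw hws hD hj hb' (h.prob j) (h'.prob j')
  rw [hjj, familyDist_self] at lim
  exact tendsto_of_tendsto_of_tendsto_of_le_of_le' tendsto_const_nhds lim
    (Eventually.of_forall fun n => maxMinDist_nonneg hw D _ _ _)
    (hb.mono fun n hn => hk' n _ hn)

/-- If the law `p j` has distance greater than `c` from all laws of the second sample, then no estimated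
segment of the second sample is close to the one that represents the segment `j` of the first one. -/
theorem IsGeneric.eventually_le_maxMinDist (h : IsGeneric lam θ x p)
    (h' : IsGeneric lam θ' x' p') {j : Fin (κ + 1)} {c : ℝ}
    (hc : ∀ j', c < familyDist w (p j) (p' j')) {𝒰 : Ultrafilter ℕ}
    (hl : (𝒰 : Filter ℕ) ≤ atTop) : ∀ᶠ n in (𝒰 : Filter ℕ),
      c < maxMinDist w D (comparedLength lam (pwSample θ x n) (pwSample θ' x' n))
        (segments w D lam (pwSample θ x n)) (segments w D lam (pwSample θ' x' n)) := by
  obtain ⟨τ, hτ, hm⟩ := h.hasRate_comparedLength h' hl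
  obtain ⟨k, hk, hk'⟩ := h.exists_index_segment hw hws hD hl hτ hm
    (fun n => comparedLength_le h.lam_pos.le _ _) j
  have hb : ∀ n, ∃ b < (segments w D lam (pwSample θ' x' n)).length,
      k n < (segments w D lam (pwSample θ x n)).length →
      empDist w D (((segments w D lam (pwSample θ x n)).getD (k n) []).take
          (comparedLength lam (pwSample θ x n) (pwSample θ' x' n)))
        (((segments w D lam (pwSample θ' x' n)).getD b []).take
          (comparedLength lam (pwSample θ x n) (pwSample θ' x' n))) ≤
      maxMinDist w D (comparedLength lam (pwSample θ x n) (pwSample θ' x' n))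
        (segments w D lam (pwSample θ x n)) (segments w D lam (pwSample θ' x' n)) := by
    intro n
    by_cases hn : k n < (segments w D lam (pwSample θ x n)).length
    · obtain ⟨b, hb, hb'⟩ := exists_le_maxMinDist (w := w) (D := D)
        (n := comparedLength lam (pwSample θ x n) (pwSample θ' x' n))
        (segments_ne_nil w D lam (pwSample θ' x' n)) hn
      exact ⟨b, hb, fun _ => hb'⟩
    · exact ⟨0, by rw [length_segments]; omega, fun h => absurd h hn⟩
  choose b hb hb' using hb
  obtain ⟨j', -, -, -, -, hj'⟩ := h'.exists_empTendsto_segment hw hws hD hl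
    (Eventually.of_forall hb) hτ hm
    (fun n => by rw [comparedLength_comm]; exact comparedLength_le h.lam_pos.le _ _)
  have lim := tendsto_empDist hw hws hD hk' hj' (h.prob j) (h'.prob j')
  filter_upwards [lim.eventually (lt_mem_nhds (hc j')), hk] with n h1 h2
  exact h1.trans_le (hb' n h2)

/-- The estimated distance of samples with the same set of distributions tends to zero. -/
theorem IsGeneric.tendsto_empDelta_zero (h : IsGeneric lam θ x p)
    (h' : IsGeneric lam θ' x' p') (hpp : Set.range p = Set.range p') :
    Tendsto (fun n => empDelta w D lam (pwSample θ x n) (pwSample θ' x' n)) atTop (𝓝 0) := by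
  rw [tendsto_iff_ultrafilter]
  intro 𝒰 hl
  have h1 := h.tendsto_maxMinDist_zero hw hws hD h' (fun j => by
    obtain ⟨j', hj'⟩ := hpp ▸ Set.mem_range_self (f := p) j
    exact ⟨j', hj'.symm⟩) hl
  have h2 := h'.tendsto_maxMinDist_zero hw hws hD h (fun j => by
    obtain ⟨j', hj'⟩ := hpp ▸ Set.mem_range_self (f := p') j
    exact ⟨j', hj'.symm⟩) hl
  have h12 := h1.add h2
  rw [add_zero] at h12
  refine h12.congr fun n => ?_
  rw [comparedLength_comm lam (pwSample θ' x' n)]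
  rfl

/-- The estimated distance of samples with different sets of distributions stays away from zero. -/
theorem IsGeneric.exists_eventually_le_empDelta (h : IsGeneric lam θ x p)
    (h' : IsGeneric lam θ' x' p') (hpp : Set.range p ≠ Set.range p') :
    ∃ c, 0 < c ∧ ∀ᶠ n in atTop, c < empDelta w D lam (pwSample θ x n) (pwSample θ' x' n) := by
  have key : ∀ {κ κ' : ℕ} {θ : Fin (κ + 2) → ℝ} {x : Fin (κ + 1) → ℕ → ℝ}
      {p : Fin (κ + 1) → CubeFamily} {θ' : Fin (κ' + 2) → ℝ} {x' : Fin (κ' + 1) → ℕ → ℝ}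
      {p' : Fin (κ' + 1) → CubeFamily}, IsGeneric lam θ x p → IsGeneric lam θ' x' p' →
      ¬ Set.range p ⊆ Set.range p' → ∃ c, 0 < c ∧ ∀ᶠ n in atTop,
        c < maxMinDist w D (comparedLength lam (pwSample θ x n) (pwSample θ' x' n))
        (segments w D lam (pwSample θ x n)) (segments w D lam (pwSample θ' x' n)) := by
    intro κ κ' θ x p θ' x' p' h h' hpp
    obtain ⟨_, ⟨j, rfl⟩, hj⟩ := Set.not_subset.1 hpp
    obtain ⟨j0, hj0⟩ := Finite.exists_min fun j' => familyDist w (p j) (p' j')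
    have hpos := familyDist_pos hw hws (h.prob j) (h'.prob j0) fun e => hj ⟨j0, e.symm⟩
    refine ⟨_, half_pos hpos, ?_⟩
    refine mem_iff_ultrafilter.2 fun 𝒰 hl => ?_
    exact h.eventually_le_maxMinDist hw hws hD h' (fun j' =>
      (half_lt_self hpos).trans_le (hj0 j')) hl
  have e : ∀ n, empDelta w D lam (pwSample θ x n) (pwSample θ' x' n) =
      maxMinDist w D (comparedLength lam (pwSample θ x n) (pwSample θ' x' n))
        (segments w D lam (pwSample θ x n)) (segments w D lam (pwSample θ' x' n)) +
      maxMinDist w D (comparedLength lam (pwSample θ' x' n) (pwSample θ x n))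
        (segments w D lam (pwSample θ' x' n)) (segments w D lam (pwSample θ x n)) := fun n => by
    rw [comparedLength_comm lam (pwSample θ' x' n)]; rfl
  simp only [e]
  by_cases hs : Set.range p ⊆ Set.range p'
  · obtain ⟨c, hc, hc'⟩ := key h' h fun hs' => hpp (hs.antisymm hs')
    exact ⟨c, hc, hc'.mono fun n hn => lt_add_of_nonneg_of_lt (maxMinDist_nonneg hw D _ _ _) hn⟩
  · obtain ⟨c, hc, hc'⟩ := key h h' hs
    exact ⟨c, hc, hc'.mono fun n hn => lt_add_of_lt_of_nonneg hn (maxMinDist_nonneg hw D _ _ _)⟩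

end delta

/-! ### Clustering with a separated distance -/

open Classical in
/-- If `δ` is less than `ε` on samples of the same class and at least `ε` on samples of different
classes, then the algorithm with the right number of clusters returns the classes. -/
theorem image_cluster_eq {N : ℕ} [NeZero N] {β : Type*} (M : Fin N → β) {δ : Fin N → Fin N → ℝ}
    {ε : ℝ} (hsame : ∀ i j, M i = M j → δ i j < ε) (hdiff : ∀ i j, M i ≠ M j → ε ≤ δ i j) :
    (Finset.range (Set.range M).ncard).image (cluster δ (Set.range M).ncard) =
      Finset.univ.image fun i => Finset.univ.filter fun j => M j = M i := by
  set m := (Set.range M).ncard with hm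
  have hcard : (Finset.univ.image M).card = m := by
    rw [hm, ← Set.ncard_coe_finset, Finset.coe_image, Finset.coe_univ, Set.image_univ]
  have hm0 : m ≠ 0 := by
    rw [← hcard, Finset.card_ne_zero]
    exact ⟨M 0, Finset.mem_image_of_mem _ (Finset.mem_univ _)⟩
  -- a new centre is far from all previous ones as long as some class has no centre
  have hnew : ∀ ℓ < m, ∀ j < ℓ, M (centre δ ℓ) ≠ M (centre δ j) := by
    intro ℓ hℓ j hj he
    have : Nonempty (Fin ℓ) := ⟨⟨j, hj⟩⟩
    obtain ⟨b, hb, hb'⟩ := Finset.exists_mem_notMem_of_card_lt_card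
      (s := (Finset.range ℓ).image fun j => M (centre δ j)) (t := Finset.univ.image M)
      (by rw [hcard]; exact Finset.card_image_le.trans_lt (by rwa [Finset.card_range]))
    obtain ⟨i, -, rfl⟩ := Finset.mem_image.1 hb
    have h1 : ε ≤ minDist δ ℓ i := by
      rw [minDist_eq]
      exact le_ciInf fun a => hdiff _ _ fun h => hb' (Finset.mem_image.2
        ⟨a, Finset.mem_range.2 a.2, h.symm⟩)
    have h2 := List.le_of_mem_argmax (List.mem_finRange i) (argmax_minDist δ ℓ)
    have h3 : minDist δ ℓ (centre δ ℓ) ≤ δ (centre δ ℓ) (centre δ j) := by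
      rw [minDist_eq]
      exact ciInf_le (Set.finite_range fun a : Fin ℓ => δ (centre δ ℓ) (centre δ a)).bddBelow ⟨j, hj⟩
    linarith [hsame _ _ he]
  have hinj : Set.InjOn (fun ℓ => M (centre δ ℓ)) (Finset.range m) := by
    intro a ha b hb he
    rw [Finset.mem_coe, Finset.mem_range] at ha hb
    rcases lt_trichotomy a b with h | h | h
    · exact absurd he.symm (hnew b hb a h)
    · exact h
    · exact absurd he (hnew a ha b h)
  have himg : (Finset.range m).image (fun ℓ => M (centre δ ℓ)) = Finset.univ.image M := by
    refine Finset.eq_of_subset_of_card_le (fun b hb => ?_) ?_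
    · obtain ⟨ℓ, -, rfl⟩ := Finset.mem_image.1 hb
      exact Finset.mem_image_of_mem _ (Finset.mem_univ _)
    · rw [hcard, Finset.card_image_of_injOn hinj, Finset.card_range]
  have hex : ∀ i, ∃ ℓ < m, M (centre δ ℓ) = M i := fun i => by
    have : M i ∈ (Finset.range m).image (fun ℓ => M (centre δ ℓ)) := by
      rw [himg]; exact Finset.mem_image_of_mem _ (Finset.mem_univ _)
    obtain ⟨ℓ, hℓ, h⟩ := Finset.mem_image.1 this
    exact ⟨ℓ, Finset.mem_range.1 hℓ, h⟩
  have hlabel : ∀ i, label δ m i < m ∧ M (centre δ (label δ m i)) = M i := by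
    intro i
    have h1 := argmin_eq_label δ hm0 i
    refine ⟨List.mem_range.1 (List.argmin_mem h1), ?_⟩
    obtain ⟨ℓ, hℓ, h2⟩ := hex i
    have h3 := List.le_of_mem_argmin (List.mem_range.2 hℓ) h1
    by_contra h4
    linarith [hsame i _ h2.symm, hdiff i _ (Ne.symm h4)]
  have hcl : ∀ ℓ < m, cluster δ m ℓ = Finset.univ.filter fun j => M j = M (centre δ ℓ) := by
    intro ℓ hℓ
    ext i
    rw [mem_cluster hℓ, Finset.mem_filter]
    constructor
    · rintro (h | h)
      · exact ⟨Finset.mem_univ _, by rw [← h]; exact (hlabel i).2.symm⟩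
      · exact ⟨Finset.mem_univ _, by rw [h]⟩
    · rintro ⟨-, h⟩
      exact Or.inl (hinj (Finset.mem_coe.2 (Finset.mem_range.2 (hlabel i).1))
        (Finset.mem_coe.2 (Finset.mem_range.2 hℓ)) ((hlabel i).2.trans h))
  ext C
  simp only [Finset.mem_image, Finset.mem_range, Finset.mem_univ, true_and]
  constructor
  · rintro ⟨ℓ, hℓ, rfl⟩
    exact ⟨centre δ ℓ, (hcl ℓ hℓ).symm⟩
  · rintro ⟨i, rfl⟩
    obtain ⟨ℓ, hℓ, h⟩ := hex i
    exact ⟨ℓ, hℓ, by rw [hcl ℓ hℓ, h]⟩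

/-! ### Almost sure consistency -/

section consistency
variable {N : ℕ} {κ : Fin N → ℕ} {P : Measure ((i : Fin N) → Fin (κ i + 1) → ℕ → ℝ)}
  [IsProbabilityMeasure P]

theorem measurable_coord (i : Fin N) :
    Measurable fun ω : (i : Fin N) → Fin (κ i + 1) → ℕ → ℝ => ω i := measurable_pi_apply i

instance isProbabilityMeasure_sampleLaw (i : Fin N) : IsProbabilityMeasure (sampleLaw P i) :=
  Measure.isProbabilityMeasure_map (measurable_coord i).aemeasurable

instance isProbabilityMeasure_rowLaw {κ : ℕ} (ρ : Measure (Fin (κ + 1) → ℕ → ℝ))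
    [IsProbabilityMeasure ρ] (j : Fin (κ + 1)) : IsProbabilityMeasure (rowLaw ρ j) :=
  Measure.isProbabilityMeasure_map (measurable_pi_apply j).aemeasurable

omit [IsProbabilityMeasure P] in
/-- Almost surely, every row has the limiting frequencies that its law prescribes. -/
theorem ae_tendsto_empFamily (hP : ∀ i, IsPiecewiseStationaryErgodic (sampleLaw P i)) :
    ∀ᵐ ω ∂P, ∀ (i : Fin N) (j : Fin (κ i + 1)) (u v : ℕ) (k : Fin (u + 1) → ℤ),
      Tendsto (fun n => empFamily n (ω i j) u v k) atTop
        (𝓝 (lawFamily (rowLaw (sampleLaw P i) j) u v k)) := by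
  simp only [ae_all_iff]
  intro i j u v k
  have h := ((hP i).1 j).2 (u + 1) (dyadicCube (v + 1) k) (measurableSet_dyadicCube _ _)
  exact ae_of_ae_map (measurable_coord i).aemeasurable
    (ae_of_ae_map (measurable_pi_apply j).aemeasurable h)

theorem minSeparation_le (θ : (i : Fin N) → Fin (κ i + 2) → ℝ) (i : Fin N) (k : Fin (κ i + 1)) :
    minSeparation θ ≤ θ i k.succ - θ i k.castSucc :=
  (ciInf_le (f := fun i : Fin N => ⨅ k : Fin (κ i + 1), (θ i k.succ - θ i k.castSucc))
    (Set.finite_range _).bddBelow i).trans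
  (ciInf_le (f := fun k : Fin (κ i + 1) => θ i k.succ - θ i k.castSucc)
    (Set.finite_range _).bddBelow k)

/-- The sets of laws agree if and only if the sets of their families of probabilities do. -/
theorem range_lawFamily_eq_iff (i i' : Fin N) :
    (Set.range fun j => lawFamily (rowLaw (sampleLaw P i) j)) =
        (Set.range fun j => lawFamily (rowLaw (sampleLaw P i') j)) ↔
      segmentLaws (sampleLaw P i) = segmentLaws (sampleLaw P i') := by
  have key : ∀ i i' : Fin N, (∀ j, ∃ j', lawFamily (rowLaw (sampleLaw P i') j') =
      lawFamily (rowLaw (sampleLaw P i) j)) ↔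
      segmentLaws (sampleLaw P i) ⊆ segmentLaws (sampleLaw P i') := by
    intro i i'
    rw [segmentLaws, Set.range_subset_iff]
    refine forall_congr' fun j => exists_congr fun j' => ?_
    exact ⟨fun h => lawFamily_injective h, fun h => by rw [h]⟩
  rw [Set.Subset.antisymm_iff, Set.Subset.antisymm_iff, Set.range_subset_iff, Set.range_subset_iff,
    ← key, ← key]
  rfl

/-- Asymptotic consistency of the clustering algorithm. -/
theorem ae_eventually_algOutput_eq [NeZero N] {w : ℕ → ℝ} (hw : ∀ j, 1 ≤ j → 0 < w j)
    (hws : Summable w) {D : ℕ → ℕ∞} (hD : Tendsto D atTop (𝓝 ⊤))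
    (hP : ∀ i, IsPiecewiseStationaryErgodic (sampleLaw P i))
    {θ : (i : Fin N) → Fin (κ i + 2) → ℝ} (h0 : ∀ i, θ i 0 = 0)
    (h1 : ∀ i (k : Fin (κ i + 1)), θ i k.succ ∈ Set.Ioo (0 : ℝ) 1) {lam : ℝ} (hlam : 0 < lam)
    (hle : lam ≤ minSeparation θ) :
    ∀ᵐ ω ∂P, ∀ᶠ n : ℕ in atTop,
      algOutput w D lam (fun i => pwSample (θ i) (ω i) n) (numClasses P) = groundTruth P := by
  filter_upwards [ae_tendsto_empFamily hP] with ω hω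
  have hgen : ∀ i, IsGeneric lam (θ i) (ω i) fun j => lawFamily (rowLaw (sampleLaw P i) j) :=
    fun i => ⟨hlam, h0 i, fun k => (h1 i k).2, fun k => hle.trans (minSeparation_le θ i k), hω i,
      fun j => isProbFamily_lawFamily _, fun k h => (hP i).2 k (lawFamily_injective h)⟩
  have hdiff : ∀ i i', ∃ c, 0 < c ∧ (segmentLaws (sampleLaw P i) ≠ segmentLaws (sampleLaw P i') →
      ∀ᶠ n in atTop, c < empDelta w D lam (pwSample (θ i) (ω i) n) (pwSample (θ i') (ω i') n)) := by
    intro i i'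
    by_cases he : segmentLaws (sampleLaw P i) = segmentLaws (sampleLaw P i')
    · exact ⟨1, one_pos, fun h => absurd he h⟩
    · obtain ⟨c, hc, hc'⟩ := (hgen i).exists_eventually_le_empDelta hw hws hD (hgen i')
        fun h => he ((range_lawFamily_eq_iff i i').1 h)
      exact ⟨c, hc, fun _ => hc'⟩
  choose c hc hc' using hdiff
  -- a threshold that serves all pairs
  obtain ⟨⟨i0, i0'⟩, hmin⟩ := Finite.exists_min fun q : Fin N × Fin N => c q.1 q.2
  have key : ∀ i i', ∀ᶠ n in atTop,
      (segmentLaws (sampleLaw P i) = segmentLaws (sampleLaw P i') →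
        empDelta w D lam (pwSample (θ i) (ω i) n) (pwSample (θ i') (ω i') n) < c i0 i0') ∧
      (segmentLaws (sampleLaw P i) ≠ segmentLaws (sampleLaw P i') →
        c i0 i0' ≤ empDelta w D lam (pwSample (θ i) (ω i) n) (pwSample (θ i') (ω i') n)) := by
    intro i i'
    by_cases he : segmentLaws (sampleLaw P i) = segmentLaws (sampleLaw P i')
    · filter_upwards [((hgen i).tendsto_empDelta_zero hw hws hD (hgen i')
        ((range_lawFamily_eq_iff i i').2 he)).eventually (gt_mem_nhds (hc i0 i0'))] with n hn
      exact ⟨fun _ => hn, fun h => absurd he h⟩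
    · filter_upwards [hc' i i' he] with n hn
      exact ⟨fun h => absurd h he, fun _ => (hmin (i, i')).trans hn.le⟩
  filter_upwards [eventually_all.2 fun i => eventually_all.2 (key i)] with n hn
  exact image_cluster_eq (fun i => segmentLaws (sampleLaw P i)) (fun i j => (hn i j).1)
    fun i j => (hn i j).2

end consistency

end PSClust

end

theorem mainTheorem1 :
    -- asymptotic consistency
    (∀ (w : ℕ → ℝ), (∀ j, 1 ≤ j → 0 < w j) → Summable w →
      ∀ (D : ℕ → ℕ∞), Tendsto D atTop (𝓝 ⊤) →
      ∀ (N : ℕ) [NeZero N] (κ : Fin N → ℕ)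
        (P : Measure ((i : Fin N) → Fin (κ i + 1) → ℕ → ℝ)) [IsProbabilityMeasure P],
      (∀ i, IsPiecewiseStationaryErgodic (sampleLaw P i)) →
      ∀ (θ : (i : Fin N) → Fin (κ i + 2) → ℝ),
      (∀ i, θ i 0 = 0) → (∀ i (k : Fin (κ i + 1)), θ i k.succ ∈ Set.Ioo (0 : ℝ) 1) →
      ∀ lam : ℝ, 0 < lam → lam ≤ minSeparation θ →
        ∀ᵐ ω ∂P, ∀ᶠ n : ℕ in atTop,
          algOutput w D lam (fun i => pwSample (θ i) (ω i) n) (numClasses P) = groundTruth P) ∧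
    -- running time, with the series of the empirical distance cut off at the logarithm
    (∃ (p : Prog) (c : ℝ) (d : ℕ),
      ∀ (w : ℕ → ℝ), (∀ j, 1 ≤ j → 0 < w j) → Summable w →
      ∀ lam : ℝ, 0 < lam → lam < 1 →
      ∀ (N : ℕ) [NeZero N] (m : ℕ), 1 ≤ m →
      ∀ (n : ℕ), 2 ≤ n →
      ∀ (S : Fin N → List ℝ), (∀ i, (S i).length ≤ n) →
        ∃ (σ : State) (t : ℕ), Runs p (inputState w lam S m) σ t ∧
          OutputsClusters σ m (algCluster w (fun k => (Nat.log 2 k : ℕ∞)) lam S m) ∧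
          (t : ℝ) ≤ c * (m * N * ((n : ℝ) ^ 2 * Real.log n ^ d +
            (lam ^ 2)⁻¹ * (n * Real.log n ^ d)))) := by
  exact ⟨fun _ hw hws _ hD _ _ _ _ _ hP _ h0 h1 _ hlam hle =>
    ae_eventually_algOutput_eq hw hws hD hP h0 h1 hlam hle, exists_clusterProg⟩
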